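/- **Setting.** Let $k>0$, $\alpha_1,\alpha_2\in\mathbb R$, $0<c<\tilde c$, $0<\varepsilon<\tfrac12\min\{1,\tilde c\}$, and let $m>2$ be an integer. Let $\mathcal X\in C^{m+3}(\mathbb R)$ be real valued with $\mathcal X(t)=1$ for $|t|\le c$ and $\mathcal X(t)=0$ for $|t|\ge (c+\tilde c)/2$, and let $\mathcal Y\in C^{m+3}([0,\infty))$ be real valued with $\mathcal Y=1$ on $[0,\varepsilon]$ and $\mathcal Y=0$ on $[2\varepsilon,\infty)$. Put $\beta_{n}=\sqrt{k^2-|\alpha+n|^2}$ if $|\alpha+n|\le k$ and $\beta_n=i\sqrt{|\alpha+n|^2-k^2}$ otherwise, for $n\in\mathbb Z^2$ and $\alpha=(\alpha_1,\alpha_2)$. Assume $\beta_n\ne0$ and $\beta_n\neq\pm j_3\pi/\tilde c$ for all $n\in\mathbb Z^2$, $j_3\in\mathbb Z$. **Exact tensor.** Let $$G_d(x)=\frac{i}{8\pi^2}\sum_{n\in\mathbb Z^2}\frac1{\beta_n}e^{i(\alpha_1+n_1)x_1+i(\alpha_2+n_2)x_2+i\beta_n|x_3|}\qquad(x_3\ne0),$$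 extended to $x_3=0$ by its limit as $x_3\to0$, and let $\mathbb G=G_d\mathbb I+k^{-2}\big(\partial_p\partial_qG_d\big)_{p,q=1}^3$. Let $D_{dc}=[-\pi,\pi]^2\times[-c,c]$. **Computed tensor.** Let $N\ge1$ (grid parameter) and $M\ge N$ (FFT parameter; for instance $M=N$), $S_N=\{j\in\mathbb Z^3:-N\le j_1,j_2,j_3<N\}$, $x^{(N)}_l=(l_1\pi/N,\,l_2\pi/N,\,l_3\tilde c/N)$ for $l\in\mathbb Z^3$, $\phi_j(x)=(8\pi^2\tilde c)^{-1/2}e^{i(j_1x_1+j_2x_2+j_3\pi x_3/\tilde c)}$, $c_j=(\alpha_1+j_1,\alpha_2+j_2,j_3\pi/\tilde c)$, $\gamma_j=j_3\pi/\tilde c$, $\beta_j=\beta_{(j_1,j_2)}$, $g(x)=e^{ik|x|}/(4\pi|x|)$ for $x\neq0$ and $g(0)=0$. *Preparation.* Set, by discrete Fourier transforms of $2M$ points per period and direction, $$I^{\pm}_j=\frac{\tilde c}{M}\sum_{l=0}^{M-1}e^{i(\beta_j\pm\gamma_j)\,l\tilde c/M}\,\mathcal X'(l\tilde c/M),$$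 $$H_j=\frac{\pi^2\tilde c}{M^3}\sum_{l\in S_M}\Big[g(x)\big(2ik\mathcal Y'(|x|)+\mathcal Y''(|x|)\big)e^{-i c_j\cdot x}\Big]_{x=x_l^{(M)}},$$ $$\hat L_j=\frac1{\sqrt{8\pi^2\tilde c}}\Big[\frac{1}{|c_j|^2-k^2}+\frac{I^-_j}{2\beta_j(\gamma_j-\beta_j)}-\frac{I^+_j}{2\beta_j(\gamma_j+\beta_j)}-\frac{1-H_j}{|c_j|^2-k^2}\Big],\qquad \hat L^{pq}_j=-c_j^pc_j^q\hat L_j .$$ Compute the values of $L_N=\sum_{j\in S_N}\hat L_j\phi_j$ and $L^{pq}_N=\sum_{j\in S_N}\hat L^{pq}_j\phi_j$ at the grid points $x^{(N)}_l$. *Calculation.* For $x$ with $|x_3|\le c$ let $t=(t_1,t_2,x_3)$ with $t_1,t_2\in[-\pi,\pi)$, $x_i-t_i\in2\pi\mathbb Z$. Let $L^*_N(t)$, $L^{pq,*}_N(t)$ be obtained from the ($2N$-periodically indexed) grid values by tricubic interpolation with the $4\times4\times4$ grid points around the grid cell of $t$, either by the Lagrange interpolation polynomial of degree at most $3$ in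 each variable, or by the tricubic Hermite polynomial of the cell in which the derivatives at the corners are replaced by central differences. With $F(x)=e^{-i\alpha_1x_1-i\alpha_2x_2}g(x)\mathcal Y(|x|)$ and $F^{pq}(x)=e^{-i\alpha_1x_1-i\alpha_2x_2}\partial_p\partial_q[e^{i\alpha_1x_1+i\alpha_2x_2}F(x)]$ put $$\widetilde G(x)=e^{i\alpha_1x_1+i\alpha_2x_2}\big(L_N^*(t)+F(t)\big),\quad \widetilde G^{pq}(x)=e^{i\alpha_1x_1+i\alpha_2x_2}\big(L^{pq,*}_N(t)+F^{pq}(t)\big),\quad \widetilde{\mathbb G}(x)=\widetilde G(x)\mathbb I+k^{-2}\big(\widetilde G^{pq}(x)\big)_{p,q=1}^3 .$$ **Theorem.** $G_d$ is twice continuously differentiable near every point of $D_{dc}\setminus\{0\}$, and there is a constant $C$, independent of $N$, $M$, $x$ and the choice between the two interpolations, such that for all $N\ge1$, all $M\ge N$ and all $x\in D_{dc}\setminus\{0\}$ $$\max_{j,l=1,2,3}\big|\mathbb G_{jl}(x)-\widetilde{\mathbb G}_{jl}(x)\big|\le \frac{C}{N^{\sigma}},\qquad \sigma=\min\{2,m-2\}.$$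 -/

import Mathlib

open scoped Topology

namespace MaxwellGreen

/-- Points of three-dimensional Euclidean space. The coordinates `x₁, x₂, x₃` are
`x 0, x 1, x 2`. -/
abbrev E3 : Type := EuclideanSpace ℝ (Fin 3)

/-- The data of the problem and of the method: the wave number `k`, the quasi-periodicity
parameters `α₁, α₂`, the half heights `c` and `ct` of the cells `[-π,π]² × [-c,c]` and
`[-π,π]² × [-ct,ct]`, the radius `ε`, and the cut-off functions `χ` and `Y`.
This only names the data; the conditions on them are hypotheses of the theorem. -/
structure Data where
  k : ℝ
  α₁ : ℝ
  α₂ : ℝ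
  c : ℝ
  ct : ℝ
  ε : ℝ
  χ : ℝ → ℝ
  Y : ℝ → ℝ

/-- The two families of four weights (for the nodes `-1, 0, 1, 2`) of cubic interpolation on `[0,1]`
from four equidistant values: `lagrange` is the cubic polynomial through the four values; `hermite`
is the cubic polynomial with the given values at `0` and `1` whose derivatives there are the central
differences (its tensor product in three variables is the tricubic polynomial that matches
`f, f_x, f_y, f_z, f_xy, f_xz, f_yz, f_xyz` at the eight corners of a cell, with the derivatives
replaced by central differences). -/
inductive CubicScheme : Type
  | lagrange
  | hermite

noncomputable section

/-- The weights of the nodes `-1, 0, 1, 2` at the point `s ∈ [0,1]`. -/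
def CubicScheme.weight : CubicScheme → Fin 4 → ℝ → ℝ
  | .lagrange, a, s =>
      ![-(s * (s - 1) * (s - 2)) / 6, (s + 1) * (s - 1) * (s - 2) / 2,
        -((s + 1) * s * (s - 2)) / 2, (s + 1) * s * (s - 1) / 6] a
  | .hermite, a, s =>
      ![(-s + 2 * s ^ 2 - s ^ 3) / 2, (2 - 5 * s ^ 2 + 3 * s ^ 3) / 2,
        (s + 4 * s ^ 2 - 3 * s ^ 3) / 2, (-s ^ 2 + s ^ 3) / 2] a

/-- The partial derivative of `f` in the `p`-th coordinate direction. -/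
def pderiv (p : Fin 3) (f : E3 → ℂ) (x : E3) : ℂ :=
  lineDeriv ℝ f x (EuclideanSpace.single p (1 : ℝ))

/-- The index set `S_N = {j ∈ ℤ³ : -N ≤ j₁, j₂, j₃ < N}`. -/
def indexBox (N : ℕ) : Finset (Fin 3 → ℤ) :=
  Fintype.piFinset fun _ => Finset.Ico (-(N : ℤ)) (N : ℤ)

namespace Data

variable (d : Data)

/-! ### The exact Green's function and the exact Green's tensor -/

/-- `α_{1,n₁}² + α_{2,n₂}²` with `α_{i,n} = α_i + n`. -/
def horiz (n : ℤ × ℤ) : ℝ := (d.α₁ + n.1) ^ 2 + (d.α₂ + n.2) ^ 2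

/-- The vertical wave number `β_{n₁,n₂}`. -/
def beta (n : ℤ × ℤ) : ℂ :=
  if d.horiz n ≤ d.k ^ 2 then (√(d.k ^ 2 - d.horiz n) : ℝ)
  else Complex.I * (√(d.horiz n - d.k ^ 2) : ℝ)

/-- The eigenfunction expansion at `(x₁, x₂, x₃)`; it converges absolutely for `x₃ ≠ 0`. -/
def eigenSeries (x₁ x₂ x₃ : ℝ) : ℂ :=
  Complex.I / (8 * (Real.pi : ℂ) ^ 2) *
    ∑' n : ℤ × ℤ, 1 / d.beta n *
      Complex.exp (Complex.I * ((d.α₁ + n.1 : ℝ) : ℂ) * x₁ + Complex.I * ((d.α₂ + n.2 : ℝ) : ℂ) * x₂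
        + Complex.I * d.beta n * ((|x₃| : ℝ) : ℂ))

/-- The doubly quasi-periodic Green's function `G_d` of the Helmholtz equation: the eigenfunction
expansion for `x₃ ≠ 0`, and its limit for `x₃ → 0` on the plane `x₃ = 0`, where the expansion does
not converge absolutely. -/
def green (x : E3) : ℂ :=
  if x 2 ≠ 0 then d.eigenSeries (x 0) (x 1) (x 2)
  else Filter.limUnder (𝓝[≠] (0 : ℝ)) fun t => d.eigenSeries (x 0) (x 1) t

/-- The Green's tensor of Maxwell's equations, `G_d I + k⁻² ∇∇·(G_d I)`. -/
def greenTensor (x : E3) : Matrix (Fin 3) (Fin 3) ℂ :=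
  d.green x • (1 : Matrix (Fin 3) (Fin 3) ℂ) +
    (1 / (d.k : ℂ) ^ 2) • Matrix.of fun p q => pderiv p (pderiv q d.green) x

/-- The cell `D_{dc} = [-π,π] × [-π,π] × [-c,c]`. -/
def cell : Set E3 := {x | |x 0| ≤ Real.pi ∧ |x 1| ≤ Real.pi ∧ |x 2| ≤ d.c}

/-! ### Fourier basis and grids -/

/-- Half of the periods, `(π, π, ct)`. -/
def halfPeriod : Fin 3 → ℝ := ![Real.pi, Real.pi, d.ct]

/-- `x_l = (l₁ π / N, l₂ π / N, l₃ ct / N)`, the points of the grid with `2N × 2N × 2N` points per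
period. -/
def gridPoint (N : ℕ) (l : Fin 3 → ℤ) : E3 :=
  WithLp.toLp 2 fun i => (l i : ℝ) * d.halfPeriod i / N

/-- `exp(i (j₁ x₁ + j₂ x₂ + j₃ π x₃ / ct))`. -/
def wave (j : Fin 3 → ℤ) (x : E3) : ℂ :=
  Complex.exp (Complex.I *
    (((j 0 : ℝ) * x 0 + (j 1 : ℝ) * x 1 + (j 2 : ℝ) * Real.pi / d.ct * x 2 : ℝ) : ℂ))

/-- The normalizing factor `1 / √(8 π² ct)`. -/
def normFactor : ℂ := ((1 / √(8 * Real.pi ^ 2 * d.ct) : ℝ) : ℂ)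

/-- The Fourier basis `φ_j` of `L²([-π,π]² × [-ct,ct])`. -/
def phi (j : Fin 3 → ℤ) (x : E3) : ℂ := d.normFactor * d.wave j x

/-- `c_j = (α₁ + j₁, α₂ + j₂, j₃ π / ct)`. -/
def freq (j : Fin 3 → ℤ) : Fin 3 → ℝ :=
  ![d.α₁ + j 0, d.α₂ + j 1, (j 2 : ℝ) * Real.pi / d.ct]

/-- `(α₁ + j₁)² + (α₂ + j₂)² + (j₃ π / ct)² - k²`. -/
def symbol (j : Fin 3 → ℤ) : ℝ := (∑ i, d.freq j i ^ 2) - d.k ^ 2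

/-! ### The singular part -/

/-- `exp(i (α₁ x₁ + α₂ x₂))`. -/
def phase (x : E3) : ℂ := Complex.exp (Complex.I * ((d.α₁ * x 0 + d.α₂ * x 1 : ℝ) : ℂ))

/-- The fundamental solution `exp(i k |x|) / (4 π |x|)`. -/
def fundSol (x : E3) : ℂ :=
  Complex.exp (Complex.I * ((d.k * ‖x‖ : ℝ) : ℂ)) / ((4 * Real.pi * ‖x‖ : ℝ) : ℂ)

/-- `F(x) = exp(-i (α₁ x₁ + α₂ x₂)) exp(i k |x|) / (4 π |x|) Y(|x|)` (on the period cell). -/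
def F (x : E3) : ℂ := (d.phase x)⁻¹ * d.fundSol x * (d.Y ‖x‖ : ℂ)

/-- `F^{pq}(x) = exp(-i (α₁ x₁ + α₂ x₂)) ∂_p ∂_q [exp(i (α₁ x₁ + α₂ x₂)) F(x)]`. -/
def Fpq (p q : Fin 3) (x : E3) : ℂ :=
  (d.phase x)⁻¹ * pderiv p (pderiv q fun y => d.phase y * d.F y) x

/-! ### The preparation step: computed Fourier coefficients

The integrals are computed by discrete Fourier transforms on the uniform grid with `2M` points per
period and direction (the trapezoidal rule for integrands that vanish near the boundary). -/

/-- The discrete Fourier transform, of length `2M` for functions on a period `[-ct,ct]`, of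
`exp(i β x₃) χ'(x₃)` on `[0,ct]`, extended by zero; it approximates
`∫_0^ct exp(i (β_{n} - j₃ π / ct) x₃) χ'(x₃) dx₃`. -/
def dftOne (M : ℕ) (n : ℤ × ℤ) (j₃ : ℤ) : ℂ :=
  ((d.ct / M : ℝ) : ℂ) * ∑ l ∈ Finset.range M,
    Complex.exp (Complex.I * d.beta n * ((l * d.ct / M : ℝ) : ℂ)) *
      ((deriv d.χ (l * d.ct / M) : ℝ) : ℂ) *
      Complex.exp (-(Complex.I * ((j₃ * Real.pi / d.ct * (l * d.ct / M) : ℝ) : ℂ)))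

/-- The three-dimensional discrete Fourier transform that approximates the integral over
`[-π,π]² × [-ct,ct]` of
`exp(i k |x|) / (4 π |x|) (2 i k Y'(|x|) + Y''(|x|)) exp(-i (α₁ x₁ + α₂ x₂)) · conj (wave j x)`. -/
def dftThree (M : ℕ) (j : Fin 3 → ℤ) : ℂ :=
  (((Real.pi / M) ^ 2 * (d.ct / M) : ℝ) : ℂ) * ∑ l ∈ indexBox M,
    d.fundSol (d.gridPoint M l) *
      (2 * Complex.I * (d.k : ℂ) * ((deriv d.Y ‖d.gridPoint M l‖ : ℝ) : ℂ) +
        ((deriv (deriv d.Y) ‖d.gridPoint M l‖ : ℝ) : ℂ)) *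
      (d.phase (d.gridPoint M l))⁻¹ * (d.wave j (d.gridPoint M l))⁻¹

/-- The computed coefficient of `K_d(x) = exp(-i (α₁ x₁ + α₂ x₂)) G_d(x) χ(|x₃|)`. -/
def coefK (M : ℕ) (j : Fin 3 → ℤ) : ℂ :=
  d.normFactor *
    (1 / (d.symbol j : ℂ)
      + 1 / (2 * d.beta (j 0, j 1) * (((j 2 * Real.pi / d.ct : ℝ) : ℂ) - d.beta (j 0, j 1))) *
          d.dftOne M (j 0, j 1) (j 2)
      - 1 / (2 * d.beta (j 0, j 1) * (((j 2 * Real.pi / d.ct : ℝ) : ℂ) + d.beta (j 0, j 1))) *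
          d.dftOne M (j 0, j 1) (-(j 2)))

/-- The computed coefficient of `F`. -/
def coefF (M : ℕ) (j : Fin 3 → ℤ) : ℂ :=
  d.normFactor * (1 / (d.symbol j : ℂ)) * (1 - d.dftThree M j)

/-- The computed coefficient of `L_d = K_d - F`. -/
def coefL (M : ℕ) (j : Fin 3 → ℤ) : ℂ := d.coefK M j - d.coefF M j

/-- The computed coefficient of `L_d^{pq}`. -/
def coefLpq (M : ℕ) (p q : Fin 3) (j : Fin 3 → ℤ) : ℂ :=
  -((d.freq j p : ℝ) : ℂ) * ((d.freq j q : ℝ) : ℂ) * d.coefL M j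

/-- The value at the grid point `x_l` of the truncated Fourier series `∑_{j ∈ S_N} a_j φ_j`
(an inverse discrete Fourier transform; it is `2N`-periodic in each component of `l`). -/
def gridValue (N : ℕ) (a : (Fin 3 → ℤ) → ℂ) (l : Fin 3 → ℤ) : ℂ :=
  ∑ j ∈ indexBox N, a j * d.phi j (d.gridPoint N l)

/-! ### The calculation step -/

/-- Tricubic interpolation of the grid values `v` at `x`, from the `4 × 4 × 4` grid points around the
grid cell that contains `x`. -/
def tricubic (sch : CubicScheme) (N : ℕ) (v : (Fin 3 → ℤ) → ℂ) (x : E3) : ℂ :=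
  ∑ o : Fin 3 → Fin 4,
    ((∏ i, sch.weight (o i) (Int.fract (x i * N / d.halfPeriod i)) : ℝ) : ℂ) *
      v fun i => ⌊x i * N / d.halfPeriod i⌋ + ((o i : ℕ) : ℤ) - 1

/-- The point `(t₁, t₂, x₃)` with `t₁, t₂ ∈ [-π, π)` and `x_i - t_i ∈ 2πℤ`. -/
def reduce (x : E3) : E3 :=
  !₂[toIcoMod Real.two_pi_pos (-Real.pi) (x 0), toIcoMod Real.two_pi_pos (-Real.pi) (x 1), x 2]

/-- The computed value of `G_d(x)`, for `|x₃| ≤ c`. -/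
def numGreen (sch : CubicScheme) (N M : ℕ) (x : E3) : ℂ :=
  d.phase x *
    (d.tricubic sch N (d.gridValue N (d.coefL M)) (reduce x) + d.F (reduce x))

/-- The computed value of `∂_p ∂_q G_d(x)`, for `|x₃| ≤ c`. -/
def numGreenDeriv (sch : CubicScheme) (N M : ℕ) (p q : Fin 3) (x : E3) : ℂ :=
  d.phase x *
    (d.tricubic sch N (d.gridValue N (d.coefLpq M p q)) (reduce x) + d.Fpq p q (reduce x))

/-- The computed value of the Green's tensor, for `|x₃| ≤ c`. -/
def numGreenTensor (sch : CubicScheme) (N M : ℕ) (x : E3) : Matrix (Fin 3) (Fin 3) ℂ :=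
  d.numGreen sch N M x • (1 : Matrix (Fin 3) (Fin 3) ℂ) +
    (1 / (d.k : ℂ) ^ 2) • Matrix.of fun p q => d.numGreenDeriv sch N M p q x

end Data

end

end MaxwellGreen

/-! With the quasi-periodic phase factored out, `green` is the sum of the explicit singular part `F`
and a remainder, `regular`. The method evaluates `F` exactly, so the whole error lies in the
remainder.

The truncated Green's function and `F` both have the leading Fourier coefficient 1/(|c_j|² - k²),
that of the same point source. It cancels in the difference. What is left, `regCoef`, consists of
Fourier integrals of χ' and of 2ikY' + Y'', which are smooth and supported away from zero.
Integration by parts bounds both by `size j ^ -(m+2)`. The χ' integrals are moreover exponentially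
small in the horizontal frequency, because χ' vanishes below height c and Im β_n grows linearly.
With the multipliers of order -1 and -2 in front, the coefficients are summable against `size j ^ m`
(`summable_regCoef`).

The splitting is obtained mode by mode, without prior knowledge of the singularity of the Green's
function (`green_mul_χ_of_ne`). For each horizontal index n, the vertical profile of the nth mode
minus the horizontal Fourier integral of `F` is continuous, is supported inside |x₃| < ct, and has
the summable coefficients `regCoef`, so Fourier inversion in x₃ applies. Off the plane x₃ = 0 the
modes decay exponentially. Hence the horizontal coefficients of `F` are summable too, and Fourier
inversion in the horizontal variables recovers `F`. The plane is reached by continuity. The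
remainder is a C² series that can be differentiated termwise (`green_spec`).

The numerical error has two sources. A discrete Fourier transform adds to each coefficient all its
aliases; over the computed frequencies each true coefficient is counted at most once, so the total
error is at most a tail sum (`sum_norm_dft_sub_le`, `exists_sum_coefL_sub_le`). Truncation and
interpolation cost at most a constant times (size j / N)^s in the jth mode for s ≤ 2, since both
interpolation schemes reproduce affine functions (`norm_series_sub_tricubic_le`). Second derivatives
cost a further `size j ^ 2`, which requires s + 2 ≤ m. Together the two constraints give s = min(2,
m - 2). -/

noncomputable section

open MeasureTheory

/-! ### Fourier series and discrete Fourier transforms on a box. -/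

namespace BoxFourier

variable {ι : Type*} [Fintype ι]

/-- The character `exp (i π ∑ jᵢ xᵢ / pᵢ)` of the torus with half periods `p`. -/
def char (p : ι → ℝ) (j : ι → ℤ) (x : ι → ℝ) : ℂ :=
  Complex.exp (Complex.I * ((∑ i, (j i : ℝ) * Real.pi / p i * x i : ℝ) : ℂ))

/-- The Fourier integral `∫ Q(x) exp (-i π ∑ jᵢ xᵢ / pᵢ) dx`. -/
def coef (p : ι → ℝ) (Q : (ι → ℝ) → ℂ) (j : ι → ℤ) : ℂ :=
  ∫ x, Q x * char p (-j) x

/-- The cube of indices `-N ≤ jᵢ < N`. -/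
def box (ι : Type*) [Fintype ι] [DecidableEq ι] (N : ℕ) : Finset (ι → ℤ) :=
  Fintype.piFinset fun _ => Finset.Ico (-(N : ℤ)) (N : ℤ)

/-- The point of index `l` of the grid with `2 * M` points per period. -/
def node (p : ι → ℝ) (M : ℕ) (l : ι → ℤ) : ι → ℝ := fun i => (l i : ℝ) * p i / M

/-- The discrete Fourier transform of `Q`, with `2 * M` points per period. -/
def dft [DecidableEq ι] (p : ι → ℝ) (M : ℕ) (Q : (ι → ℝ) → ℂ) (j : ι → ℤ) : ℂ :=
  ((∏ i, p i / M : ℝ) : ℂ) * ∑ l ∈ box ι M, Q (node p M l) * char p (-j) (node p M l)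

lemma char_eq_prod (p : ι → ℝ) (j : ι → ℤ) (x : ι → ℝ) :
    char p j x = ∏ i, Complex.exp (Complex.I * (((j i : ℝ) * Real.pi / p i * x i : ℝ) : ℂ)) := by
  rw [char, ← Complex.exp_sum, Complex.ofReal_sum, Finset.mul_sum]

lemma char_mul_char (p : ι → ℝ) (i j : ι → ℤ) (x : ι → ℝ) :
    char p i x * char p j x = char p (i + j) x := by
  rw [char, char, char, ← Complex.exp_add]
  congr 1
  rw [← mul_add, ← Complex.ofReal_add, ← Finset.sum_add_distrib]
  congr 3
  ext k
  simp only [Pi.add_apply, Int.cast_add]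
  ring

/-- Functions on `ℝ^ι` that vanish near the boundary and outside of the box with half sides `p`. -/
structure SupportedIn (p : ι → ℝ) (Q : (ι → ℝ) → ℂ) : Prop where
  continuous : Continuous Q
  exists_lt : ∃ b : ι → ℝ, (∀ i, b i < p i) ∧ ∀ x i, b i < |x i| → Q x = 0

/-! ### Fourier inversion on the unit torus for functions supported in a cube. -/

section Periodization

/-- The representative of a point of the circle in `(-1/2, 1/2]`. -/
def rep (x : UnitAddCircle) : ℝ := (AddCircle.equivIoc (1 : ℝ) (-(1 / 2)) x).1

lemma coe_rep (x : UnitAddCircle) : ((rep x : ℝ) : UnitAddCircle) = x :=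
  (AddCircle.equivIoc (1 : ℝ) (-(1 / 2))).symm_apply_apply x

lemma rep_mem (x : UnitAddCircle) : rep x ∈ Set.Ioc (-(1 / 2) : ℝ) (1 / 2) := by
  have h := (AddCircle.equivIoc (1 : ℝ) (-(1 / 2)) x).2
  norm_num at h
  exact ⟨by simpa [rep] using h.1, by simpa [rep] using h.2⟩

lemma abs_rep (x : UnitAddCircle) : |rep x| = ‖x‖ := by
  conv_rhs => rw [← coe_rep x]
  symm
  rw [AddCircle.norm_coe_eq_abs_iff 1 one_ne_zero, abs_one]
  exact abs_le.2 ⟨(rep_mem x).1.le, (rep_mem x).2⟩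

lemma rep_coe {u : ℝ} (hu : u ∈ Set.Ioc (-(1 / 2) : ℝ) (1 / 2)) : rep (u : UnitAddCircle) = u := by
  have : u ∈ Set.Ioc (-(1 / 2) : ℝ) (-(1 / 2) + 1) := by norm_num at hu ⊢; exact hu
  rw [rep, AddCircle.equivIoc_coe_of_mem this]

lemma continuousAt_rep {x : UnitAddCircle} (hx : ‖x‖ ≠ 1 / 2) : ContinuousAt rep x := by
  have : x ≠ ((-(1 / 2) : ℝ) : UnitAddCircle) := by
    rintro rfl
    apply hx
    rw [(AddCircle.norm_coe_eq_abs_iff 1 one_ne_zero).2] <;> norm_num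
  exact continuousAt_subtype_val.comp (AddCircle.continuousAt_equivIoc 1 _ this)

/-- Periodization of a function supported in the unit cube centred at the origin. -/
def periodize (q : (ι → ℝ) → ℂ) (x : UnitAddTorus ι) : ℂ := q fun i => rep (x i)

/-- The representative jumps only where a coordinate has norm 1/2, and there the function vanishes
in a whole neighbourhood. -/
lemma continuous_periodize {q : (ι → ℝ) → ℂ} (hq : SupportedIn (fun _ => 1 / 2) q) :
    Continuous (periodize q) := by
  obtain ⟨b, hb, hz⟩ := hq.exists_lt
  rw [continuous_iff_continuousAt]
  intro x
  by_cases h : ∀ i, ‖x i‖ ≠ 1 / 2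
  · refine hq.continuous.continuousAt.comp (continuousAt_pi.2 fun i => ?_)
    exact ContinuousAt.comp (f := fun y : UnitAddTorus ι => y i) (continuousAt_rep (h i))
      (continuous_apply i).continuousAt
  · push Not at h
    obtain ⟨i, hi⟩ := h
    have hev : ∀ᶠ y : UnitAddTorus ι in 𝓝 x, b i < ‖y i‖ := by
      apply (continuous_norm.comp (continuous_apply i)).continuousAt.eventually_const_lt
      simpa [hi] using hb i
    have : periodize q =ᶠ[𝓝 x] fun _ => 0 := by
      filter_upwards [hev] with y hy
      exact hz _ i (by rwa [abs_rep])
    exact (continuousAt_const).congr this.symm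

/-- A coordinate -1/2 is represented by +1/2, but the function vanishes on both faces, so the closed
cube is covered. The closed cube is needed because the grids contain points on a face. -/
lemma periodize_coe {q : (ι → ℝ) → ℂ} (hq : SupportedIn (fun _ => 1 / 2) q) {u : ι → ℝ}
    (hu : ∀ i, |u i| ≤ 1 / 2) : periodize q (fun i => (u i : UnitAddCircle)) = q u := by
  obtain ⟨b, hb, hz⟩ := hq.exists_lt
  by_cases h : ∀ i, -(1 / 2) < u i
  · rw [periodize]
    congr 1
    ext i
    exact rep_coe ⟨h i, (abs_le.1 (hu i)).2⟩
  · push Not at h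
    obtain ⟨i, hi⟩ := h
    have hui : u i = -(1 / 2) := le_antisymm hi (abs_le.1 (hu i)).1
    have h1 : |u i| = 1 / 2 := by rw [hui]; norm_num
    rw [hz u i (by rw [h1]; exact hb i)]
    apply hz _ i
    rw [abs_rep, (AddCircle.norm_coe_eq_abs_iff 1 one_ne_zero).2, h1]
    · exact hb i
    · rw [h1]; norm_num

lemma mFourier_coe (j : ι → ℤ) (u : ι → ℝ) :
    UnitAddTorus.mFourier j (fun i => (u i : UnitAddCircle)) = char (fun _ => 1 / 2) j u := by
  rw [char_eq_prod]
  simp only [UnitAddTorus.mFourier, ContinuousMap.coe_mk]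
  refine Finset.prod_congr rfl fun i _ => ?_
  rw [fourier_coe_apply]
  congr 1
  push_cast
  ring

lemma mFourierCoeff_periodize {q : (ι → ℝ) → ℂ} (hq : SupportedIn (fun _ => 1 / 2) q)
    (j : ι → ℤ) : UnitAddTorus.mFourierCoeff (periodize q) j = coef (fun _ => 1 / 2) q j := by
  obtain ⟨b, hb, hz⟩ := hq.exists_lt
  rw [UnitAddTorus.mFourierCoeff_eq_integral _ _ (fun _ => -(1 / 2)), coef]
  rw [← setIntegral_eq_integral_of_forall_compl_eq_zero (f := fun x => q x * _)
    (s := {x : ι → ℝ | ∀ i, x i ∈ Set.Ioc (-(1 / 2) : ℝ) (-(1 / 2) + 1)})]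
  · refine setIntegral_congr_fun 
      (MeasurableSet.univ_pi' fun i => (measurableSet_Ioc : MeasurableSet
        (Set.Ioc (-(1 / 2) : ℝ) (-(1 / 2) + 1)))) ?_
    intro x hx
    have hx' : ∀ i, |x i| ≤ 1 / 2 := fun i => by
      have := hx i
      rw [Set.mem_Ioc] at this
      exact abs_le.2 ⟨by linarith, by linarith⟩
    simp only
    rw [periodize_coe hq hx', mFourier_coe, smul_eq_mul, mul_comm]
  · intro x hx
    simp only [Set.mem_ofPred_eq, not_forall] at hx
    obtain ⟨i, hi⟩ := hx
    rw [hz x i, zero_mul]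
    refine (hb i).trans_le ?_
    by_contra! h
    rw [abs_lt] at h
    exact hi ⟨h.1, by linarith⟩

lemma hasSum_char_unit {q : (ι → ℝ) → ℂ} (hq : SupportedIn (fun _ => 1 / 2) q)
    (hs : Summable (coef (fun _ => 1 / 2) q)) {u : ι → ℝ} (hu : ∀ i, |u i| ≤ 1 / 2) :
    HasSum (fun j => coef (fun _ => 1 / 2) q j * char (fun _ => 1 / 2) j u) (q u) := by
  have h : UnitAddTorus.mFourierCoeff (⟨periodize q, continuous_periodize hq⟩ :
      C(UnitAddTorus ι, ℂ)) = coef (fun _ => 1 / 2) q :=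
    funext fun j => mFourierCoeff_periodize hq j
  have := UnitAddTorus.hasSum_mFourier_series_apply_of_summable (by rwa [h])
    (fun i => (u i : UnitAddCircle))
  simp only [mFourier_coe, smul_eq_mul, ContinuousMap.coe_mk, periodize_coe hq hu] at this
  exact h ▸ this

end Periodization

/-! ### Transfer to boxes with arbitrary half periods. -/

section Scaling

variable {p : ι → ℝ}

lemma char_scale (hp : ∀ i, 0 < p i) (j : ι → ℤ) (u : ι → ℝ) :
    char p j (fun i => 2 * p i * u i) = char (fun _ => 1 / 2) j u := by
  unfold char
  congr 4
  ext i
  have := (hp i).ne'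
  field_simp

lemma integral_scale [DecidableEq ι] (hp : ∀ i, 0 < p i) (f : (ι → ℝ) → ℂ) :
    ((∏ i, 2 * p i : ℝ) : ℂ) * ∫ u : ι → ℝ, f (fun i => 2 * p i * u i) = ∫ x, f x := by
  have hdet : (Matrix.diagonal fun i => 2 * p i).det ≠ 0 := by
    rw [Matrix.det_diagonal]
    exact (Finset.prod_pos fun i _ => by have := hp i; positivity).ne'
  have hpos : 0 ≤ ∏ i, 2 * p i := Finset.prod_nonneg fun i _ => by have := hp i; positivity
  conv_rhs => rw [← Real.smul_map_diagonal_volume_pi hdet]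
  rw [integral_smul_measure, Matrix.det_diagonal, ENNReal.toReal_ofReal (abs_nonneg _),
    abs_of_nonneg hpos]
  let e : (ι → ℝ) ≃ₜ (ι → ℝ) := Homeomorph.piCongrRight fun i =>
    Homeomorph.mulLeft₀ (2 * p i) (by have := hp i; positivity)
  have he : ⇑(Matrix.toLin' (Matrix.diagonal fun i => 2 * p i)) = e := by
    ext x i
    simp [e, Matrix.mulVec_diagonal]
  rw [he, (e.measurableEmbedding).integral_map]
  rfl

lemma hasSum_char (hp : ∀ i, 0 < p i) {Q : (ι → ℝ) → ℂ} (hQ : SupportedIn p Q)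
    (hs : Summable (coef p Q)) {x : ι → ℝ} (hx : ∀ i, |x i| ≤ p i) :
    HasSum (fun j => ((∏ i, 2 * p i : ℝ) : ℂ)⁻¹ * coef p Q j * char p j x) (Q x) := by
  classical
  obtain ⟨b, hb, hz⟩ := hQ.exists_lt
  have hprod : ((∏ i, 2 * p i : ℝ) : ℂ) ≠ 0 := by
    exact_mod_cast (Finset.prod_pos fun i _ => by have := hp i; positivity).ne'
  set q : (ι → ℝ) → ℂ := fun u => Q fun i => 2 * p i * u i with hq
  have hqs : SupportedIn (fun _ => 1 / 2) q := by
    refine ⟨hQ.continuous.comp (by fun_prop), fun i => b i / (2 * p i), fun i => ?_, ?_⟩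
    · have := hp i
      rw [div_lt_iff₀ (by positivity)]
      linarith [hb i]
    · intro u i h
      have := hp i
      refine hz _ i ?_
      rw [abs_mul, abs_of_pos (by positivity)]
      rwa [div_lt_iff₀' (by positivity)] at h
  have hcoef : coef (fun _ => 1 / 2) q = fun j => ((∏ i, 2 * p i : ℝ) : ℂ)⁻¹ * coef p Q j := by
    ext j
    rw [eq_inv_mul_iff_mul_eq₀ hprod]
    conv_rhs => rw [coef, ← integral_scale hp]
    simp only [char_scale hp, coef, hq]
  have h := hasSum_char_unit hqs (by rw [hcoef]; exact hs.mul_left _)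
    (u := fun i => x i / (2 * p i)) (fun i => by
      have := hp i
      rw [abs_div, abs_of_pos (show (0 : ℝ) < 2 * p i by positivity), div_le_iff₀ (by positivity)]
      linarith [hx i])
  have hx' : (fun i => 2 * p i * (x i / (2 * p i))) = x := by
    ext i
    have := (hp i).ne'
    field_simp
  rw [hcoef] at h
  simpa only [← char_scale hp, hq, hx'] using h

end Scaling

/-! ### Aliasing of the discrete Fourier transform. -/

section Aliasing

lemma sum_root_of_unity (M : ℕ) (hM : 0 < M) (n : ℤ) :
    ∑ l ∈ Finset.Ico (-(M : ℤ)) M, Complex.exp (Complex.I * ((n * Real.pi * l / M : ℝ) : ℂ)) =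
      if ((2 * M : ℕ) : ℤ) ∣ n then ((2 * M : ℕ) : ℂ) else 0 := by
  have hM' : (M : ℂ) ≠ 0 := by exact_mod_cast hM.ne'
  set ζ : ℂ := Complex.exp (Complex.I * ((n * Real.pi / M : ℝ) : ℂ)) with hζ
  have hpow : ∀ l : ℤ, Complex.exp (Complex.I * ((n * Real.pi * l / M : ℝ) : ℂ)) = ζ ^ l := by
    intro l
    rw [hζ, ← Complex.exp_int_mul]
    congr 1
    push_cast
    ring
  have hζ0 : ζ ≠ 0 := Complex.exp_ne_zero _
  have hζ1 : ζ = 1 ↔ ((2 * M : ℕ) : ℤ) ∣ n := by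
    rw [hζ, Complex.exp_eq_one_iff]
    constructor
    · rintro ⟨m, hm⟩
      refine ⟨m, ?_⟩
      have hpi : (Real.pi : ℂ) ≠ 0 := by exact_mod_cast Real.pi_ne_zero
      have : (n : ℂ) = (2 * M * m : ℂ) := by
        push_cast at hm
        field_simp at hm
        linear_combination hm
      exact_mod_cast this
    · rintro ⟨m, hm⟩
      refine ⟨m, ?_⟩
      rw [hm]
      push_cast
      field_simp
  simp_rw [hpow]
  have hshift : ∑ l ∈ Finset.Ico (-(M : ℤ)) M, ζ ^ l
      = ζ ^ (-(M : ℤ)) * ∑ l ∈ Finset.range (2 * M), ζ ^ l := by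
    rw [Finset.mul_sum]
    symm
    refine Finset.sum_bij (fun (l : ℕ) _ => (l : ℤ) - M) ?_ ?_ ?_ ?_
    · intro l hl
      simp only [Finset.mem_range, Finset.mem_Ico] at hl ⊢
      omega
    · intro a _ b _ h
      simpa using h
    · intro l hl
      simp only [Finset.mem_Ico] at hl
      refine ⟨(l + M).toNat, ?_, ?_⟩
      · simp only [Finset.mem_range]; omega
      · have : ((l + M).toNat : ℤ) = l + M := Int.toNat_of_nonneg (by omega)
        rw [this]; ring
    · intro l _
      rw [sub_eq_neg_add, zpow_add₀ hζ0, zpow_natCast]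
  rw [hshift]
  split_ifs with h
  · simp [hζ1.2 h]
  · have hne : ζ ≠ 1 := fun h' => h (hζ1.1 h')
    rw [geom_sum_eq hne]
    have : ζ ^ (2 * M) = 1 := by
      rw [hζ, ← Complex.exp_nat_mul, Complex.exp_eq_one_iff]
      refine ⟨n, ?_⟩
      push_cast
      field_simp
    simp [this]

variable [DecidableEq ι] {p : ι → ℝ}

lemma sum_char_node (hp : ∀ i, 0 < p i) (M : ℕ) (hM : 0 < M) (n : ι → ℤ) :
    ∑ l ∈ box ι M, char p n (node p M l) =
      if ∀ i, ((2 * M : ℕ) : ℤ) ∣ n i then (∏ _i : ι, ((2 * M : ℕ) : ℂ)) else 0 := by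
  have h1 : ∀ l : ι → ℤ, char p n (node p M l) =
      ∏ i, Complex.exp (Complex.I * ((n i * Real.pi * l i / M : ℝ) : ℂ)) := by
    intro l
    rw [char_eq_prod]
    refine Finset.prod_congr rfl fun i _ => ?_
    congr 3
    have := (hp i).ne'
    simp only [node]
    field_simp
  simp_rw [h1]
  rw [box, Finset.sum_prod_piFinset (Finset.Ico (-(M : ℤ)) M)
    (fun i l => Complex.exp (Complex.I * ((n i * Real.pi * l / M : ℝ) : ℂ)))]
  simp_rw [sum_root_of_unity M hM]
  split_ifs with h
  · exact Finset.prod_congr rfl fun i _ => if_pos (h i)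
  · push Not at h
    obtain ⟨i, hi⟩ := h
    exact Finset.prod_eq_zero (Finset.mem_univ i) (if_neg hi)

lemma mem_box {N : ℕ} {j : ι → ℤ} : j ∈ box ι N ↔ ∀ i, -(N : ℤ) ≤ j i ∧ j i < N := by
  simp [box, Fintype.mem_piFinset]

/-- Inserting the absolutely convergent Fourier series at the nodes and using the orthogonality of
characters on the grid leaves exactly the frequencies congruent to j modulo 2M. -/
lemma hasSum_dft (hp : ∀ i, 0 < p i) {Q : (ι → ℝ) → ℂ} (hQ : SupportedIn p Q)
    (hs : Summable (coef p Q)) {M : ℕ} (hM : 0 < M) (j : ι → ℤ) :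
    HasSum (fun n => if ∀ i, ((2 * M : ℕ) : ℤ) ∣ n i - j i then coef p Q n else 0)
      (dft p M Q j) := by
  have hM' : (M : ℂ) ≠ 0 := by exact_mod_cast hM.ne'
  have hnode : ∀ l ∈ box ι M, ∀ i, |node p M l i| ≤ p i := by
    intro l hl i
    have h := mem_box.1 hl i
    have h1 : |(l i : ℝ)| ≤ M := by
      rw [abs_le]
      exact ⟨by exact_mod_cast h.1, by exact_mod_cast h.2.le⟩
    have hMr : (0 : ℝ) < M := by exact_mod_cast hM
    rw [node, abs_div, abs_mul, abs_of_pos (hp i), abs_of_pos hMr, div_le_iff₀ hMr]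
    nlinarith [hp i]
  have h := (hasSum_sum fun l hl => (hasSum_char hp hQ hs (hnode l hl)).mul_right
    (char p (-j) (node p M l))).mul_left ((∏ i, p i / M : ℝ) : ℂ)
  rw [dft]
  convert! h using 1
  ext n
  have h2 : ∑ l ∈ box ι M, ((∏ i, 2 * p i : ℝ) : ℂ)⁻¹ * coef p Q n * char p n (node p M l) *
      char p (-j) (node p M l) = ((∏ i, 2 * p i : ℝ) : ℂ)⁻¹ * coef p Q n *
        ∑ l ∈ box ι M, char p (n - j) (node p M l) := by
    rw [Finset.mul_sum]
    refine Finset.sum_congr rfl fun l _ => ?_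
    rw [mul_assoc, char_mul_char, sub_eq_add_neg]
  rw [h2, sum_char_node hp M hM]
  simp only [Pi.sub_apply]
  split_ifs
  · have : ((∏ i, p i / M : ℝ) : ℂ) * (((∏ i, 2 * p i : ℝ) : ℂ)⁻¹ * ∏ _i : ι, ((2 * M : ℕ) : ℂ))
        = 1 := by
      push_cast
      rw [← Finset.prod_inv_distrib, ← Finset.prod_mul_distrib, ← Finset.prod_mul_distrib]
      refine Finset.prod_eq_one fun i _ => ?_
      have : (p i : ℂ) ≠ 0 := by exact_mod_cast (hp i).ne'
      field_simp
    linear_combination (-coef p Q n) * this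
  · simp

/-- The aliasing error of the discrete Fourier transform, summed over the computed frequencies, is
at most the sum of the absolute values of the Fourier integrals of higher frequency. -/
theorem sum_norm_dft_sub_le (hp : ∀ i, 0 < p i) {Q : (ι → ℝ) → ℂ} (hQ : SupportedIn p Q)
    (hs : Summable (coef p Q)) {N M : ℕ} (hM : 0 < M) (hNM : N ≤ M) :
    ∑ j ∈ box ι N, ‖dft p M Q j - coef p Q j‖ ≤
      ∑' n, if n ∈ box ι M then 0 else ‖coef p Q n‖ := by
  have hsn := hs.norm
  have hcong : ∀ (j n : ι → ℤ), j ∈ box ι M → n ∈ box ι M →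
      (∀ i, ((2 * M : ℕ) : ℤ) ∣ n i - j i) → n = j := by
    intro j n hj hn h
    ext i
    obtain ⟨t, ht⟩ := h i
    have h1 := mem_box.1 hj i
    have h2 := mem_box.1 hn i
    push_cast at ht
    have hM' : (0 : ℤ) < M := by exact_mod_cast hM
    have : t = 0 := by
      have ha : t < 1 := by nlinarith
      have hb : -1 < t := by nlinarith
      omega
    rw [this] at ht
    omega
  have hsub : box ι N ⊆ box ι M := by
    intro j hj
    rw [mem_box] at hj ⊢
    intro i
    have := hj i
    omega
  let g : (ι → ℤ) → (ι → ℤ) → ℝ := fun j n =>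
    if (∀ i, ((2 * M : ℕ) : ℤ) ∣ n i - j i) ∧ n ≠ j then ‖coef p Q n‖ else 0
  have hg0 : ∀ j n, 0 ≤ g j n := fun j n => by simp only [g]; split_ifs <;> positivity
  have hgs : ∀ j, Summable (g j) := fun j => Summable.of_nonneg_of_le (hg0 j)
    (fun n => by simp only [g]; split_ifs <;> [exact le_rfl; positivity]) hsn
  have h1 : ∀ j, ‖dft p M Q j - coef p Q j‖ ≤ ∑' n, g j n := by
    intro j
    have h := (hasSum_dft hp hQ hs hM j).sub (hasSum_ite_eq j (coef p Q j))
    rw [← h.tsum_eq]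
    refine tsum_of_norm_bounded (hgs j).hasSum fun n => ?_
    by_cases hnj : n = j
    · subst hnj; simp [g]
    · simp only [g, hnj, if_false, sub_zero, ne_eq, not_false_eq_true, and_true]
      split_ifs <;> simp
  refine (Finset.sum_le_sum fun j _ => h1 j).trans ?_
  rw [← Summable.tsum_finsetSum fun j _ => hgs j]
  refine Summable.tsum_le_tsum (fun n => ?_) (summable_sum fun j _ => hgs j) ?_
  -- Indices of the box of size M are pairwise incongruent modulo 2M. Hence n is an alias of at most
  -- one computed j, and of none if n itself lies in that box; this is where N ≤ M enters.
  · by_cases hex : ∃ j ∈ box ι N, (∀ i, ((2 * M : ℕ) : ℤ) ∣ n i - j i) ∧ n ≠ j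
    · obtain ⟨j, hj, hd, hne⟩ := hex
      have hn : n ∉ box ι M := fun hn => hne (hcong j n (hsub hj) hn hd)
      rw [if_neg hn, Finset.sum_eq_single_of_mem j hj]
      · simp only [g]; split_ifs <;> [exact le_rfl; positivity]
      · intro j' hj' hjj'
        refine if_neg fun h => hjj' ?_
        refine hcong j j' (hsub hj) (hsub hj') fun i => ?_
        have := dvd_sub (hd i) (h.1 i)
        simpa using this
    · push Not at hex
      rw [Finset.sum_eq_zero]
      · split_ifs <;> positivity
      · intro j hj
        refine if_neg fun h => h.2 (hex j hj h.1)
  · refine Summable.of_nonneg_of_le (fun n => ?_) (fun n => ?_) hsn <;> split_ifs <;>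
      first | exact le_rfl | positivity

end Aliasing

end BoxFourier

/-! ### Fourier transforms of radial functions in space. -/

namespace MaxwellGreen

/-- The point with horizontal coordinates `y` and vertical coordinate `z`. -/
def glue (z : ℝ) (y : Fin 2 → ℝ) : E3 := !₂[y 0, y 1, z]

/-- Separation of the vertical and the horizontal coordinates. -/
def glueEquiv : ℝ × (Fin 2 → ℝ) ≃ᵐ E3 :=
  (MeasurableEquiv.piFinSuccAbove (fun _ : Fin 3 => ℝ) 2).symm.trans
    (MeasurableEquiv.toLp 2 (Fin 3 → ℝ))

lemma glueEquiv_apply (q : ℝ × (Fin 2 → ℝ)) : glueEquiv q = glue q.1 q.2 := by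
  ext i
  fin_cases i
  · rfl
  · rfl
  · rfl

lemma measurePreserving_glueEquiv : MeasurePreserving glueEquiv := by
  exact (volume_preserving_piFinSuccAbove (fun _ : Fin 3 => ℝ) 2).symm.trans
    (EuclideanSpace.volume_preserving_symm_measurableEquiv_toLp (Fin 3)).symm

lemma integral_E3_eq {f : E3 → ℂ} (hf : Integrable f) :
    ∫ x, f x = ∫ z, ∫ y, f (glue z y) := by
  rw [← measurePreserving_glueEquiv.integral_comp' f, Measure.volume_eq_prod, integral_prod]
  · simp only [glueEquiv_apply]
  · exact (measurePreserving_glueEquiv.integrable_comp_emb glueEquiv.measurableEmbedding).2 hf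

lemma norm_glue_sq (z : ℝ) (y : Fin 2 → ℝ) : ‖glue z y‖ ^ 2 = z ^ 2 + (y 0 ^ 2 + y 1 ^ 2) := by
  rw [EuclideanSpace.norm_sq_eq, Fin.sum_univ_three]
  simp [glue]
  ring

lemma norm_glue (z : ℝ) (y : Fin 2 → ℝ) : ‖glue z y‖ = √(z ^ 2 + (y 0 ^ 2 + y 1 ^ 2)) := by
  rw [← norm_glue_sq, Real.sqrt_sq (norm_nonneg _)]

/-- Integration of a radial function over the plane. -/
lemma integral_plane_radial (g : ℝ → ℂ) :
    ∫ y : Fin 2 → ℝ, g (y 0 ^ 2 + y 1 ^ 2) = Real.pi * ∫ t in Set.Ioi 0, g t := by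
  have h1 : ∫ y : Fin 2 → ℝ, g (y 0 ^ 2 + y 1 ^ 2)
      = ∫ x : EuclideanSpace ℝ (Fin 2), g (‖x‖ ^ 2) := by
    rw [← (EuclideanSpace.volume_preserving_symm_measurableEquiv_toLp (Fin 2)).integral_comp'
      (fun y => g (y 0 ^ 2 + y 1 ^ 2))]
    refine integral_congr_ae (Filter.Eventually.of_forall fun x => ?_)
    simp [EuclideanSpace.norm_sq_eq, Fin.sum_univ_two]
  rw [h1, integral_fun_norm_addHaar volume (fun r => g (r ^ 2))]
  have h2 : (volume : Measure (EuclideanSpace ℝ (Fin 2))).real (Metric.ball 0 1) = Real.pi := by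
    simp [Measure.real, Real.pi_pos.le]
  rw [h2]
  have h3 := integral_comp_rpow_Ioi_of_pos (g := g) (p := 2) two_pos
  rw [← h3]
  simp only [finrank_euclideanSpace_fin, Complex.real_smul, nsmul_eq_mul]
  rw [← integral_const_mul, ← integral_const_mul, ← integral_const_mul]
  refine setIntegral_congr_fun measurableSet_Ioi fun r hr => ?_
  norm_num
  ring

lemma integral_exp_symm (s a : ℝ) (ha : 0 ≤ a) :
    ∫ z in Set.Ioo (-a) a, Complex.exp (Complex.I * ((-(s * z) : ℝ) : ℂ))
      = ((2 * (a * Real.sinc (s * a)) : ℝ) : ℂ) := by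
  rw [← integral_Ioc_eq_integral_Ioo, ← intervalIntegral.integral_of_le (by linarith)]
  by_cases hs : s = 0
  · subst hs
    simp
    ring
  · have h := intervalIntegral.integral_comp_mul_left (a := -a) (b := a)
      (fun t : ℝ => Complex.exp (t * Complex.I)) (c := -s) (neg_ne_zero.2 hs)
    have h2 := integral_exp_mul_I_eq_sinc (-s * a)
    rw [show -s * -a = -(-s * a) by ring, h2] at h
    have : (fun z : ℝ => Complex.exp (Complex.I * ((-(s * z) : ℝ) : ℂ))) =
        fun z : ℝ => Complex.exp (((-s * z : ℝ) : ℂ) * Complex.I) := by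
      ext z
      rw [mul_comm, neg_mul]
    rw [this, h, neg_mul, Real.sinc_neg, Complex.real_smul]
    have : (s : ℂ) ≠ 0 := by exact_mod_cast hs
    push_cast
    field_simp

/-- Continuous functions on the half line that vanish far from the origin. -/
structure Profile (u : ℝ → ℂ) : Prop where
  continuous : Continuous u
  exists_zero : ∃ R : ℝ, 0 < R ∧ ∀ r, R ≤ r → u r = 0

lemma Profile.integrableOn {u : ℝ → ℂ} (hu : Profile u) : IntegrableOn u (Set.Ioi 0) := by
  obtain ⟨R, hR, hz⟩ := hu.exists_zero
  have h : IntegrableOn u (Set.Ioc 0 R) :=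
    (hu.continuous.integrableOn_Icc (a := 0) (b := R)).mono_set Set.Ioc_subset_Icc_self
  refine h.of_forall_sdiff_eq_zero measurableSet_Ioi ?_
  intro x hx
  apply hz
  by_contra! h'
  exact hx.2 ⟨hx.1, h'.le⟩

lemma Profile.mul {u : ℝ → ℂ} (hu : Profile u) {v : ℝ → ℂ} (hv : Continuous v) :
    Profile fun r => u r * v r := by
  obtain ⟨R, hR, hz⟩ := hu.exists_zero
  exact ⟨hu.continuous.mul hv, R, hR, fun r hr => by rw [hz r hr, zero_mul]⟩

/-- The volume element r² dr absorbs the singularity 1/r. -/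
lemma Profile.integrable_radial {u : ℝ → ℂ} (hu : Profile u) :
    Integrable fun x : E3 => u ‖x‖ / (‖x‖ : ℂ) := by
  rw [integrable_fun_norm_addHaar volume (f := fun r => u r / (r : ℂ))]
  refine ((hu.mul Complex.continuous_ofReal).integrableOn).congr_fun ?_ measurableSet_Ioi
  intro r hr
  have : (r : ℂ) ≠ 0 := by exact_mod_cast (ne_of_gt hr)
  simp only [finrank_euclideanSpace_fin, Complex.real_smul]
  push_cast
  field_simp

lemma Profile.integrable_radial_mul {u : ℝ → ℂ} (hu : Profile u) {e : E3 → ℂ}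
    (he : Continuous e) (hb : ∀ x, ‖e x‖ ≤ 1) :
    Integrable fun x : E3 => u ‖x‖ / (‖x‖ : ℂ) * e x :=
  hu.integrable_radial.mul_bdd he.aestronglyMeasurable (Filter.Eventually.of_forall hb)

/-- In cylindrical coordinates, with t the square of the distance to the origin as variable in place
of the planar radius, the integrand depends on z only through the exponential, over the interval |z|
< √t. Integrating in z first produces the sinc factor. -/
lemma Profile.integral_vertical {u : ℝ → ℂ} (hu : Profile u) (s : ℝ) :
    ∫ x : E3, u ‖x‖ / (‖x‖ : ℂ) * Complex.exp (Complex.I * ((-(s * x 2) : ℝ) : ℂ)) =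
      4 * Real.pi * ∫ r in Set.Ioi 0, u r * ((r * Real.sinc (s * r) : ℝ) : ℂ) := by
  set e : ℝ → ℂ := fun z => Complex.exp (Complex.I * ((-(s * z) : ℝ) : ℂ)) with he
  have he1 : ∀ z, ‖e z‖ = 1 := fun z => by
    rw [he]; simp only; rw [mul_comm, Complex.norm_exp_ofReal_mul_I]
  have hec : Continuous e := by fun_prop
  set g : ℝ → ℂ := fun t => u √t / ((√t : ℝ) : ℂ) with hg
  have hgm : Measurable g :=
    (hu.continuous.measurable.comp Real.continuous_sqrt.measurable).div (by fun_prop)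
  rw [integral_E3_eq (hu.integrable_radial_mul (e := fun x => e (x 2)) (by fun_prop)
    fun x => (he1 _).le)]
  have hinner : ∀ z : ℝ, ∫ y : Fin 2 → ℝ, u ‖glue z y‖ / (‖glue z y‖ : ℂ) * e ((glue z y) 2)
      = Real.pi * ∫ t in Set.Ioi 0, (if z ^ 2 < t then g t * e z else 0) := by
    intro z
    have h1 : ∀ y : Fin 2 → ℝ, u ‖glue z y‖ / (‖glue z y‖ : ℂ) * e ((glue z y) 2)
        = (fun t => g (z ^ 2 + t)) (y 0 ^ 2 + y 1 ^ 2) * e z := by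
      intro y
      simp only [hg, norm_glue]
      rfl
    simp_rw [h1]
    rw [integral_mul_const, integral_plane_radial (fun t => g (z ^ 2 + t)), mul_assoc,
      ← integral_mul_const]
    congr 1
    -- Translation by z² replaces the squared planar radius by the squared distance to the origin.
    rw [← integral_indicator measurableSet_Ioi, ← integral_indicator measurableSet_Ioi,
      ← integral_add_left_eq_self (fun t => (Set.Ioi (0 : ℝ)).indicator
        (fun t => if z ^ 2 < t then g t * e z else 0) t) (z ^ 2)]
    congr 1
    ext t
    by_cases ht : 0 < t
    · have h0 : 0 < z ^ 2 + t := by positivity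
      simp [Set.indicator, ht, h0]
    · have h0 : ¬ z ^ 2 < z ^ 2 + t := by simpa using ht
      simp [Set.indicator, ht, h0]
  simp_rw [hinner]
  rw [integral_const_mul]
  have hind : ∀ t ∈ Set.Ioi (0 : ℝ), ∀ w : ℂ, (fun z : ℝ => if z ^ 2 < t then w * e z else 0) =
      (Set.Ioo (-√t) √t).indicator fun z => w * e z := by
    intro t _ w
    ext z
    simp only [Set.indicator, Set.mem_Ioo, ← abs_lt, ← Real.sqrt_lt_sqrt_iff (sq_nonneg z),
      Real.sqrt_sq_eq_abs]
  have hInt : Integrable (Function.uncurry fun z t : ℝ => if z ^ 2 < t then g t * e z else 0)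
      (volume.prod (volume.restrict (Set.Ioi 0))) := by
    have hm : Measurable (Function.uncurry fun z t : ℝ => if z ^ 2 < t then g t * e z else 0) := by
      refine Measurable.ite ?_ ?_ measurable_const
      · exact measurableSet_lt (by fun_prop) (by fun_prop)
      · exact (hgm.comp measurable_snd).mul (hec.measurable.comp measurable_fst)
    rw [integrable_prod_iff' hm.aestronglyMeasurable]
    constructor
    · filter_upwards [ae_restrict_mem measurableSet_Ioi] with t ht
      simp only [Function.uncurry_apply_pair]
      rw [hind t ht, integrable_indicator_iff measurableSet_Ioo]
      exact ((continuous_const.mul hec).integrableOn_Icc).mono_set Set.Ioo_subset_Icc_self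
    -- The norm integrates in z to 2√t |g(t)| = 2 |u(√t)|; the substitution t = r² turns this into 4
    -- r |u(r)|.
    · have hP : IntegrableOn (fun r => u r * ((4 * r : ℝ) : ℂ)) (Set.Ioi 0) :=
        (hu.mul (by fun_prop)).integrableOn
      have hQ := (integrableOn_Ioi_comp_rpow_iff (fun t : ℝ => (2 : ℂ) * u √t) two_ne_zero).1 <|
        hP.congr_fun (fun r hr => by
          have : √(r ^ (2 : ℝ)) = r := by
            rw [Real.rpow_two, Real.sqrt_sq (le_of_lt hr)]
          simp only [this]
          norm_num
          ring) measurableSet_Ioi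
      refine hQ.norm.congr ?_
      filter_upwards [ae_restrict_mem measurableSet_Ioi] with t ht
      have ht0 : 0 < √t := Real.sqrt_pos.2 ht
      simp only [Function.uncurry_apply_pair]
      have : (fun z : ℝ => ‖if z ^ 2 < t then g t * e z else 0‖) =
          (Set.Ioo (-√t) √t).indicator fun _ => ‖g t‖ := by
        ext z
        rw [congrFun (hind t ht (g t)) z, norm_indicator_eq_indicator_norm]
        simp [he1]
      rw [this, integral_indicator measurableSet_Ioo, setIntegral_const, hg]
      simp only [norm_div, norm_mul, Complex.norm_real, Real.norm_eq_abs, abs_of_pos ht0]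
      simp [Measure.real]
      field_simp
      ring
  rw [integral_integral_swap hInt]
  have hfin : ∀ t ∈ Set.Ioi (0 : ℝ), ∫ z : ℝ, (if z ^ 2 < t then g t * e z else 0) =
      2 * u √t * ((Real.sinc (s * √t) : ℝ) : ℂ) := by
    intro t ht
    have ht0 : ((√t : ℝ) : ℂ) ≠ 0 := by exact_mod_cast (Real.sqrt_pos.2 ht).ne'
    rw [hind t ht, integral_indicator measurableSet_Ioo, integral_const_mul,
      integral_exp_symm s √t (Real.sqrt_nonneg t), hg]
    push_cast
    field_simp
  rw [setIntegral_congr_fun measurableSet_Ioi hfin,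
    ← integral_comp_rpow_Ioi_of_pos (p := 2) two_pos, ← integral_const_mul, ← integral_const_mul]
  refine setIntegral_congr_fun measurableSet_Ioi fun r hr => ?_
  have : √(r ^ (2 : ℝ)) = r := by rw [Real.rpow_two, Real.sqrt_sq (le_of_lt hr)]
  simp only [this]
  norm_num
  ring

/-- The Fourier transform of a radial function in three dimensions. -/
theorem Profile.integral_radial {u : ℝ → ℂ} (hu : Profile u) (c : E3) :
    ∫ x : E3, u ‖x‖ / (‖x‖ : ℂ) * Complex.exp (Complex.I * ((-(inner ℝ c x) : ℝ) : ℂ)) =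
      4 * Real.pi * ∫ r in Set.Ioi 0, u r * ((r * Real.sinc (‖c‖ * r) : ℝ) : ℂ) := by
  rw [← hu.integral_vertical ‖c‖]
  set v : E3 := ‖c‖ • EuclideanSpace.single 2 (1 : ℝ) with hv
  have hnorm : ‖v‖ = ‖c‖ := by rw [hv, norm_smul]; simp
  -- The reflection that exchanges the two vectors `v` and `c` of equal length reduces the general
  -- frequency to a vertical one.
  set A : E3 ≃ₗᵢ[ℝ] E3 := (Submodule.span ℝ {v - c})ᗮ.reflection with hA
  have hAv : A v = c := Submodule.reflection_sub hnorm
  rw [← A.measurePreserving.integral_comp A.toHomeomorph.measurableEmbedding]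
  refine integral_congr_ae (Filter.Eventually.of_forall fun x => ?_)
  simp only [LinearIsometryEquiv.norm_map]
  have : inner ℝ c (A x) = ‖c‖ * x 2 := by
    conv_lhs => rw [← hAv, LinearIsometryEquiv.inner_map_map, hv, inner_smul_left,
      EuclideanSpace.inner_single_left]
    simp
  rw [this]

/-! ### Decay of oscillatory integrals by integration by parts. -/

section Oscillatory

lemma integral_exp_mul_eq_deriv {f : ℝ → ℂ} (hf : ContDiff ℝ 1 f) (hc : HasCompactSupport f)
    {s : ℂ} (hs : s ≠ 0) :
    ∫ t : ℝ, Complex.exp (Complex.I * s * t) * f t =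
      Complex.I / s * ∫ t : ℝ, Complex.exp (Complex.I * s * t) * deriv f t := by
  have hd : ∀ t : ℝ, HasDerivAt (fun t : ℝ => Complex.exp (Complex.I * s * t))
      (Complex.I * s * Complex.exp (Complex.I * s * t)) t := by
    intro t
    have := ((Complex.ofRealCLM.hasDerivAt (x := t)).const_mul (Complex.I * s)).cexp
    simpa [mul_comm] using this
  have hf' : ∀ t, HasDerivAt f (deriv f t) t := fun t =>
    (hf.differentiable one_ne_zero t).hasDerivAt
  have hfc : Continuous (deriv f) := hf.continuous_deriv le_rfl
  have hec : Continuous fun t : ℝ => Complex.exp (Complex.I * s * t) := by fun_prop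
  have h := integral_mul_deriv_eq_deriv_mul_of_integrable (fun t _ => hd t) (fun t _ => hf' t)
    ((hec.mul hfc).integrable_of_hasCompactSupport hc.deriv.mul_left)
    (((continuous_const.mul hec).mul hf.continuous).integrable_of_hasCompactSupport hc.mul_left)
    ((hec.mul hf.continuous).integrable_of_hasCompactSupport hc.mul_left)
  rw [h]
  simp_rw [mul_assoc (Complex.I * s)]
  rw [integral_const_mul]
  field_simp
  rw [Complex.I_sq]
  ring

lemma integral_exp_mul_eq_iteratedDeriv {n : ℕ} {f : ℝ → ℂ} (hf : ContDiff ℝ n f)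
    (hc : HasCompactSupport f) {s : ℂ} (hs : s ≠ 0) :
    ∫ t : ℝ, Complex.exp (Complex.I * s * t) * f t =
      (Complex.I / s) ^ n * ∫ t : ℝ, Complex.exp (Complex.I * s * t) * iteratedDeriv n f t := by
  induction n generalizing f with
  | zero => simp
  | succ n ih =>
    have h1 : ContDiff ℝ 1 f := hf.of_le (by exact_mod_cast Nat.le_add_left 1 n)
    have h2 : ContDiff ℝ n (deriv f) := by
      have := contDiff_succ_iff_deriv (n := (n : WithTop ℕ∞)).1 (by exact_mod_cast hf)
      exact this.2.2
    rw [integral_exp_mul_eq_deriv h1 hc hs, ih h2 hc.deriv, iteratedDeriv_succ', pow_succ]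
    ring

/-- Besides the n powers of s gained by parts, the support in t ≥ a gives |exp(ist)| ≤ exp(-a Im s).
With s = β_n - γ_j this second factor makes the sums over the horizontal frequencies converge. -/
lemma norm_integral_exp_mul_le {n : ℕ} {f : ℝ → ℂ} (hf : ContDiff ℝ n f)
    (hc : HasCompactSupport f) {a : ℝ} (ha : ∀ t < a, f t = 0) {s : ℂ} (hs : s ≠ 0)
    (him : 0 ≤ s.im) :
    ‖∫ t : ℝ, Complex.exp (Complex.I * s * t) * f t‖ ≤
      (∫ t, ‖iteratedDeriv n f t‖) * Real.exp (-(s.im * a)) / ‖s‖ ^ n := by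
  have hcs : HasCompactSupport (iteratedDeriv n f) := by
    rw [HasCompactSupport] at hc ⊢
    refine hc.of_isClosed_subset (isClosed_tsupport _) ?_
    refine closure_minimal ?_ (isClosed_tsupport _)
    intro t ht
    by_contra h
    rw [notMem_tsupport_iff_eventuallyEq] at h
    apply ht
    have := h.iteratedDeriv_eq n
    rw [this]
    simp
  have hInt : Integrable (fun t => ‖iteratedDeriv n f t‖ * Real.exp (-(s.im * a))) :=
    ((hf.continuous_iteratedDeriv n le_rfl).integrable_of_hasCompactSupport hcs).norm.mul_const _
  rw [integral_exp_mul_eq_iteratedDeriv hf hc hs, norm_mul, norm_pow, norm_div, Complex.norm_I,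
    div_pow, one_pow, mul_comm, mul_one_div]
  gcongr
  rw [← integral_mul_const]
  refine norm_integral_le_of_norm_le hInt (Filter.Eventually.of_forall fun t => ?_)
  rw [norm_mul, mul_comm]
  by_cases hta : t < a
  · have : iteratedDeriv n f t = 0 := by
      have h0 : f =ᶠ[𝓝 t] fun _ => 0 := by
        filter_upwards [Iio_mem_nhds hta] with y hy using ha y hy
      rw [h0.iteratedDeriv_eq n]
      simp
    simp [this]
  · gcongr
    rw [Complex.norm_exp]
    have : (Complex.I * s * (t : ℂ)).re = -(s.im * t) := by simp
    rw [this]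
    gcongr
    exact not_lt.1 hta

end Oscillatory

/-- The data of the problem, with cut-off functions that are extended by one to the negative
half line. -/
structure Data.Regular (d : Data) (m : ℕ) : Prop where
  two_lt : 2 < m
  k_pos : 0 < d.k
  c_pos : 0 < d.c
  c_lt : d.c < d.ct
  ε_pos : 0 < d.ε
  ε_lt_one : 2 * d.ε < 1
  ε_lt_ct : 2 * d.ε < d.ct
  contDiff_χ : ContDiff ℝ ((m + 3 : ℕ) : WithTop ℕ∞) d.χ
  χ_one : ∀ t ≤ d.c, d.χ t = 1
  χ_zero : ∀ t, (d.c + d.ct) / 2 ≤ t → d.χ t = 0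
  contDiff_Y : ContDiff ℝ ((m + 3 : ℕ) : WithTop ℕ∞) d.Y
  Y_one : ∀ t ≤ d.ε, d.Y t = 1
  Y_zero : ∀ t, 2 * d.ε ≤ t → d.Y t = 0
  beta_ne : ∀ n : ℤ × ℤ, d.beta n ≠ 0
  beta_ne' : ∀ (n : ℤ × ℤ) (j₃ : ℤ), d.beta n ≠ ((j₃ * Real.pi / d.ct : ℝ) : ℂ)

namespace Data

variable {d : Data} {m : ℕ}

/-! ### Fourier integrals of radial functions -/

/-- The vector `c_j`. -/
def freqVec (d : Data) (j : Fin 3 → ℤ) : E3 := WithLp.toLp 2 (d.freq j)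

lemma symbol_eq (d : Data) (j : Fin 3 → ℤ) : d.symbol j = ‖d.freqVec j‖ ^ 2 - d.k ^ 2 := by
  rw [symbol, EuclideanSpace.norm_sq_eq]
  simp [freqVec]

/-- `exp(i k r) Y(r)`. -/
def outgoing (d : Data) (r : ℝ) : ℂ := Complex.exp (Complex.I * d.k * r) * (d.Y r : ℂ)

/-- `exp(i k r) (2 i k Y'(r) + Y''(r))`. -/
def source (d : Data) (r : ℝ) : ℂ :=
  Complex.exp (Complex.I * d.k * r) * (2 * Complex.I * (d.k : ℂ) * ((deriv d.Y r : ℝ) : ℂ) +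
    ((deriv (deriv d.Y) r : ℝ) : ℂ))

/-- `r sinc(ρ r)`. -/
def sineKernel (ρ r : ℝ) : ℝ := r * Real.sinc (ρ * r)

lemma sineKernel_eq {ρ : ℝ} (hρ : ρ ≠ 0) (r : ℝ) : sineKernel ρ r = Real.sin (ρ * r) / ρ := by
  rw [sineKernel]
  by_cases hr : r = 0
  · simp [hr]
  · rw [Real.sinc_of_ne_zero (mul_ne_zero hρ hr)]
    field_simp

lemma abs_sineKernel_le (ρ r : ℝ) : |sineKernel ρ r| ≤ |r| := by
  rw [sineKernel, abs_mul]
  exact mul_le_of_le_one_right (abs_nonneg r) (Real.abs_sinc_le_one _)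

lemma hasDerivAt_sineKernel (ρ r : ℝ) : HasDerivAt (sineKernel ρ) (Real.cos (ρ * r)) r := by
  by_cases hρ : ρ = 0
  · subst hρ
    have : sineKernel 0 = id := by ext r; simp [sineKernel]
    rw [this]
    simpa using hasDerivAt_id r
  · have : sineKernel ρ = fun r => Real.sin (ρ * r) / ρ := funext (sineKernel_eq hρ)
    rw [this]
    have := (((hasDerivAt_id r).const_mul ρ).sin).div_const ρ
    simpa [hρ] using this

lemma hasDerivAt_cos_mul (ρ r : ℝ) :
    HasDerivAt (fun r => Real.cos (ρ * r)) (-(ρ ^ 2 * sineKernel ρ r)) r := by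
  have h := ((hasDerivAt_id r).const_mul ρ).cos
  simp only [id, mul_one] at h
  convert! h using 1
  by_cases hρ : ρ = 0
  · simp [hρ]
  · rw [sineKernel_eq hρ]
    field_simp

@[fun_prop]
lemma continuous_sineKernel (ρ : ℝ) : Continuous (sineKernel ρ) :=
  continuous_iff_continuousAt.2 fun r => (hasDerivAt_sineKernel ρ r).continuousAt

/-- The exact value of the integral that is approximated by `dftThree`. -/
def sourceTransform (d : Data) (j : Fin 3 → ℤ) : ℂ :=
  ∫ r in Set.Ioi 0, d.source r * (sineKernel ‖d.freqVec j‖ r : ℂ)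

namespace Regular

lemma differentiable_Y (h : d.Regular m) : Differentiable ℝ d.Y :=
  h.contDiff_Y.differentiable (by positivity)

lemma contDiff_deriv_Y (h : d.Regular m) : ContDiff ℝ ((m + 2 : ℕ) : WithTop ℕ∞) (deriv d.Y) := by
  have h1 : ContDiff ℝ (((m + 2 : ℕ) : WithTop ℕ∞) + 1) d.Y := by exact_mod_cast h.contDiff_Y
  exact (contDiff_succ_iff_deriv.1 h1).2.2

lemma contDiff_deriv_deriv_Y (h : d.Regular m) :
    ContDiff ℝ ((m + 1 : ℕ) : WithTop ℕ∞) (deriv (deriv d.Y)) := by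
  have h1 : ContDiff ℝ (((m + 1 : ℕ) : WithTop ℕ∞) + 1) (deriv d.Y) := by
    exact_mod_cast h.contDiff_deriv_Y
  exact (contDiff_succ_iff_deriv.1 h1).2.2

lemma contDiff_source (h : d.Regular m) : ContDiff ℝ ((m + 1 : ℕ) : WithTop ℕ∞) d.source := by
  have h1 : ContDiff ℝ ((m + 1 : ℕ) : WithTop ℕ∞) (deriv d.Y) :=
    h.contDiff_deriv_Y.of_le (by exact_mod_cast Nat.le_succ (m + 1))
  have h2 := h.contDiff_deriv_deriv_Y
  have h3 : ContDiff ℝ ((m + 1 : ℕ) : WithTop ℕ∞) fun r : ℝ => (r : ℂ) :=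
    Complex.ofRealCLM.contDiff
  have h4 : ContDiff ℝ ((m + 1 : ℕ) : WithTop ℕ∞) fun r => ((deriv d.Y r : ℝ) : ℂ) :=
    Complex.ofRealCLM.contDiff.comp h1
  have h5 : ContDiff ℝ ((m + 1 : ℕ) : WithTop ℕ∞) fun r => ((deriv (deriv d.Y) r : ℝ) : ℂ) :=
    Complex.ofRealCLM.contDiff.comp h2
  exact ((contDiff_const.mul h3).cexp).mul ((contDiff_const.mul h4).add h5)

lemma deriv_Y_zero (h : d.Regular m) {r : ℝ} (hr : r < d.ε ∨ 2 * d.ε < r) :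
    d.Y =ᶠ[𝓝 r] (fun _ => d.Y r) := by
  rcases hr with hr | hr
  · filter_upwards [Iio_mem_nhds hr] with y hy
    rw [h.Y_one y (le_of_lt hy), h.Y_one r hr.le]
  · filter_upwards [Ioi_mem_nhds hr] with y hy
    rw [h.Y_zero y (le_of_lt hy), h.Y_zero r hr.le]

lemma source_zero (h : d.Regular m) {r : ℝ} (hr : r < d.ε ∨ 2 * d.ε < r) : d.source r = 0 := by
  have h1 : deriv d.Y =ᶠ[𝓝 r] fun _ => 0 := by
    have := (h.deriv_Y_zero hr).deriv
    simpa using this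
  have h2 : deriv d.Y r = 0 := h1.eq_of_nhds
  have h3 : deriv (deriv d.Y) r = 0 := by rw [h1.deriv_eq]; simp
  simp [source, h2, h3]

lemma hasCompactSupport_source (h : d.Regular m) : HasCompactSupport d.source := by
  refine HasCompactSupport.of_support_subset_isCompact (isCompact_Icc (a := d.ε) (b := 2 * d.ε)) ?_
  intro r hr
  by_contra hn
  rw [Set.mem_Icc, not_and_or, not_le, not_le] at hn
  exact hr (h.source_zero hn)

lemma profile_source (h : d.Regular m) : Profile d.source :=
  ⟨h.contDiff_source.continuous, 2 * d.ε + 1, by have := h.ε_pos; positivity,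
    fun r hr => h.source_zero (Or.inr (by linarith))⟩

lemma profile_outgoing (h : d.Regular m) : Profile d.outgoing := by
  have := h.contDiff_Y.continuous
  refine ⟨by unfold outgoing; fun_prop, 2 * d.ε, by have := h.ε_pos; positivity, fun r hr => ?_⟩
  simp [outgoing, h.Y_zero r hr]

/-- The source is C^(m+1) with support in [ε, 2ε], so m + 1 integrations by parts are possible; the
factor 1/ρ in sin(ρr)/ρ supplies one more power. -/
lemma norm_sourceTransform_le (h : d.Regular m) :
    ∃ C : ℝ, 0 ≤ C ∧ ∀ j, ‖d.sourceTransform j‖ ≤ C / (1 + ‖d.freqVec j‖) ^ (m + 2) := by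
  set A := ∫ t, ‖iteratedDeriv (m + 1) d.source t‖ with hA
  set B := ∫ r in Set.Ioi 0, ‖d.source r * (r : ℂ)‖ with hB
  have hA0 : 0 ≤ A := integral_nonneg fun t => norm_nonneg _
  have hB0 : 0 ≤ B := integral_nonneg fun t => norm_nonneg _
  refine ⟨2 ^ (m + 2) * (A + B), by positivity, fun j => ?_⟩
  set ρ := ‖d.freqVec j‖ with hρ
  have hρ0 : 0 ≤ ρ := norm_nonneg _
  -- For ρ ≤ 1 the trivial bound and 1 + ρ ≤ 2 suffice; for ρ ≥ 1 one has 1 + ρ ≤ 2ρ. Both cases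
  -- explain the factor 2^(m+2).
  rcases le_total ρ 1 with h1 | h1
  · have hb : ‖d.sourceTransform j‖ ≤ B := by
      refine norm_integral_le_of_norm_le
        (h.profile_source.mul Complex.continuous_ofReal).integrableOn.norm ?_
      refine Filter.Eventually.of_forall fun r => ?_
      rw [norm_mul, norm_mul, Complex.norm_real, Complex.norm_real]
      gcongr
      exact abs_sineKernel_le _ _
    rw [le_div_iff₀ (by positivity)]
    calc ‖d.sourceTransform j‖ * (1 + ρ) ^ (m + 2) ≤ (A + B) * 2 ^ (m + 2) := by
          gcongr
          · linarith
          · linarith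
      _ = _ := by ring
  · have hρp : 0 < ρ := by linarith
    have hw : ∀ r ≤ 0, d.source r = 0 := fun r hr =>
      h.source_zero (Or.inl (by linarith [h.ε_pos]))
    have hfull : d.sourceTransform j = ∫ r, d.source r * (sineKernel ρ r : ℂ) := by
      rw [sourceTransform, setIntegral_eq_integral_of_forall_compl_eq_zero]
      intro r hr
      rw [hw r (not_lt.1 hr), zero_mul]
    have hI : ∀ s : ℂ, Integrable fun t : ℝ => Complex.exp (Complex.I * s * t) * d.source t := by
      intro s
      refine Continuous.integrable_of_hasCompactSupport ?_ h.hasCompactSupport_source.mul_left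
      exact (by fun_prop : Continuous _).mul h.contDiff_source.continuous
    have hsplit : d.sourceTransform j =
        1 / (2 * Complex.I * ρ) * ((∫ t : ℝ, Complex.exp (Complex.I * (ρ : ℂ) * t) * d.source t) -
          ∫ t : ℝ, Complex.exp (Complex.I * (-ρ : ℂ) * t) * d.source t) := by
      rw [hfull, ← integral_sub (hI _) (hI _), ← integral_const_mul]
      congr 1
      ext r
      rw [sineKernel_eq hρp.ne']
      have hρc : (ρ : ℂ) ≠ 0 := by exact_mod_cast hρp.ne'
      push_cast
      rw [Complex.sin]
      have e1 : Complex.I * (ρ : ℂ) * r = ρ * r * Complex.I := by ring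
      have e2 : Complex.I * (-ρ : ℂ) * r = -(ρ * r) * Complex.I := by ring
      rw [e1, e2]
      field_simp
      rw [Complex.I_sq]
      ring
    have hρc : (ρ : ℂ) ≠ 0 := by exact_mod_cast hρp.ne'
    have hb1 := norm_integral_exp_mul_le (a := 0) h.contDiff_source h.hasCompactSupport_source
      (fun t ht => hw t ht.le) hρc (by simp)
    have hb2 := norm_integral_exp_mul_le (a := 0) h.contDiff_source h.hasCompactSupport_source
      (fun t ht => hw t ht.le) (neg_ne_zero.2 hρc) (by simp)
    simp only [norm_neg, Complex.norm_real, Real.norm_eq_abs, abs_of_pos hρp, mul_zero, neg_zero,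
      Real.exp_zero, mul_one] at hb1 hb2
    have hb : ‖d.sourceTransform j‖ ≤ A / ρ ^ (m + 2) := by
      rw [hsplit, norm_mul]
      have : ‖(1 / (2 * Complex.I * ρ) : ℂ)‖ = 1 / (2 * ρ) := by
        simp [abs_of_pos hρp]
      rw [this]
      calc 1 / (2 * ρ) * ‖_ - _‖ ≤ 1 / (2 * ρ) * (A / ρ ^ (m + 1) + A / ρ ^ (m + 1)) := by
            gcongr
            exact (norm_sub_le _ _).trans (add_le_add hb1 hb2)
        _ = A / ρ ^ (m + 2) := by
            rw [pow_succ ρ (m + 1)]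
            field_simp
            ring
    refine hb.trans ?_
    rw [div_le_div_iff₀ (by positivity) (by positivity)]
    calc A * (1 + ρ) ^ (m + 2) ≤ (A + B) * (2 * ρ) ^ (m + 2) := by
          gcongr
          · linarith
          · linarith
      _ = _ := by rw [mul_pow]; ring

/-- Green's identity in the radial variable. With v = exp(ikr) Y(r) and s = sin(ρr)/ρ, the equations
v'' + k²v = `source` and s'' = -ρ²s show that the Wronskian v's - vs' has derivative `source`·s +
(ρ² - k²) v s. It vanishes for large r and equals -1 at r = 0, which is the contribution of the
point source. -/
lemma symbol_mul_integral_outgoing (h : d.Regular m) (j : Fin 3 → ℤ) :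
    (d.symbol j : ℂ) * ∫ r in Set.Ioi 0, d.outgoing r * (sineKernel ‖d.freqVec j‖ r : ℂ) =
      1 - d.sourceTransform j := by
  set ρ := ‖d.freqVec j‖ with hρ
  have he : ∀ r : ℝ, HasDerivAt (fun r : ℝ => Complex.exp (Complex.I * d.k * r))
      (Complex.I * d.k * Complex.exp (Complex.I * d.k * r)) r := by
    intro r
    have := ((Complex.ofRealCLM.hasDerivAt (x := r)).const_mul (Complex.I * d.k)).cexp
    simpa [mul_comm] using this
  have hY1 : ∀ r, HasDerivAt (fun r => (d.Y r : ℂ)) ((deriv d.Y r : ℝ) : ℂ) r := fun r =>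
    (h.differentiable_Y r).hasDerivAt.ofReal_comp
  have hY2 : ∀ r, HasDerivAt (fun r => ((deriv d.Y r : ℝ) : ℂ))
      ((deriv (deriv d.Y) r : ℝ) : ℂ) r := fun r =>
    ((h.contDiff_deriv_Y.differentiable (by positivity)) r).hasDerivAt.ofReal_comp
  set v' : ℝ → ℂ := fun r => Complex.exp (Complex.I * d.k * r) *
    (Complex.I * d.k * d.Y r + ((deriv d.Y r : ℝ) : ℂ)) with hv'
  have hv : ∀ r, HasDerivAt d.outgoing (v' r) r := by
    intro r
    have := (he r).mul (hY1 r)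
    convert! this using 1
    simp only [hv']
    ring
  have hvv : ∀ r, HasDerivAt v' (d.source r - d.k ^ 2 * d.outgoing r) r := by
    intro r
    have := (he r).mul (((hY1 r).const_mul (Complex.I * d.k)).add (hY2 r))
    convert! this using 1
    simp only [source, outgoing, Pi.add_apply]
    ring_nf
    rw [Complex.I_sq]
    ring
  have hS : ∀ r, HasDerivAt (fun r => (sineKernel ρ r : ℂ)) ((Real.cos (ρ * r) : ℝ) : ℂ) r :=
    fun r => (hasDerivAt_sineKernel ρ r).ofReal_comp
  have hC : ∀ r, HasDerivAt (fun r => ((Real.cos (ρ * r) : ℝ) : ℂ))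
      ((-(ρ ^ 2 * sineKernel ρ r) : ℝ) : ℂ) r :=
    fun r => (hasDerivAt_cos_mul ρ r).ofReal_comp
  have hW : ∀ r, HasDerivAt (fun r => v' r * (sineKernel ρ r : ℂ) -
      d.outgoing r * ((Real.cos (ρ * r) : ℝ) : ℂ))
      (d.source r * (sineKernel ρ r : ℂ) +
        (d.symbol j : ℂ) * (d.outgoing r * (sineKernel ρ r : ℂ))) r := by
    intro r
    have := ((hvv r).mul (hS r)).sub ((hv r).mul (hC r))
    convert! this using 1
    rw [d.symbol_eq, ← hρ]
    push_cast
    ring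
  have hi1 : IntegrableOn (fun r => d.source r * (sineKernel ρ r : ℂ)) (Set.Ioi 0) :=
    (h.profile_source.mul (by fun_prop)).integrableOn
  have hi2 : IntegrableOn (fun r => d.outgoing r * (sineKernel ρ r : ℂ)) (Set.Ioi 0) :=
    (h.profile_outgoing.mul (by fun_prop)).integrableOn
  have hlim : Filter.Tendsto (fun r => v' r * (sineKernel ρ r : ℂ) -
      d.outgoing r * ((Real.cos (ρ * r) : ℝ) : ℂ)) Filter.atTop (𝓝 0) := by
    refine tendsto_const_nhds.congr' ?_
    filter_upwards [Filter.eventually_gt_atTop (2 * d.ε)] with r hr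
    have h1 : d.Y r = 0 := h.Y_zero r hr.le
    have h2 : deriv d.Y r = 0 := by rw [(h.deriv_Y_zero (Or.inr hr)).deriv_eq]; simp
    simp [hv', outgoing, h1, h2]
  have hFTC := integral_Ioi_of_hasDerivAt_of_tendsto' (a := 0) (fun r _ => hW r)
    (hi1.add (hi2.const_mul _)) hlim
  rw [integral_add hi1 (hi2.const_mul _), integral_const_mul] at hFTC
  have hY0 : d.Y 0 = 1 := h.Y_one 0 h.ε_pos.le
  have hS0 : sineKernel ρ 0 = 0 := by simp [sineKernel]
  simp only [hS0, outgoing, hY0] at hFTC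
  rw [sourceTransform]
  simp only [outgoing]
  simp at hFTC
  linear_combination hFTC

end Regular

end Data

/-- Turns a lower bound outside a finite set, together with pointwise positivity, into a uniform
lower bound. This is how the nonresonance hypotheses become quantitative. -/
lemma exists_pos_forall_le {ι : Type*} (g : ι → ℝ) (hg : ∀ i, 0 < g i) {δ : ℝ} (hδ : 0 < δ)
    (hfin : {i | g i < δ}.Finite) : ∃ δ' > 0, ∀ i, δ' ≤ g i := by
  rcases Set.eq_empty_or_nonempty {i | g i < δ} with h | h
  · refine ⟨δ, hδ, fun i => ?_⟩
    by_contra! hi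
    exact (h ▸ (show i ∈ {i | g i < δ} from hi) : i ∈ (∅ : Set ι))
  · obtain ⟨i₀, hi₀, hmin⟩ := Set.exists_min_image _ g hfin h
    refine ⟨g i₀, hg i₀, fun i => ?_⟩
    by_cases hi : g i < δ
    · exact hmin i hi
    · exact (le_of_lt hi₀).trans (not_lt.1 hi)

lemma exists_exp_neg_le {a : ℝ} (ha : 0 < a) :
    ∃ C : ℝ, 0 < C ∧ ∀ t : ℝ, 0 ≤ t → Real.exp (-(a * t)) ≤ C / (1 + t) ^ 2 := by
  set b := min 1 (a / 2) with hb
  have hb0 : 0 < b := lt_min one_pos (by positivity)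
  refine ⟨1 / b ^ 2, by positivity, fun t ht => ?_⟩
  have h1 : b * (1 + t) ≤ Real.exp (a * t / 2) := by
    have h2 := Real.add_one_le_exp (a * t / 2)
    have h3 : b ≤ 1 := min_le_left _ _
    have h4 : b ≤ a / 2 := min_le_right _ _
    nlinarith
  have h5 : Real.exp (a * t) = Real.exp (a * t / 2) ^ 2 := by
    rw [← Real.exp_nat_mul]; congr 1; push_cast; ring
  rw [Real.exp_neg, h5, div_div, ← mul_pow, ← one_div]
  gcongr

/-! ### Summation over the integer lattice -/

/-- The size `1 + |j₁| + |j₂| + |j₃|` of a multi-index. -/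
def size (j : Fin 3 → ℤ) : ℝ := 1 + |(j 0 : ℝ)| + |(j 1 : ℝ)| + |(j 2 : ℝ)|

lemma one_le_size (j : Fin 3 → ℤ) : 1 ≤ size j := by
  unfold size
  linarith [abs_nonneg (j 0 : ℝ), abs_nonneg (j 1 : ℝ), abs_nonneg (j 2 : ℝ)]

lemma size_pos (j : Fin 3 → ℤ) : 0 < size j := one_pos.trans_le (one_le_size j)

lemma one_add_abs_le_size (j : Fin 3 → ℤ) (i : Fin 3) : 1 + |(j i : ℝ)| ≤ size j := by
  unfold size
  have := abs_nonneg (j 0 : ℝ)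
  have := abs_nonneg (j 1 : ℝ)
  have := abs_nonneg (j 2 : ℝ)
  fin_cases i <;> simp <;> linarith

lemma summable_int_rpow {s : ℝ} (hs : 1 < s) : Summable fun n : ℤ => (1 + |(n : ℝ)|) ^ (-s) := by
  have h : Summable fun n : ℕ => (1 + |(n : ℝ)|) ^ (-s) := by
    have h1 := (summable_nat_add_iff 1).2 (Real.summable_nat_rpow.2 (show -s < -1 by linarith))
    refine h1.congr fun n => ?_
    rw [abs_of_nonneg (Nat.cast_nonneg n)]
    push_cast
    rw [add_comm]
  refine Summable.of_nat_of_neg (by simpa using h) (by simpa using h)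

/-- Multi-indices as triples. -/
def tripleEquiv : (Fin 3 → ℤ) ≃ (ℤ × ℤ) × ℤ where
  toFun j := ((j 0, j 1), j 2)
  invFun n := ![n.1.1, n.1.2, n.2]
  left_inv j := by ext i; fin_cases i <;> rfl
  right_inv n := rfl

lemma summable_triple {f g h : ℤ → ℝ} (hf : Summable f) (hg : Summable g) (hh : Summable h)
    (hf0 : 0 ≤ f) (hg0 : 0 ≤ g) (hh0 : 0 ≤ h) :
    Summable fun j : Fin 3 → ℤ => f (j 0) * g (j 1) * h (j 2) := by
  have h1 : Summable fun n : ℤ × ℤ => f n.1 * g n.2 := hf.mul_of_nonneg hg hf0 hg0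
  have h2 : Summable fun n : (ℤ × ℤ) × ℤ => (f n.1.1 * g n.1.2) * h n.2 :=
    h1.mul_of_nonneg hh (fun n => mul_nonneg (hf0 _) (hg0 _)) hh0
  exact (tripleEquiv.summable_iff (f := fun n : (ℤ × ℤ) × ℤ => (f n.1.1 * g n.1.2) * h n.2)).2 h2

lemma summable_int_sq : Summable fun n : ℤ => 1 / (1 + |(n : ℝ)|) ^ 2 := by
  refine (summable_int_rpow one_lt_two).congr fun n => ?_
  rw [Real.rpow_neg (by positivity), Real.rpow_two, one_div]

/-- The exponent 4 is shared equally among the three coordinates, each receiving 4/3 > 1. -/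
lemma summable_size : Summable fun j : Fin 3 → ℤ => 1 / size j ^ 4 := by
  have h := summable_int_rpow (s := 4 / 3) (by norm_num)
  have hn : (0 : ℤ → ℝ) ≤ fun n : ℤ => (1 + |(n : ℝ)|) ^ (-(4 / 3) : ℝ) := fun n => by
    simp only [Pi.zero_apply]; positivity
  refine Summable.of_nonneg_of_le (fun j => by have := size_pos j; positivity) (fun j => ?_)
    (summable_triple h h h hn hn hn)
  have h1 : ∀ i, size j ^ (-(4 / 3) : ℝ) ≤ (1 + |(j i : ℝ)|) ^ (-(4 / 3) : ℝ) := fun i =>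
    Real.rpow_le_rpow_of_nonpos (by positivity) (one_add_abs_le_size j i) (by norm_num)
  have hp := size_pos j
  have h2 : 1 / size j ^ 4 = size j ^ (-(4 / 3) : ℝ) * size j ^ (-(4 / 3) : ℝ) *
      size j ^ (-(4 / 3) : ℝ) := by
    rw [← Real.rpow_add hp, ← Real.rpow_add hp, one_div, ← Real.rpow_natCast, ← Real.rpow_neg hp.le]
    norm_num
  rw [h2]
  exact mul_le_mul (mul_le_mul (h1 0) (h1 1) (by positivity) (by positivity)) (h1 2)
    (by positivity) (by positivity)

/-- The weight `1 / ((1 + |n₁|)² (1 + |n₂|)²)`. -/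
def horizWeight (n : ℤ × ℤ) : ℝ := 1 / (1 + |(n.1 : ℝ)|) ^ 2 * (1 / (1 + |(n.2 : ℝ)|) ^ 2)

lemma horizWeight_nonneg (n : ℤ × ℤ) : 0 ≤ horizWeight n := by unfold horizWeight; positivity

lemma summable_horizWeight : Summable horizWeight :=
  summable_int_sq.mul_of_nonneg summable_int_sq (fun n => by simp only [Pi.zero_apply]; positivity)
    (fun n => by simp only [Pi.zero_apply]; positivity)

/-- The weight takes care of the horizontal indices, so `size j` is needed only for the sum over j₃.
-/
lemma summable_size_horizWeight :
    Summable fun j : Fin 3 → ℤ => horizWeight (j 0, j 1) / size j ^ 3 := by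
  have hn : (0 : ℤ → ℝ) ≤ fun n : ℤ => 1 / (1 + |(n : ℝ)|) ^ 2 := fun n => by
    simp only [Pi.zero_apply]; positivity
  refine Summable.of_nonneg_of_le (fun j => ?_) (fun j => ?_)
    (summable_triple summable_int_sq summable_int_sq summable_int_sq hn hn hn)
  · exact div_nonneg (horizWeight_nonneg _) (by have := size_pos j; positivity)
  · rw [div_eq_mul_one_div]
    refine mul_le_mul_of_nonneg_left ?_ (horizWeight_nonneg _)
    gcongr
    calc (1 + |(j 2 : ℝ)|) ^ 2 ≤ size j ^ 2 := by gcongr; exact one_add_abs_le_size j 2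
      _ ≤ size j ^ 3 := pow_le_pow_right₀ (one_le_size j) (by norm_num)

lemma finite_size_lt (R : ℝ) : {j : Fin 3 → ℤ | size j < R}.Finite := by
  refine (Finset.finite_toSet (BoxFourier.box (Fin 3) (⌈R⌉₊ + 1))).subset fun j hj => ?_
  rw [Finset.mem_coe, BoxFourier.mem_box]
  intro i
  have h1 := one_add_abs_le_size j i
  have h2 : |(j i : ℝ)| ≤ (⌈R⌉₊ : ℝ) := by
    have := Nat.le_ceil R
    have h3 : size j < R := hj
    linarith
  have h3 : |j i| ≤ (⌈R⌉₊ : ℤ) := by exact_mod_cast h2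
  rw [abs_le] at h3
  push_cast
  omega

namespace Data

variable {d : Data} {m : ℕ}

/-! ### The vertical wave numbers and the symbol -/

lemma beta_sq (d : Data) (n : ℤ × ℤ) : d.beta n ^ 2 = ((d.k ^ 2 - d.horiz n : ℝ) : ℂ) := by
  unfold beta
  split_ifs with h
  · rw [← Complex.ofReal_pow, Real.sq_sqrt (by linarith)]
  · rw [mul_pow, Complex.I_sq, ← Complex.ofReal_pow, Real.sq_sqrt (by linarith)]
    push_cast
    ring

lemma beta_im_nonneg (d : Data) (n : ℤ × ℤ) : 0 ≤ (d.beta n).im := by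
  unfold beta
  split_ifs with h
  · simp
  · simp

lemma sqrt_horiz_ge (d : Data) (n : ℤ × ℤ) :
    (|(n.1 : ℝ)| + |(n.2 : ℝ)|) / 2 - (|d.α₁| + |d.α₂|) ≤ √(d.horiz n) := by
  have h1 : |d.α₁ + n.1| ≤ √(d.horiz n) := by
    apply Real.abs_le_sqrt
    unfold horiz
    nlinarith [sq_nonneg (d.α₂ + n.2)]
  have h2 : |d.α₂ + n.2| ≤ √(d.horiz n) := by
    apply Real.abs_le_sqrt
    unfold horiz
    nlinarith [sq_nonneg (d.α₁ + n.1)]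
  have h3 : |(n.1 : ℝ)| ≤ |d.α₁ + n.1| + |d.α₁| := by
    have := abs_sub (d.α₁ + n.1) d.α₁
    simpa using this
  have h4 : |(n.2 : ℝ)| ≤ |d.α₂ + n.2| + |d.α₂| := by
    have := abs_sub (d.α₂ + n.2) d.α₂
    simpa using this
  have := abs_nonneg d.α₁
  have := abs_nonneg d.α₂
  linarith

lemma sqrt_horiz_sub_le_beta_im (hk : 0 < d.k) (n : ℤ × ℤ) :
    √(d.horiz n) - d.k ≤ (d.beta n).im := by
  have h0 : 0 ≤ d.horiz n := by unfold horiz; positivity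
  unfold beta
  split_ifs with h
  · have : √(d.horiz n) ≤ d.k := Real.sqrt_le_iff.2 ⟨hk.le, h⟩
    simp
    linarith
  · simp
    push Not at h
    have h1 : √(d.horiz n) ^ 2 = d.horiz n := Real.sq_sqrt h0
    have h2 : √(d.horiz n - d.k ^ 2) ^ 2 = d.horiz n - d.k ^ 2 := Real.sq_sqrt (by linarith)
    have h3 := Real.sqrt_nonneg (d.horiz n - d.k ^ 2)
    nlinarith [Real.sqrt_nonneg (d.horiz n)]

lemma norm_beta_le (hk : 0 < d.k) (n : ℤ × ℤ) :
    ‖d.beta n‖ ≤ d.k + |d.α₁| + |d.α₂| + |(n.1 : ℝ)| + |(n.2 : ℝ)| := by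
  have h1 : ‖d.beta n‖ ^ 2 ≤ (d.k + |d.α₁| + |d.α₂| + |(n.1 : ℝ)| + |(n.2 : ℝ)|) ^ 2 := by
    rw [← norm_pow, beta_sq, Complex.norm_real, Real.norm_eq_abs]
    have h0 : 0 ≤ d.horiz n := by unfold horiz; positivity
    have h3 := abs_add_le d.α₁ n.1
    have h4 := abs_add_le d.α₂ n.2
    have h5 : d.horiz n ≤ (|d.α₁| + |(n.1 : ℝ)|) ^ 2 + (|d.α₂| + |(n.2 : ℝ)|) ^ 2 := by
      unfold horiz
      rw [← sq_abs (d.α₁ + n.1), ← sq_abs (d.α₂ + n.2)]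
      gcongr
    refine (abs_sub _ _).trans ?_
    rw [abs_of_nonneg h0, abs_of_nonneg (sq_nonneg d.k)]
    set x := |d.α₁| + |(n.1 : ℝ)|
    set y := |d.α₂| + |(n.2 : ℝ)|
    have hx : 0 ≤ x := by positivity
    have hy : 0 ≤ y := by positivity
    have : (d.k + |d.α₁| + |d.α₂| + |(n.1 : ℝ)| + |(n.2 : ℝ)|) = d.k + x + y := by ring
    rw [this]
    nlinarith [mul_nonneg hx hy, mul_nonneg hk.le hx, mul_nonneg hk.le hy]
  exact le_of_sq_le_sq h1 (by positivity)

/-- The vertical frequency `j₃ π / ct`. -/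
abbrev vert (d : Data) (j₃ : ℤ) : ℝ := j₃ * Real.pi / d.ct

/-- Since β² = k² - |α + n|², the symbol is γ² - β². A lower bound for it thus passes to the two
factors that occur as denominators. -/
lemma symbol_eq_mul (d : Data) (j : Fin 3 → ℤ) :
    (d.symbol j : ℂ) = ((d.vert (j 2) : ℂ) - d.beta (j 0, j 1)) *
      ((d.vert (j 2) : ℂ) + d.beta (j 0, j 1)) := by
  have h := d.beta_sq (j 0, j 1)
  have : ((d.vert (j 2) : ℂ) - d.beta (j 0, j 1)) * ((d.vert (j 2) : ℂ) + d.beta (j 0, j 1)) =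
    (d.vert (j 2) : ℂ) ^ 2 - d.beta (j 0, j 1) ^ 2 := by ring
  rw [this, h, ← Complex.ofReal_pow, ← Complex.ofReal_sub]
  congr 1
  simp only [symbol, freq, Fin.sum_univ_three, horiz, vert]
  simp
  ring

namespace Regular

lemma ct_pos (h : d.Regular m) : 0 < d.ct := h.c_pos.trans h.c_lt

lemma vert_sub_beta_ne (h : d.Regular m) (n : ℤ × ℤ) (j₃ : ℤ) : (d.vert j₃ : ℂ) - d.beta n ≠ 0 :=
    fun h0 =>
  h.beta_ne' n j₃ (sub_eq_zero.1 h0).symm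

lemma vert_add_beta_ne (h : d.Regular m) (n : ℤ × ℤ) (j₃ : ℤ) : (d.vert j₃ : ℂ) + d.beta n ≠ 0 := by
  intro h0
  apply h.beta_ne' n (-j₃)
  rw [eq_neg_of_add_eq_zero_right h0]
  simp only [vert]
  push_cast
  ring

lemma symbol_ne (h : d.Regular m) (j : Fin 3 → ℤ) : d.symbol j ≠ 0 := by
  have : (d.symbol j : ℂ) ≠ 0 := by
    rw [symbol_eq_mul]
    exact mul_ne_zero (h.vert_sub_beta_ne _ _) (h.vert_add_beta_ne _ _)
  exact_mod_cast this

lemma abs_freq_le (h : d.Regular m) : ∃ C : ℝ, 0 < C ∧ ∀ j i, |d.freq j i| ≤ C * size j := by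
  have hct := h.ct_pos
  have hpi := Real.pi_pos
  refine ⟨1 + |d.α₁| + |d.α₂| + Real.pi / d.ct, by positivity, fun j i => ?_⟩
  have h0 := one_add_abs_le_size j 0
  have h1 := one_add_abs_le_size j 1
  have h2 := one_add_abs_le_size j 2
  have hs := one_le_size j
  have a1 := abs_nonneg d.α₁
  have a2 := abs_nonneg d.α₂
  have a3 : 0 ≤ Real.pi / d.ct := by positivity
  fin_cases i
  · simp only [freq]
    have := abs_add_le d.α₁ (j 0)
    simp
    nlinarith
  · simp only [freq]
    have := abs_add_le d.α₂ (j 1)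
    simp
    nlinarith
  · simp only [freq]
    simp
    rw [abs_div, abs_mul, abs_of_pos hpi, abs_of_pos hct]
    have : |(j 2 : ℝ)| * Real.pi / d.ct = |(j 2 : ℝ)| * (Real.pi / d.ct) := by ring
    rw [this]
    nlinarith

lemma size_le (h : d.Regular m) : ∃ C : ℝ, 0 < C ∧ ∀ j, size j ≤ C * (1 + ‖d.freqVec j‖) := by
  have hct := h.ct_pos
  have hpi := Real.pi_pos
  have a1 := abs_nonneg d.α₁
  have a2 := abs_nonneg d.α₂
  refine ⟨3 + |d.α₁| + |d.α₂| + d.ct / Real.pi, by positivity, fun j => ?_⟩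
  have hn : ∀ i, |d.freq j i| ≤ ‖d.freqVec j‖ := fun i => by
    have := PiLp.norm_apply_le (d.freqVec j) i
    simpa [freqVec] using this
  have h0 := hn 0
  have h1 := hn 1
  have h2 := hn 2
  simp only [freq] at h0 h1 h2
  simp at h0 h1 h2
  have e0 : |(j 0 : ℝ)| ≤ |d.α₁ + j 0| + |d.α₁| := by simpa using abs_sub (d.α₁ + j 0) d.α₁
  have e1 : |(j 1 : ℝ)| ≤ |d.α₂ + j 1| + |d.α₂| := by simpa using abs_sub (d.α₂ + j 1) d.α₂
  have e2 : |(j 2 : ℝ)| ≤ d.ct / Real.pi * ‖d.freqVec j‖ := by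
    rw [abs_div, abs_mul, abs_of_pos hpi, abs_of_pos hct, div_le_iff₀ hct] at h2
    rw [div_mul_eq_mul_div, le_div_iff₀ hpi]
    linarith
  have hc : 0 ≤ ‖d.freqVec j‖ := norm_nonneg _
  have a3 : 0 ≤ d.ct / Real.pi := by positivity
  unfold size
  nlinarith [mul_nonneg a1 hc, mul_nonneg a2 hc]

/-- The symbol is elliptic of order two, so only finitely many indices can violate the bound, and at
these it does not vanish. -/
lemma symbol_ge (h : d.Regular m) : ∃ δ : ℝ, 0 < δ ∧ ∀ j, δ * size j ^ 2 ≤ |d.symbol j| := by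
  obtain ⟨C, hC, hsize⟩ := h.size_le
  have hk := h.k_pos
  obtain ⟨δ, hδ, hle⟩ := exists_pos_forall_le (fun j => |d.symbol j| / size j ^ 2)
    (fun j => div_pos (abs_pos.2 (h.symbol_ne j)) (pow_pos (size_pos j) 2))
    -- Once 1 + r ≥ 4(1 + k) one has (1 + r)² ≤ 4(r² - k²), while `size j` ≤ C(1 + r).
    (δ := 1 / (4 * C ^ 2)) (by positivity)
    ((finite_size_lt (4 * C * (1 + d.k))).subset fun j hj => by
      simp only [Set.mem_ofPred_eq] at hj ⊢
      by_contra! hs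
      have h1 := hsize j
      have hp := size_pos j
      rw [div_lt_div_iff₀ (by positivity) (by positivity), symbol_eq] at hj
      have h2 : ‖d.freqVec j‖ ^ 2 - d.k ^ 2 ≤ |‖d.freqVec j‖ ^ 2 - d.k ^ 2| := le_abs_self _
      set r := ‖d.freqVec j‖
      have hr : 0 ≤ r := norm_nonneg _
      have h3 : 4 * (1 + d.k) ≤ 1 + r := by
        by_contra! hlt
        nlinarith
      have h4 : size j ^ 2 ≤ (C * (1 + r)) ^ 2 := by gcongr
      have h5 : (1 + r) ^ 2 ≤ 4 * (r ^ 2 - d.k ^ 2) := by nlinarith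
      have h6 : C ^ 2 * (1 + r) ^ 2 ≤ C ^ 2 * (4 * (r ^ 2 - d.k ^ 2)) := by gcongr
      have h7 : C ^ 2 * (4 * (r ^ 2 - d.k ^ 2)) ≤ C ^ 2 * (4 * |r ^ 2 - d.k ^ 2|) := by gcongr
      nlinarith)
  refine ⟨δ, hδ, fun j => ?_⟩
  have := hle j
  rwa [le_div_iff₀ (pow_pos (size_pos j) 2)] at this

lemma exists_beta_im_ge (h : d.Regular m) : ∃ K : ℝ, ∀ n : ℤ × ℤ,
    (|(n.1 : ℝ)| + |(n.2 : ℝ)|) / 2 - K ≤ (d.beta n).im := by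
  refine ⟨|d.α₁| + |d.α₂| + d.k, fun n => ?_⟩
  linarith [d.sqrt_horiz_ge n, sqrt_horiz_sub_le_beta_im h.k_pos n]

lemma norm_beta_ge (h : d.Regular m) : ∃ δ : ℝ, 0 < δ ∧ ∀ n, δ ≤ ‖d.beta n‖ := by
  obtain ⟨K, hK⟩ := h.exists_beta_im_ge
  refine exists_pos_forall_le (fun n => ‖d.beta n‖) (fun n => norm_pos_iff.2 (h.beta_ne n)) one_pos
    (((finite_size_lt (2 * K + 3)).image fun j => (j 0, j 1)).subset fun n hn => ?_)
  refine ⟨![n.1, n.2, 0], ?_, rfl⟩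
  simp only [Set.mem_ofPred_eq] at hn ⊢
  have h1 := hK n
  have h2 := (le_abs_self _).trans (Complex.abs_im_le_norm (d.beta n))
  simp [size]
  linarith

/-- The product of the two factors is at least a constant times `size j ^ 2`, and each is at most a
constant times `size j`; hence neither can be smaller than that order. -/
lemma vert_beta_ge (h : d.Regular m) : ∃ δ : ℝ, 0 < δ ∧ ∀ j : Fin 3 → ℤ,
    δ * size j ≤ ‖(d.vert (j 2) : ℂ) - d.beta (j 0, j 1)‖ ∧
    δ * size j ≤ ‖(d.vert (j 2) : ℂ) + d.beta (j 0, j 1)‖ := by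
  obtain ⟨δ, hδ, hs⟩ := h.symbol_ge
  obtain ⟨C, hC, hf⟩ := h.abs_freq_le
  have hk := h.k_pos
  set D := C + 1 + d.k + |d.α₁| + |d.α₂| with hD
  have hD0 : 0 < D := by positivity
  have a1 := abs_nonneg d.α₁
  have a2 := abs_nonneg d.α₂
  have hup : ∀ j : Fin 3 → ℤ, ‖(d.vert (j 2) : ℂ)‖ + ‖d.beta (j 0, j 1)‖ ≤ D * size j := by
    intro j
    have h1 := norm_beta_le hk (j 0, j 1)
    have h2 := hf j 2
    rw [Complex.norm_real, Real.norm_eq_abs]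
    have h3 : d.freq j 2 = d.vert (j 2) := rfl
    rw [h3] at h2
    have hs1 := one_le_size j
    have h4 : |(j 0 : ℝ)| + |(j 1 : ℝ)| ≤ size j := by
      unfold size; linarith [abs_nonneg (j 2 : ℝ)]
    simp only at h1
    nlinarith
  refine ⟨δ / D, by positivity, fun j => ?_⟩
  have hmul : δ * size j ^ 2 ≤ ‖(d.vert (j 2) : ℂ) - d.beta (j 0, j 1)‖ *
      ‖(d.vert (j 2) : ℂ) + d.beta (j 0, j 1)‖ := by
    rw [← norm_mul, ← symbol_eq_mul, Complex.norm_real]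
    exact hs j
  have hp := size_pos j
  have h1 := (norm_sub_le (d.vert (j 2) : ℂ) (d.beta (j 0, j 1))).trans (hup j)
  have h2 := (norm_add_le (d.vert (j 2) : ℂ) (d.beta (j 0, j 1))).trans (hup j)
  set x := ‖(d.vert (j 2) : ℂ) - d.beta (j 0, j 1)‖
  set y := ‖(d.vert (j 2) : ℂ) + d.beta (j 0, j 1)‖
  have hx : 0 ≤ x := norm_nonneg _
  have hy : 0 ≤ y := norm_nonneg _
  constructor
  · rw [div_mul_eq_mul_div, div_le_iff₀ hD0]
    have : x * y ≤ x * (D * size j) := by gcongr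
    nlinarith
  · rw [div_mul_eq_mul_div, div_le_iff₀ hD0]
    have : x * y ≤ (D * size j) * y := by gcongr
    nlinarith

lemma exp_neg_beta_im_le (h : d.Regular m) {a : ℝ} (ha : 0 < a) : ∃ C : ℝ, 0 < C ∧ ∀ n : ℤ × ℤ,
    Real.exp (-((d.beta n).im * a)) ≤ C * horizWeight n := by
  obtain ⟨K, hK⟩ := h.exists_beta_im_ge
  obtain ⟨C, hC, hexp⟩ := exists_exp_neg_le (a := a / 2) (by positivity)
  refine ⟨Real.exp (K * a) * C ^ 2, by positivity, fun n => ?_⟩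
  calc Real.exp (-((d.beta n).im * a))
      ≤ Real.exp (K * a + (-(a / 2 * |(n.1 : ℝ)|) + -(a / 2 * |(n.2 : ℝ)|))) := by
        apply Real.exp_le_exp.2
        nlinarith [hK n]
    _ = Real.exp (K * a) * (Real.exp (-(a / 2 * |(n.1 : ℝ)|)) *
          Real.exp (-(a / 2 * |(n.2 : ℝ)|))) := by rw [Real.exp_add, Real.exp_add]
    _ ≤ Real.exp (K * a) * (C / (1 + |(n.1 : ℝ)|) ^ 2 * (C / (1 + |(n.2 : ℝ)|) ^ 2)) := by
        gcongr
        · exact hexp _ (abs_nonneg _)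
        · exact hexp _ (abs_nonneg _)
    _ = _ := by unfold horizWeight; ring

end Regular

end Data

end MaxwellGreen

namespace BoxFourier

/-! ### Functions of one variable -/

/-- The Fourier integral `∫ D(z) exp (-i π j z / T) dz`. -/
def lineCoef (T : ℝ) (D : ℝ → ℂ) (j : ℤ) : ℂ :=
  ∫ z : ℝ, D z * Complex.exp (-(Complex.I * ((j * Real.pi / T * z : ℝ) : ℂ)))

/-- The discrete Fourier transform of a function of one variable. -/
def lineDft (T : ℝ) (M : ℕ) (D : ℝ → ℂ) (j : ℤ) : ℂ :=
  ((T / M : ℝ) : ℂ) * ∑ l ∈ Finset.Ico (-(M : ℤ)) M, D (l * T / M) *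
    Complex.exp (-(Complex.I * ((j * Real.pi / T * (l * T / M) : ℝ) : ℂ)))

lemma char_line (T : ℝ) (j : ℤ) (z : ℝ) :
    char (fun _ : Fin 1 => T) (fun _ => j) (fun _ => z) =
      Complex.exp (Complex.I * ((j * Real.pi / T * z : ℝ) : ℂ)) := by
  simp [char]

lemma char_line_neg (T : ℝ) (j : ℤ) (z : ℝ) :
    char (fun _ : Fin 1 => T) (-(fun _ => j)) (fun _ => z) =
      Complex.exp (-(Complex.I * ((j * Real.pi / T * z : ℝ) : ℂ))) := by
  have : (-(fun _ => j) : Fin 1 → ℤ) = fun _ => -j := rfl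
  rw [this, char_line, ← mul_neg]
  congr 2
  push_cast
  ring

lemma coef_line (T : ℝ) (D : ℝ → ℂ) (j : ℤ) :
    coef (fun _ : Fin 1 => T) (fun x => D (x 0)) (fun _ => j) = lineCoef T D j := by
  have := (volume_preserving_funUnique (Fin 1) ℝ).integral_comp'
    (g := fun z => D z * Complex.exp (-(Complex.I * ((j * Real.pi / T * z : ℝ) : ℂ))))
  rw [lineCoef, ← this, coef]
  refine integral_congr_ae (Filter.Eventually.of_forall fun x => ?_)
  have hx : x = fun _ => x 0 := by ext i; fin_cases i; rfl
  simp only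
  rw [hx, char_line_neg]
  rfl

lemma sum_box_line (N : ℕ) (f : (Fin 1 → ℤ) → ℝ) :
    ∑ j ∈ box (Fin 1) N, f j = ∑ j ∈ Finset.Ico (-(N : ℤ)) N, f fun _ => j := by
  refine Finset.sum_bij' (fun j _ => j 0) (fun j _ => fun _ => j) ?_ ?_ ?_ ?_ ?_
  · intro j hj; rw [Finset.mem_Ico]; exact mem_box.1 hj 0
  · intro j hj; rw [Finset.mem_Ico] at hj; exact mem_box.2 fun _ => hj
  · intro j _; ext i; fin_cases i; rfl
  · intro j _; rfl
  · intro j _; congr 1; ext i; fin_cases i; rfl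

lemma sum_box_line' (N : ℕ) (f : (Fin 1 → ℤ) → ℂ) :
    ∑ j ∈ box (Fin 1) N, f j = ∑ j ∈ Finset.Ico (-(N : ℤ)) N, f fun _ => j := by
  refine Finset.sum_bij' (fun j _ => j 0) (fun j _ => fun _ => j) ?_ ?_ ?_ ?_ ?_
  · intro j hj; rw [Finset.mem_Ico]; exact mem_box.1 hj 0
  · intro j hj; rw [Finset.mem_Ico] at hj; exact mem_box.2 fun _ => hj
  · intro j _; ext i; fin_cases i; rfl
  · intro j _; rfl
  · intro j _; congr 1; ext i; fin_cases i; rfl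

lemma dft_line (T : ℝ) (M : ℕ) (D : ℝ → ℂ) (j : ℤ) :
    dft (fun _ : Fin 1 => T) M (fun x => D (x 0)) (fun _ => j) = lineDft T M D j := by
  rw [dft, lineDft, sum_box_line']
  simp only [Finset.univ_unique, Finset.prod_singleton, node]
  congr 1
  refine Finset.sum_congr rfl fun l _ => ?_
  rw [← char_line_neg]
  rfl

lemma supportedIn_line {T b : ℝ} (hb : b < T) {D : ℝ → ℂ} (hD : Continuous D)
    (hz : ∀ z, b < |z| → D z = 0) : SupportedIn (fun _ : Fin 1 => T) fun x => D (x 0) :=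
  ⟨by fun_prop, fun _ => b, fun _ => hb, fun x i h => by
    have : i = 0 := Subsingleton.elim _ _
    subst this
    exact hz _ h⟩

lemma summable_coef_line {T : ℝ} {D : ℝ → ℂ} (hs : Summable (lineCoef T D)) :
    Summable (coef (fun _ : Fin 1 => T) fun x => D (x 0)) := by
  rw [← (Equiv.funUnique (Fin 1) ℤ).symm.summable_iff]
  exact hs.congr fun j => (coef_line T D j).symm

lemma hasSum_line {T b : ℝ} (hT : 0 < T) (hb : b < T) {D : ℝ → ℂ} (hD : Continuous D)
    (hz : ∀ z, b < |z| → D z = 0) (hs : Summable (lineCoef T D)) {z : ℝ} (hzT : |z| ≤ T) :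
    HasSum (fun j : ℤ => ((2 * T : ℝ) : ℂ)⁻¹ * lineCoef T D j *
      Complex.exp (Complex.I * ((j * Real.pi / T * z : ℝ) : ℂ))) (D z) := by
  have h := hasSum_char (fun _ => hT) (supportedIn_line hb hD hz) (summable_coef_line hs)
    (x := fun _ => z) (fun _ => hzT)
  rw [← (Equiv.funUnique (Fin 1) ℤ).symm.hasSum_iff] at h
  convert! h using 1
  ext j
  rw [← coef_line, ← char_line]
  simp only [Finset.univ_unique, Finset.prod_singleton, Function.comp_apply]
  rfl

lemma sum_norm_lineDft_sub_le {T b : ℝ} (hT : 0 < T) (hb : b < T) {D : ℝ → ℂ}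
    (hD : Continuous D) (hz : ∀ z, b < |z| → D z = 0) (hs : Summable (lineCoef T D)) {N M : ℕ}
    (hM : 0 < M) (hNM : N ≤ M) :
    ∑ j ∈ Finset.Ico (-(N : ℤ)) N, ‖lineDft T M D j - lineCoef T D j‖ ≤
      ∑' n : ℤ, if n ∈ Finset.Ico (-(M : ℤ)) M then 0 else ‖lineCoef T D n‖ := by
  have h := sum_norm_dft_sub_le (fun _ => hT) (supportedIn_line hb hD hz) (summable_coef_line hs)
    hM hNM
  rw [sum_box_line] at h
  simp only [coef_line, dft_line] at h
  refine h.trans_eq ?_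
  rw [← (Equiv.funUnique (Fin 1) ℤ).symm.tsum_eq]
  refine tsum_congr fun n => ?_
  have e1 : (Equiv.funUnique (Fin 1) ℤ).symm n = fun _ => n := rfl
  have e2 : (fun _ => n) ∈ box (Fin 1) M ↔ n ∈ Finset.Ico (-(M : ℤ)) M := by
    rw [mem_box, Finset.mem_Ico]
    exact ⟨fun h => h 0, fun h _ => h⟩
  rw [e1, coef_line]
  simp only [e2]

end BoxFourier

/-! ### Fourier coefficients of the regular part. -/

namespace MaxwellGreen

namespace Data

variable {d : Data} {m : ℕ}

/-- The integral over the half line of `exp(i (β_n - j₃ π / ct) t) χ'(t)`. -/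
def vertTransform (d : Data) (n : ℤ × ℤ) (j₃ : ℤ) : ℂ :=
  ∫ t : ℝ, Complex.exp (Complex.I * (d.beta n - d.vert j₃) * t) * ((deriv d.χ t : ℝ) : ℂ)

/-- The Fourier coefficients of the regular part of the Green's function, up to a constant
factor. -/
def regCoef (d : Data) (j : Fin 3 → ℤ) : ℂ :=
  1 / (2 * d.beta (j 0, j 1) * ((d.vert (j 2) : ℂ) - d.beta (j 0, j 1))) *
      d.vertTransform (j 0, j 1) (j 2)
    - 1 / (2 * d.beta (j 0, j 1) * ((d.vert (j 2) : ℂ) + d.beta (j 0, j 1))) *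
      d.vertTransform (j 0, j 1) (-(j 2))
    + 1 / (d.symbol j : ℂ) * d.sourceTransform j

namespace Regular

lemma differentiable_χ (h : d.Regular m) : Differentiable ℝ d.χ :=
  h.contDiff_χ.differentiable (by positivity)

lemma contDiff_deriv_χ (h : d.Regular m) :
    ContDiff ℝ ((m + 2 : ℕ) : WithTop ℕ∞) fun t => ((deriv d.χ t : ℝ) : ℂ) := by
  have h1 : ContDiff ℝ (((m + 2 : ℕ) : WithTop ℕ∞) + 1) d.χ := by exact_mod_cast h.contDiff_χ
  exact Complex.ofRealCLM.contDiff.comp (contDiff_succ_iff_deriv.1 h1).2.2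

lemma deriv_χ_zero (h : d.Regular m) {t : ℝ} (ht : t < d.c ∨ (d.c + d.ct) / 2 < t) :
    deriv d.χ t = 0 := by
  have : d.χ =ᶠ[𝓝 t] fun _ => d.χ t := by
    rcases ht with ht | ht
    · filter_upwards [Iio_mem_nhds ht] with y hy
      rw [h.χ_one y (le_of_lt hy), h.χ_one t ht.le]
    · filter_upwards [Ioi_mem_nhds ht] with y hy
      rw [h.χ_zero y (le_of_lt hy), h.χ_zero t ht.le]
  rw [this.deriv_eq]
  simp

lemma hasCompactSupport_deriv_χ (h : d.Regular m) :
    HasCompactSupport fun t => ((deriv d.χ t : ℝ) : ℂ) := by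
  refine HasCompactSupport.of_support_subset_isCompact
    (isCompact_Icc (a := d.c) (b := (d.c + d.ct) / 2)) ?_
  intro t ht
  by_contra hn
  rw [Set.mem_Icc, not_and_or, not_le, not_le] at hn
  exact ht (by simp [h.deriv_χ_zero hn])

/-- The function χ' is C^(m+2) and vanishes below height c. The first fact gives the powers of |β ∓
γ|, which is of order `size j`; the second gives exp(-c Im β), which is dominated by the horizontal
weight. -/
lemma norm_vertTransform_le (h : d.Regular m) : ∃ C : ℝ, 0 < C ∧ ∀ j : Fin 3 → ℤ,
    ‖d.vertTransform (j 0, j 1) (j 2)‖ ≤ C * (horizWeight (j 0, j 1) / size j ^ (m + 2)) ∧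
    ‖d.vertTransform (j 0, j 1) (-(j 2))‖ ≤ C * (horizWeight (j 0, j 1) / size j ^ (m + 2)) := by
  obtain ⟨δ, hδ, hβ⟩ := h.vert_beta_ge
  obtain ⟨E, hE, hexp⟩ := h.exp_neg_beta_im_le h.c_pos
  set A := ∫ t, ‖iteratedDeriv (m + 2) (fun t => ((deriv d.χ t : ℝ) : ℂ)) t‖ with hA
  have hA0 : 0 ≤ A := integral_nonneg fun t => norm_nonneg _
  have key : ∀ (n : ℤ × ℤ) (j₃ : ℤ) (x : ℝ), 0 < x → δ * x ≤ ‖d.beta n - d.vert j₃‖ →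
      ‖d.vertTransform n j₃‖ ≤ ((A + 1) * E / δ ^ (m + 2)) * (horizWeight n / x ^ (m + 2)) := by
    intro n j₃ x hx hs
    have hs0 : d.beta n - d.vert j₃ ≠ 0 := norm_pos_iff.1 (lt_of_lt_of_le (by positivity) hs)
    have him : (d.beta n - d.vert j₃).im = (d.beta n).im := by simp
    have := norm_integral_exp_mul_le (a := d.c) h.contDiff_deriv_χ h.hasCompactSupport_deriv_χ
      (fun t ht => by simp [h.deriv_χ_zero (Or.inl ht)]) hs0
      (by rw [him]; exact d.beta_im_nonneg n)
    rw [him] at this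
    refine this.trans ?_
    calc A * Real.exp (-((d.beta n).im * d.c)) / ‖d.beta n - d.vert j₃‖ ^ (m + 2)
        ≤ (A + 1) * (E * horizWeight n) / (δ * x) ^ (m + 2) := by
          have := horizWeight_nonneg n
          gcongr
          · linarith
          · exact hexp n
      _ = _ := by rw [mul_pow]; field_simp
  refine ⟨(A + 1) * E / δ ^ (m + 2), by positivity, fun j => ⟨?_, ?_⟩⟩
  · refine key _ _ _ (size_pos j) ?_
    rw [norm_sub_rev]
    exact (hβ j).1
  · refine key _ _ _ (size_pos j) ?_
    have : d.beta (j 0, j 1) - d.vert (-(j 2)) = d.vert (j 2) + d.beta (j 0, j 1) := by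
      simp only [vert]; push_cast; ring
    rw [this]
    exact (hβ j).2

lemma norm_sourceTransform_le_size (h : d.Regular m) : ∃ C : ℝ, 0 < C ∧ ∀ j : Fin 3 → ℤ,
    ‖d.sourceTransform j‖ ≤ C * (1 / size j ^ (m + 2)) := by
  obtain ⟨C, hC, hs⟩ := h.norm_sourceTransform_le
  obtain ⟨D, hD, hsize⟩ := h.size_le
  refine ⟨(C + 1) * D ^ (m + 2), by positivity, fun j => (hs j).trans ?_⟩
  have hp := size_pos j
  rw [mul_one_div, div_le_div_iff₀ (by positivity) (by positivity)]
  calc C * size j ^ (m + 2) ≤ (C + 1) * (D * (1 + ‖d.freqVec j‖)) ^ (m + 2) := by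
        gcongr
        · linarith
        · exact hsize j
    _ = _ := by rw [mul_pow]; ring

/-- The multipliers in front of the computed integrals in the coefficients. -/
lemma multiplier_le (h : d.Regular m) : ∃ C : ℝ, 0 < C ∧ ∀ j : Fin 3 → ℤ,
    ‖1 / (2 * d.beta (j 0, j 1) * ((d.vert (j 2) : ℂ) - d.beta (j 0, j 1)))‖ ≤ C / size j ∧
    ‖1 / (2 * d.beta (j 0, j 1) * ((d.vert (j 2) : ℂ) + d.beta (j 0, j 1)))‖ ≤ C / size j ∧
    ‖1 / (d.symbol j : ℂ)‖ ≤ C / size j ^ 2 := by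
  obtain ⟨δ, hδ, hβ⟩ := h.vert_beta_ge
  obtain ⟨δ', hδ', hn⟩ := h.norm_beta_ge
  obtain ⟨δ'', hδ'', hs⟩ := h.symbol_ge
  have e1 : 1 / (2 * δ' * δ) ≤ 1 / (2 * δ' * δ) + 1 / δ'' := by
    have : 0 < 1 / δ'' := by positivity
    linarith
  have e2 : 1 / δ'' ≤ 1 / (2 * δ' * δ) + 1 / δ'' := by
    have : 0 < 1 / (2 * δ' * δ) := by positivity
    linarith
  refine ⟨1 / (2 * δ' * δ) + 1 / δ'', by positivity, fun j => ⟨?_, ?_, ?_⟩⟩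
  · have hp := size_pos j
    rw [norm_div, norm_mul, norm_mul, norm_one, Complex.norm_two]
    calc _ ≤ 1 / (2 * δ' * (δ * size j)) := by
          gcongr
          · exact hn _
          · exact (hβ j).1
      _ = 1 / (2 * δ' * δ) / size j := by field_simp
      _ ≤ _ := by gcongr
  · have hp := size_pos j
    rw [norm_div, norm_mul, norm_mul, norm_one, Complex.norm_two]
    calc _ ≤ 1 / (2 * δ' * (δ * size j)) := by
          gcongr
          · exact hn _
          · exact (hβ j).2
      _ = 1 / (2 * δ' * δ) / size j := by field_simp
      _ ≤ _ := by gcongr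
  · have hp := size_pos j
    rw [norm_div, norm_one, Complex.norm_real, Real.norm_eq_abs]
    calc 1 / |d.symbol j| ≤ 1 / (δ'' * size j ^ 2) := by gcongr; exact hs j
      _ = 1 / δ'' / size j ^ 2 := by field_simp
      _ ≤ _ := by gcongr

/-- Counting orders: the vertical terms are bounded by w · size^(-1-(m+2)) with w the horizontal
weight, the source term by size^(-2-(m+2)). After multiplication by size^m there remain w ·
size^(-3) and size^(-4), both summable. -/
lemma summable_regCoef (h : d.Regular m) : Summable fun j => ‖d.regCoef j‖ * size j ^ m := by
  obtain ⟨A, hA, hmul⟩ := h.multiplier_le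
  obtain ⟨B, hB, hv⟩ := h.norm_vertTransform_le
  obtain ⟨C, hC, hs⟩ := h.norm_sourceTransform_le_size
  refine Summable.of_nonneg_of_le (fun j => ?_) (fun j => ?_)
    ((summable_size_horizWeight.mul_left (2 * A * B)).add (summable_size.mul_left (A * C)))
  · have := size_pos j; positivity
  have hp := size_pos j
  have hw := horizWeight_nonneg (j 0, j 1)
  obtain ⟨m1, m2, m3⟩ := hmul j
  obtain ⟨v1, v2⟩ := hv j
  have hb : ‖d.regCoef j‖ ≤ A / size j * (B * (horizWeight (j 0, j 1) / size j ^ (m + 2))) +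
      A / size j * (B * (horizWeight (j 0, j 1) / size j ^ (m + 2))) +
      A / size j ^ 2 * (C * (1 / size j ^ (m + 2))) := by
    refine (norm_add_le _ _).trans (add_le_add ((norm_sub_le _ _).trans (add_le_add ?_ ?_)) ?_)
    · rw [norm_mul]; gcongr
    · rw [norm_mul]; gcongr
    · rw [norm_mul]; gcongr; exact hs j
  refine (mul_le_mul_of_nonneg_right hb (by positivity)).trans_eq ?_
  rw [pow_add]
  field_simp
  ring

/-- One integration by parts; the constant 1 is the boundary value χ(0), and it will produce the
leading coefficient 1/symbol. -/
lemma integral_exp_mul_χ (h : d.Regular m) {s : ℂ} (hs : s ≠ 0) :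
    ∫ t in Set.Ioi (0 : ℝ), Complex.exp (Complex.I * s * t) * (d.χ t : ℂ) =
      Complex.I / s * (1 + ∫ t : ℝ, Complex.exp (Complex.I * s * t) *
        ((deriv d.χ t : ℝ) : ℂ)) := by
  have he : ∀ t : ℝ, HasDerivAt (fun t : ℝ => Complex.exp (Complex.I * s * t))
      (Complex.I * s * Complex.exp (Complex.I * s * t)) t := by
    intro t
    have := ((Complex.ofRealCLM.hasDerivAt (x := t)).const_mul (Complex.I * s)).cexp
    simpa [mul_comm] using this
  have hχ : ∀ t, HasDerivAt (fun t => (d.χ t : ℂ)) ((deriv d.χ t : ℝ) : ℂ) t := fun t =>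
    (h.differentiable_χ t).hasDerivAt.ofReal_comp
  have hχc := h.contDiff_χ.continuous
  have hP : Profile fun t => (d.χ t : ℂ) := ⟨by fun_prop, (d.c + d.ct) / 2, by
    have := h.c_pos; have := h.ct_pos; positivity, fun r hr => by simp [h.χ_zero r hr]⟩
  have hP' : Profile fun t => ((deriv d.χ t : ℝ) : ℂ) :=
    ⟨h.contDiff_deriv_χ.continuous, (d.c + d.ct) / 2 + 1, by
      have := h.c_pos; have := h.ct_pos; positivity,
      fun r hr => by simp [h.deriv_χ_zero (Or.inr (show (d.c + d.ct) / 2 < r by linarith))]⟩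
  have hi1 : IntegrableOn (fun t : ℝ => Complex.exp (Complex.I * s * t) * (d.χ t : ℂ))
      (Set.Ioi 0) := by
    simpa only [mul_comm] using (hP.mul
      (by fun_prop : Continuous fun t : ℝ => Complex.exp (Complex.I * s * t))).integrableOn
  have hi2 : IntegrableOn (fun t : ℝ => Complex.exp (Complex.I * s * t) *
      ((deriv d.χ t : ℝ) : ℂ)) (Set.Ioi 0) := by
    simpa only [mul_comm] using (hP'.mul
      (by fun_prop : Continuous fun t : ℝ => Complex.exp (Complex.I * s * t))).integrableOn
  have hfull : ∫ t : ℝ, Complex.exp (Complex.I * s * t) * ((deriv d.χ t : ℝ) : ℂ) =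
      ∫ t in Set.Ioi (0 : ℝ), Complex.exp (Complex.I * s * t) * ((deriv d.χ t : ℝ) : ℂ) := by
    rw [setIntegral_eq_integral_of_forall_compl_eq_zero]
    intro t ht
    have : deriv d.χ t = 0 := h.deriv_χ_zero (Or.inl ((not_lt.1 ht).trans_lt h.c_pos))
    simp [this]
  have hlim : Filter.Tendsto (fun t : ℝ => Complex.exp (Complex.I * s * t) * (d.χ t : ℂ))
      Filter.atTop (𝓝 0) := by
    refine tendsto_const_nhds.congr' ?_
    filter_upwards [Filter.eventually_ge_atTop ((d.c + d.ct) / 2)] with r hr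
    simp [h.χ_zero r hr]
  have hFTC := integral_Ioi_of_hasDerivAt_of_tendsto' (a := 0)
    (f' := fun t : ℝ => Complex.I * s * (Complex.exp (Complex.I * s * t) * (d.χ t : ℂ)) +
      Complex.exp (Complex.I * s * t) * ((deriv d.χ t : ℝ) : ℂ))
    (fun t _ => by
      have := (he t).mul (hχ t)
      convert! this using 1
      ring) ((hi1.const_mul _).add hi2) hlim
  rw [integral_add (hi1.const_mul _) hi2, integral_const_mul, ← hfull] at hFTC
  simp [h.χ_one 0 h.c_pos.le] at hFTC
  have hI : Complex.I * s ≠ 0 := mul_ne_zero Complex.I_ne_zero hs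
  apply mul_left_cancel₀ hI
  rw [eq_sub_of_add_eq hFTC]
  field_simp
  rw [Complex.I_sq]
  ring

/-- The vertical part of the mode of index `n` of the truncated Green's function. -/
lemma lineCoef_mode (h : d.Regular m) (j : Fin 3 → ℤ) :
    BoxFourier.lineCoef d.ct (fun z => Complex.I / (2 * d.beta (j 0, j 1)) *
        (Complex.exp (Complex.I * d.beta (j 0, j 1) * ((|z| : ℝ) : ℂ)) * (d.χ |z| : ℂ))) (j 2) =
      1 / (d.symbol j : ℂ)
      + 1 / (2 * d.beta (j 0, j 1) * ((d.vert (j 2) : ℂ) - d.beta (j 0, j 1))) *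
          d.vertTransform (j 0, j 1) (j 2)
      - 1 / (2 * d.beta (j 0, j 1) * ((d.vert (j 2) : ℂ) + d.beta (j 0, j 1))) *
          d.vertTransform (j 0, j 1) (-(j 2)) := by
  set β := d.beta (j 0, j 1) with hβ
  set γ := d.vert (j 2) with hγ
  have hβ0 : β ≠ 0 := h.beta_ne _
  have hs1 : (γ : ℂ) - β ≠ 0 := h.vert_sub_beta_ne _ _
  have hs2 : (γ : ℂ) + β ≠ 0 := h.vert_add_beta_ne _ _
  have hχc := h.contDiff_χ.continuous
  set f : ℝ → ℂ := fun z => Complex.I / (2 * β) *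
        (Complex.exp (Complex.I * β * ((|z| : ℝ) : ℂ)) * (d.χ |z| : ℂ)) *
        Complex.exp (-(Complex.I * ((γ * z : ℝ) : ℂ))) with hf
  have hInt : Integrable f := by
    refine Continuous.integrable_of_hasCompactSupport (by fun_prop) ?_
    refine HasCompactSupport.of_support_subset_isCompact
      (isCompact_Icc (a := -((d.c + d.ct) / 2)) (b := (d.c + d.ct) / 2)) ?_
    intro z hz
    rw [Set.mem_Icc, ← abs_le]
    by_contra! hn
    exact hz (by simp [hf, h.χ_zero _ hn.le])
  have h0 : BoxFourier.lineCoef d.ct (fun z => Complex.I / (2 * β) *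
        (Complex.exp (Complex.I * β * ((|z| : ℝ) : ℂ)) * (d.χ |z| : ℂ))) (j 2) = ∫ z, f z := rfl
  -- The half lines contribute with the frequencies β - γ and β + γ. Their boundary terms combine to
  -- i/(2β) · (i/(β - γ) + i/(β + γ)) = 1/(γ² - β²), the reciprocal symbol.
  rw [h0, ← intervalIntegral.integral_Iic_add_Ioi (b := 0) hInt.integrableOn hInt.integrableOn]
  have e1 : ∫ z in Set.Ioi (0 : ℝ), f z = Complex.I / (2 * β) *
      ∫ t in Set.Ioi (0 : ℝ), Complex.exp (Complex.I * (β - γ) * t) * (d.χ t : ℂ) := by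
    rw [← integral_const_mul]
    refine setIntegral_congr_fun measurableSet_Ioi fun z hz => ?_
    simp only [hf, abs_of_pos (show (0 : ℝ) < z from hz)]
    have : Complex.exp (Complex.I * (β - γ) * z) = Complex.exp (Complex.I * β * z) *
        Complex.exp (-(Complex.I * ((γ * z : ℝ) : ℂ))) := by
      rw [← Complex.exp_add]; congr 1; push_cast; ring
    rw [this]
    ring
  have e2 : ∫ z in Set.Iic (0 : ℝ), f z = Complex.I / (2 * β) *
      ∫ t in Set.Ioi (0 : ℝ), Complex.exp (Complex.I * (β + γ) * t) * (d.χ t : ℂ) := by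
    have := integral_comp_neg_Ioi (0 : ℝ) f
    rw [neg_zero] at this
    rw [← this, ← integral_const_mul]
    refine setIntegral_congr_fun measurableSet_Ioi fun z hz => ?_
    simp only [hf, abs_neg, abs_of_pos (show (0 : ℝ) < z from hz)]
    have : Complex.exp (Complex.I * (β + γ) * z) = Complex.exp (Complex.I * β * z) *
        Complex.exp (-(Complex.I * ((γ * -z : ℝ) : ℂ))) := by
      rw [← Complex.exp_add]; congr 1; push_cast; ring
    rw [this]
    ring
  rw [e1, e2, h.integral_exp_mul_χ (by rwa [add_comm] at hs2),
    h.integral_exp_mul_χ (by rw [← neg_sub]; exact neg_ne_zero.2 hs1)]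
  have hv1 : d.vertTransform (j 0, j 1) (j 2) = ∫ t : ℝ, Complex.exp (Complex.I * (β - γ) * t) *
        ((deriv d.χ t : ℝ) : ℂ) := rfl
  have hv2 : d.vertTransform (j 0, j 1) (-(j 2)) =
      ∫ t : ℝ, Complex.exp (Complex.I * (β + γ) * t) * ((deriv d.χ t : ℝ) : ℂ) := by
    have : β - (d.vert (-(j 2)) : ℂ) = β + γ := by simp only [hγ, vert]; push_cast; ring
    rw [vertTransform, this]
  rw [← hv1, ← hv2, symbol_eq_mul, ← hβ, ← hγ]
  have hs1' : β - γ ≠ 0 := by rw [← neg_sub]; exact neg_ne_zero.2 hs1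
  have hs2' : β + γ ≠ 0 := by rwa [add_comm] at hs2
  have hr1 : (γ : ℂ) - β = -(β - γ) := by ring
  have hr2 : (γ : ℂ) + β = β + γ := by ring
  rw [hr1, hr2]
  field_simp
  rw [Complex.I_sq]
  ring

end Regular

end Data

/-- Integrability of `1 / |y|` near the origin of the plane. -/
lemma Profile.integrable_plane {u : ℝ → ℂ} (hu : Profile u) :
    Integrable fun y : Fin 2 → ℝ => u √(y 0 ^ 2 + y 1 ^ 2) / ((√(y 0 ^ 2 + y 1 ^ 2) : ℝ) : ℂ) := by
  have h1 : Integrable fun x : EuclideanSpace ℝ (Fin 2) => u ‖x‖ / (‖x‖ : ℂ) := by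
    rw [integrable_fun_norm_addHaar volume (f := fun r => u r / (r : ℂ))]
    refine hu.integrableOn.congr_fun ?_ measurableSet_Ioi
    intro r hr
    have : (r : ℂ) ≠ 0 := by exact_mod_cast (ne_of_gt hr)
    simp only [finrank_euclideanSpace_fin, Complex.real_smul]
    push_cast
    field_simp
  have h2 :=
    (EuclideanSpace.volume_preserving_symm_measurableEquiv_toLp (Fin 2)).symm.integrable_comp_emb
    (MeasurableEquiv.measurableEmbedding _) (g := fun x => u ‖x‖ / (‖x‖ : ℂ))
  refine (h2.2 h1).congr (Filter.Eventually.of_forall fun y => ?_)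
  simp [EuclideanSpace.norm_eq, Fin.sum_univ_two]

@[fun_prop]
lemma continuous_glue : Continuous fun q : ℝ × (Fin 2 → ℝ) => glue q.1 q.2 := by
  unfold glue
  refine (PiLp.continuous_toLp 2 _).comp ?_
  refine continuous_pi fun i => ?_
  fin_cases i <;> simp <;> fun_prop

/-! ### Splitting of the Green's function into a singular and a regular part. -/

namespace Data

variable {d : Data} {m : ℕ}

lemma phase_ne_zero (d : Data) (x : E3) : d.phase x ≠ 0 := Complex.exp_ne_zero _

lemma norm_phase (d : Data) (x : E3) : ‖d.phase x‖ = 1 := by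
  rw [phase, mul_comm, Complex.norm_exp_ofReal_mul_I]

@[fun_prop]
lemma continuous_phase (d : Data) : Continuous d.phase := by
  unfold phase
  fun_prop

lemma norm_wave (d : Data) (j : Fin 3 → ℤ) (x : E3) : ‖d.wave j x‖ = 1 := by
  rw [wave, mul_comm, Complex.norm_exp_ofReal_mul_I]

lemma phase_mul_wave (d : Data) (j : Fin 3 → ℤ) (x : E3) :
    d.phase x * d.wave j x = Complex.exp (Complex.I * ((inner ℝ (d.freqVec j) x : ℝ) : ℂ)) := by
  rw [phase, wave, ← Complex.exp_add, ← mul_add, ← Complex.ofReal_add]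
  congr 3
  simp [freqVec, freq, PiLp.inner_apply, Fin.sum_univ_three]
  ring

lemma phase_inv_mul_wave_inv (d : Data) (j : Fin 3 → ℤ) (x : E3) :
    (d.phase x)⁻¹ * (d.wave j x)⁻¹ =
      Complex.exp (Complex.I * ((-(inner ℝ (d.freqVec j) x) : ℝ) : ℂ)) := by
  rw [← mul_inv, phase_mul_wave, ← Complex.exp_neg, Complex.ofReal_neg, mul_neg]

lemma F_eq (d : Data) (x : E3) :
    d.F x = (d.outgoing ‖x‖ * (1 / (4 * Real.pi) : ℂ)) / (‖x‖ : ℂ) * (d.phase x)⁻¹ := by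
  simp only [F, fundSol, outgoing]
  push_cast
  have : Complex.exp (Complex.I * (d.k * ‖x‖)) = Complex.exp (Complex.I * d.k * ‖x‖) := by
    rw [mul_assoc]
  rw [this]
  field_simp

/-- The Fourier transform of `F` in the horizontal variables. -/
def planeTransform (d : Data) (n : ℤ × ℤ) (z : ℝ) : ℂ :=
  ∫ y : Fin 2 → ℝ, d.F (glue z y) *
    Complex.exp (-(Complex.I * ((n.1 * y 0 + n.2 * y 1 : ℝ) : ℂ)))

/-- The vertical part of the mode of index `n` of the truncated Green's function. -/
def mode (d : Data) (n : ℤ × ℤ) (z : ℝ) : ℂ :=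
  Complex.I / (2 * d.beta n) *
    (Complex.exp (Complex.I * d.beta n * ((|z| : ℝ) : ℂ)) * (d.χ |z| : ℂ))

/-- The difference of the Green's function and its singular part. -/
def regular (d : Data) (x : E3) : ℂ := ∑' j, d.normFactor * d.regCoef j * d.phi j x

namespace Regular

lemma F_zero (h : d.Regular m) {x : E3} (hx : 2 * d.ε ≤ ‖x‖) : d.F x = 0 := by
  simp [F, h.Y_zero _ hx]

lemma integral_F_mul_wave (h : d.Regular m) (j : Fin 3 → ℤ) :
    Integrable (fun x => d.F x * (d.wave j x)⁻¹) ∧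
    ∫ x, d.F x * (d.wave j x)⁻¹ = 1 / (d.symbol j : ℂ) * (1 - d.sourceTransform j) := by
  have hP : Profile fun r => d.outgoing r * (1 / (4 * Real.pi) : ℂ) :=
    h.profile_outgoing.mul continuous_const
  have heq : ∀ x : E3, d.F x * (d.wave j x)⁻¹ =
      (d.outgoing ‖x‖ * (1 / (4 * Real.pi) : ℂ)) / (‖x‖ : ℂ) *
        Complex.exp (Complex.I * ((-(inner ℝ (d.freqVec j) x) : ℝ) : ℂ)) := by
    intro x
    rw [F_eq, mul_assoc, phase_inv_mul_wave_inv]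
  simp_rw [heq]
  constructor
  · refine hP.integrable_radial_mul (by fun_prop) fun x => ?_
    rw [mul_comm, Complex.norm_exp_ofReal_mul_I]
  · rw [hP.integral_radial, ← h.symbol_mul_integral_outgoing]
    have hs : (d.symbol j : ℂ) ≠ 0 := by exact_mod_cast h.symbol_ne j
    have hpi : (Real.pi : ℂ) ≠ 0 := by exact_mod_cast Real.pi_ne_zero
    have : ∀ r : ℝ, d.outgoing r * (1 / (4 * Real.pi) : ℂ) *
        ((r * Real.sinc (‖d.freqVec j‖ * r) : ℝ) : ℂ) =
        1 / (4 * Real.pi) * (d.outgoing r * (sineKernel ‖d.freqVec j‖ r : ℂ)) := by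
      intro r; rw [sineKernel]; ring
    simp_rw [this]
    rw [integral_const_mul]
    field_simp

lemma exists_norm_outgoing_le (h : d.Regular m) :
    ∃ A : ℝ, 0 ≤ A ∧ ∀ r, 0 ≤ r → ‖d.outgoing r‖ ≤ A := by
  obtain ⟨R, hR, hz⟩ := h.profile_outgoing.exists_zero
  obtain ⟨A, hA⟩ := (isCompact_Icc (a := (0 : ℝ)) (b := R)).exists_bound_of_continuousOn
    h.profile_outgoing.continuous.continuousOn
  refine ⟨max A 0, le_max_right _ _, fun r hr => ?_⟩
  rcases le_total r R with hrR | hrR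
  · exact (hA r ⟨hr, hrR⟩).trans (le_max_left _ _)
  · rw [hz r hrR, norm_zero]; exact le_max_right _ _

lemma measurable_F (h : d.Regular m) : Measurable d.F := by
  have h1 : d.F = fun x => (d.outgoing ‖x‖ * (1 / (4 * Real.pi) : ℂ)) / (‖x‖ : ℂ) *
      (d.phase x)⁻¹ := funext d.F_eq
  have hc := h.profile_outgoing.continuous.measurable
  rw [h1]
  have := d.continuous_phase.measurable
  fun_prop

lemma continuousAt_F (h : d.Regular m) {x : E3} (hx : x ≠ 0) : ContinuousAt d.F x := by
  have h1 : d.F = fun x => (d.outgoing ‖x‖ * (1 / (4 * Real.pi) : ℂ)) / (‖x‖ : ℂ) *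
      (d.phase x)⁻¹ := funext d.F_eq
  have hc := h.profile_outgoing.continuous
  rw [h1]
  refine ContinuousAt.mul (ContinuousAt.div (by fun_prop) (by fun_prop) ?_)
    (d.continuous_phase.continuousAt.inv₀ (d.phase_ne_zero x))
  exact_mod_cast norm_ne_zero_iff.2 hx

/-- Continuity across z = 0, where the slice meets the singularity, holds because 1/|y| is
integrable in the plane and dominates all slices. -/
lemma continuous_planeTransform (h : d.Regular m) (n : ℤ × ℤ) :
    Continuous (d.planeTransform n) := by
  obtain ⟨A, hA, hbd⟩ := h.exists_norm_outgoing_le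
  -- The hat function max(0, 2 - r) is at least 1 for r ≤ 1, and `F` vanishes outside the ball of
  -- radius 2ε < 1.
  have hb : Profile fun r : ℝ => ((max 0 (2 - r) : ℝ) : ℂ) :=
    ⟨by fun_prop, 2, two_pos, fun r hr => by rw [max_eq_left (by linarith)]; simp⟩
  refine continuous_of_dominated
    (bound := fun y => A * ‖((max 0 (2 - √(y 0 ^ 2 + y 1 ^ 2)) : ℝ) : ℂ) /
      ((√(y 0 ^ 2 + y 1 ^ 2) : ℝ) : ℂ)‖) ?_ ?_ (hb.integrable_plane.norm.const_mul A) ?_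
  · intro z
    have h1 : Measurable fun y : Fin 2 → ℝ => d.F (glue z y) :=
      h.measurable_F.comp (by fun_prop : Continuous fun y : Fin 2 → ℝ => glue z y).measurable
    exact (h1.mul (by fun_prop)).aestronglyMeasurable
  · intro z
    have h0 : ∀ᵐ y : Fin 2 → ℝ, y ≠ 0 := Measure.ae_ne volume 0
    filter_upwards [h0] with y hy
    rw [norm_mul]
    have he : ‖Complex.exp (-(Complex.I * ((n.1 * y 0 + n.2 * y 1 : ℝ) : ℂ)))‖ = 1 := by
      rw [mul_comm, ← neg_mul, ← Complex.ofReal_neg, Complex.norm_exp_ofReal_mul_I]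
    rw [he, mul_one]
    by_cases hx : 2 * d.ε ≤ ‖glue z y‖
    · rw [h.F_zero hx, norm_zero]; positivity
    · have hpos : 0 < y 0 ^ 2 + y 1 ^ 2 := by
        by_contra! hle
        apply hy
        have h0 : y 0 = 0 := by nlinarith [sq_nonneg (y 0), sq_nonneg (y 1)]
        have h1 : y 1 = 0 := by nlinarith [sq_nonneg (y 0), sq_nonneg (y 1)]
        ext i
        fin_cases i
        · exact h0
        · exact h1
      set s := √(y 0 ^ 2 + y 1 ^ 2) with hs
      have hs0 : 0 < s := Real.sqrt_pos.2 hpos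
      have hle : s ≤ ‖glue z y‖ := by
        rw [norm_glue]
        exact Real.sqrt_le_sqrt (by nlinarith [sq_nonneg z])
      have hs1 : s ≤ 1 := by linarith [not_le.1 hx, h.ε_lt_one]
      have e1 : ‖((‖glue z y‖ : ℝ) : ℂ)‖ = ‖glue z y‖ := by simp
      have e2 : ‖((max 0 (2 - s) : ℝ) : ℂ) / (s : ℂ)‖ = (2 - s) / s := by
        rw [norm_div, Complex.norm_real, Complex.norm_real, max_eq_right (by linarith),
          Real.norm_eq_abs, Real.norm_eq_abs, abs_of_pos hs0, abs_of_nonneg (by linarith)]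
      rw [F_eq, norm_mul, norm_inv, norm_phase, inv_one, mul_one, norm_div, norm_mul, e1, e2]
      have hpi : ‖(1 / (4 * Real.pi) : ℂ)‖ ≤ 1 := by
        simp only [norm_div, norm_mul, norm_one, Complex.norm_real, Real.norm_eq_abs,
          abs_of_pos Real.pi_pos]
        rw [div_le_one (by simpa using Real.pi_pos)]
        have := Real.pi_gt_three
        simp
        linarith
      have hg : 0 < ‖glue z y‖ := hs0.trans_le hle
      calc ‖d.outgoing ‖glue z y‖‖ * ‖(1 / (4 * Real.pi) : ℂ)‖ / ‖glue z y‖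
          ≤ A * 1 / s := by
            gcongr
            exact hbd _ (norm_nonneg _)
        _ ≤ A * ((2 - s) / s) := by
            rw [mul_div_assoc]
            gcongr
            linarith
  · have h0 : ∀ᵐ y : Fin 2 → ℝ, y ≠ 0 := Measure.ae_ne volume 0
    filter_upwards [h0] with y hy
    refine Continuous.mul ?_ continuous_const
    rw [continuous_iff_continuousAt]
    intro z
    refine ContinuousAt.comp (g := d.F) (f := fun z => glue z y) (h.continuousAt_F ?_)
      (by fun_prop : Continuous fun z => glue z y).continuousAt
    intro hg
    apply hy
    ext i
    fin_cases i
    · exact congrArg (fun x : E3 => x 0) hg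
    · exact congrArg (fun x : E3 => x 1) hg

lemma planeTransform_zero (h : d.Regular m) (n : ℤ × ℤ) {z : ℝ} (hz : 2 * d.ε ≤ |z|) :
    d.planeTransform n z = 0 := by
  rw [planeTransform]
  have : ∀ y, d.F (glue z y) = 0 := fun y => by
    refine h.F_zero (hz.trans ?_)
    rw [norm_glue, ← Real.sqrt_sq_eq_abs]
    exact Real.sqrt_le_sqrt (by nlinarith [sq_nonneg (y 0), sq_nonneg (y 1)])
  simp [this]

lemma lineCoef_planeTransform (h : d.Regular m) (j : Fin 3 → ℤ) :
    BoxFourier.lineCoef d.ct (d.planeTransform (j 0, j 1)) (j 2) =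
      1 / (d.symbol j : ℂ) * (1 - d.sourceTransform j) := by
  obtain ⟨hi, he⟩ := h.integral_F_mul_wave j
  rw [← he, integral_E3_eq hi, BoxFourier.lineCoef]
  congr 1
  ext z
  rw [planeTransform, ← integral_mul_const]
  congr 1
  ext y
  rw [mul_assoc, wave, ← Complex.exp_neg, ← Complex.exp_add]
  congr 2
  have e0 : (glue z y) 0 = y 0 := rfl
  have e1 : (glue z y) 1 = y 1 := rfl
  have e2 : (glue z y) 2 = z := rfl
  rw [e0, e1, e2]
  push_cast
  ring

lemma continuous_mode (h : d.Regular m) (n : ℤ × ℤ) : Continuous (d.mode n) := by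
  have hχc := h.contDiff_χ.continuous
  unfold mode
  fun_prop

lemma mode_sub_zero (h : d.Regular m) (n : ℤ × ℤ) {z : ℝ}
    (hz : max (2 * d.ε) ((d.c + d.ct) / 2) < |z|) :
    d.mode n z - d.planeTransform n z = 0 := by
  rw [h.planeTransform_zero n ((le_max_left _ _).trans hz.le), mode,
    h.χ_zero _ ((le_max_right _ _).trans hz.le)]
  simp

lemma integrable_mul_exp {D : ℝ → ℂ} (hD : Continuous D) {b : ℝ}
    (hz : ∀ z, b < |z| → D z = 0) (j₃ : ℤ) :
    Integrable fun z : ℝ =>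
      D z * Complex.exp (-(Complex.I * ((j₃ * Real.pi / d.ct * z : ℝ) : ℂ))) := by
  refine Continuous.integrable_of_hasCompactSupport (by fun_prop) ?_
  refine HasCompactSupport.of_support_subset_isCompact (isCompact_Icc (a := -b) (b := b)) ?_
  intro z hz'
  rw [Set.mem_Icc, ← abs_le]
  by_contra! hn
  exact hz' (by simp [hz _ hn])

/-- Here the singularity is removed: the reciprocal symbols of the mode and of `F` cancel, leaving
rapidly decaying terms only. -/
lemma lineCoef_mode_sub (h : d.Regular m) (j : Fin 3 → ℤ) :
    BoxFourier.lineCoef d.ct (fun z => d.mode (j 0, j 1) z - d.planeTransform (j 0, j 1) z) (j 2) =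
      d.regCoef j := by
  have h1 := h.lineCoef_mode j
  have h2 := h.lineCoef_planeTransform j
  have hi1 := integrable_mul_exp (d := d) (h.continuous_mode (j 0, j 1)) (b := (d.c + d.ct) / 2)
    (fun z hz => by rw [mode, h.χ_zero _ hz.le]; simp) (j 2)
  have hi2 := integrable_mul_exp (d := d) (h.continuous_planeTransform (j 0, j 1)) (b := 2 * d.ε)
    (fun z hz => h.planeTransform_zero _ hz.le) (j 2)
  have h3 : BoxFourier.lineCoef d.ct
      (fun z => d.mode (j 0, j 1) z - d.planeTransform (j 0, j 1) z) (j 2) =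
      BoxFourier.lineCoef d.ct (d.mode (j 0, j 1)) (j 2) -
        BoxFourier.lineCoef d.ct (d.planeTransform (j 0, j 1)) (j 2) := by
    simp only [BoxFourier.lineCoef, sub_mul]
    exact integral_sub hi1 hi2
  have h1' : BoxFourier.lineCoef d.ct (d.mode (j 0, j 1)) (j 2) = _ := h1
  rw [h3, h1', h2, regCoef]
  ring

lemma summable_norm_regCoef (h : d.Regular m) : Summable fun j => ‖d.regCoef j‖ := by
  refine Summable.of_nonneg_of_le (fun j => norm_nonneg _) (fun j => ?_) h.summable_regCoef
  exact le_mul_of_one_le_right (norm_nonneg _) (one_le_pow₀ (one_le_size j))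

lemma summable_norm_regCoef_triple (h : d.Regular m) :
    Summable fun n : (ℤ × ℤ) × ℤ => ‖d.regCoef (tripleEquiv.symm n)‖ :=
  (tripleEquiv.symm.summable_iff (f := fun j => ‖d.regCoef j‖)).2 h.summable_norm_regCoef

/-- The difference of profiles is continuous and vanishes near |z| = ct, so its vertical Fourier
series, having summable coefficients, converges to it at every height, including z = 0. -/
lemma hasSum_mode_sub (h : d.Regular m) (n : ℤ × ℤ) {z : ℝ} (hz : |z| ≤ d.ct) :
    HasSum (fun j₃ : ℤ => ((2 * d.ct : ℝ) : ℂ)⁻¹ * d.regCoef (tripleEquiv.symm (n, j₃)) *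
      Complex.exp (Complex.I * ((j₃ * Real.pi / d.ct * z : ℝ) : ℂ)))
      (d.mode n z - d.planeTransform n z) := by
  have hco : ∀ j₃ : ℤ, BoxFourier.lineCoef d.ct (fun z => d.mode n z - d.planeTransform n z) j₃ =
      d.regCoef (tripleEquiv.symm (n, j₃)) := fun j₃ =>
    h.lineCoef_mode_sub (tripleEquiv.symm (n, j₃))
  have hs : Summable (BoxFourier.lineCoef d.ct (fun z => d.mode n z - d.planeTransform n z)) := by
    refine Summable.of_norm ?_
    simp_rw [hco]
    exact h.summable_norm_regCoef_triple.prod_factor n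
  have := BoxFourier.hasSum_line (D := fun z => d.mode n z - d.planeTransform n z) h.ct_pos
    (b := max (2 * d.ε) ((d.c + d.ct) / 2))
    (max_lt h.ε_lt_ct (by linarith [h.c_lt]))
    ((h.continuous_mode n).sub (h.continuous_planeTransform n)) (fun z hz => h.mode_sub_zero n hz)
    hs hz
  simpa only [hco] using this

lemma summable_mode (h : d.Regular m) {z : ℝ} (hz : z ≠ 0) : Summable fun n => ‖d.mode n z‖ := by
  obtain ⟨C, hC, hexp⟩ := h.exp_neg_beta_im_le (abs_pos.2 hz)
  obtain ⟨δ, hδ, hn⟩ := h.norm_beta_ge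
  refine Summable.of_nonneg_of_le (fun n => norm_nonneg _) (fun n => ?_)
    (summable_horizWeight.mul_left (1 / (2 * δ) * (C * ‖(d.χ |z| : ℂ)‖)))
  have hw := horizWeight_nonneg n
  rw [mode, norm_mul, norm_mul, norm_div, Complex.norm_I, norm_mul, Complex.norm_two,
    Complex.norm_exp]
  have : (Complex.I * d.beta n * ((|z| : ℝ) : ℂ)).re = -((d.beta n).im * |z|) := by simp
  rw [this]
  calc 1 / (2 * ‖d.beta n‖) * (Real.exp (-((d.beta n).im * |z|)) * ‖(d.χ |z| : ℂ)‖)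
      ≤ 1 / (2 * δ) * ((C * horizWeight n) * ‖(d.χ |z| : ℂ)‖) := by
        gcongr
        · exact hn n
        · exact hexp n
    _ = _ := by ring

lemma summable_mode_sub (h : d.Regular m) {z : ℝ} (hz : |z| ≤ d.ct) :
    Summable fun n => ‖d.mode n z - d.planeTransform n z‖ := by
  have hct := h.ct_pos
  have h1 := h.summable_norm_regCoef_triple
  refine Summable.of_nonneg_of_le (fun n => norm_nonneg _) (fun n => ?_)
    (h1.prod.mul_left (2 * d.ct)⁻¹)
  rw [← tsum_mul_left]
  have hn : ∀ j₃ : ℤ, ‖((2 * d.ct : ℝ) : ℂ)⁻¹ * d.regCoef (tripleEquiv.symm (n, j₃)) *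
      Complex.exp (Complex.I * ((j₃ * Real.pi / d.ct * z : ℝ) : ℂ))‖ =
      (2 * d.ct)⁻¹ * ‖d.regCoef (tripleEquiv.symm (n, j₃))‖ := by
    intro j₃
    rw [norm_mul, norm_mul, mul_comm Complex.I, Complex.norm_exp_ofReal_mul_I, mul_one, norm_inv,
      Complex.norm_real, Real.norm_eq_abs, abs_of_pos (by positivity)]
  rw [← (h.hasSum_mode_sub n hz).tsum_eq]
  refine tsum_of_norm_bounded ((h1.prod_factor n).mul_left _).hasSum fun j₃ => (hn j₃).le

/-- A horizontal slice at height z ≠ 0 misses the singularity, so its restriction to the plane is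
continuous. -/
lemma supportedIn_F (h : d.Regular m) {z : ℝ} (hz : z ≠ 0) :
    BoxFourier.SupportedIn (fun _ : Fin 2 => Real.pi) fun y => d.F (glue z y) := by
  refine ⟨?_, fun _ => 1, fun _ => by linarith [Real.pi_gt_three], fun y i hi => h.F_zero ?_⟩
  · rw [continuous_iff_continuousAt]
    intro y
    refine ContinuousAt.comp (g := d.F) (f := fun y => glue z y) (h.continuousAt_F ?_)
      (by fun_prop : Continuous fun y => glue z y).continuousAt
    intro hg
    exact hz (congrArg (fun x : E3 => x 2) hg)
  · have h1 : |y i| ≤ ‖glue z y‖ := by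
      rw [norm_glue]
      apply Real.abs_le_sqrt
      fin_cases i <;> simp <;> nlinarith [sq_nonneg z, sq_nonneg (y 0), sq_nonneg (y 1)]
    linarith [h.ε_lt_one]

lemma coef_F (n : Fin 2 → ℤ) (z : ℝ) :
    BoxFourier.coef (fun _ : Fin 2 => Real.pi) (fun y => d.F (glue z y)) n =
      d.planeTransform (n 0, n 1) z := by
  rw [BoxFourier.coef, planeTransform]
  congr 1
  ext y
  congr 1
  rw [BoxFourier.char, ← mul_neg, ← Complex.ofReal_neg]
  congr 3
  have := Real.pi_ne_zero
  simp [Fin.sum_univ_two]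
  field_simp
  ring

/-- The horizontal coefficients of `F` are not estimated directly. They are differences of two
summable families: the modes, exponentially small off the plane, and mode minus coefficient,
controlled by `regCoef`. -/
lemma hasSum_F (h : d.Regular m) {z : ℝ} (hz : z ≠ 0) (hzct : |z| ≤ d.ct) {y : Fin 2 → ℝ}
    (hy : ∀ i, |y i| ≤ Real.pi) :
    HasSum (fun n : ℤ × ℤ => (4 * (Real.pi : ℂ) ^ 2)⁻¹ * d.planeTransform n z *
      Complex.exp (Complex.I * ((n.1 * y 0 + n.2 * y 1 : ℝ) : ℂ))) (d.F (glue z y)) := by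
  have hs : Summable fun n => d.planeTransform n z := by
    refine Summable.of_norm (Summable.of_nonneg_of_le (fun n => norm_nonneg _) (fun n => ?_)
      ((h.summable_mode hz).add (h.summable_mode_sub hzct)))
    have : d.planeTransform n z = d.mode n z - (d.mode n z - d.planeTransform n z) := by ring
    conv_lhs => rw [this]
    exact norm_sub_le _ _
  have hs' : Summable (BoxFourier.coef (fun _ : Fin 2 => Real.pi) fun y => d.F (glue z y)) := by
    rw [← (finTwoArrowEquiv ℤ).symm.summable_iff]
    refine hs.congr fun n => ?_
    rw [Function.comp_apply, coef_F]
    rfl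
  have := BoxFourier.hasSum_char (fun _ => Real.pi_pos) (h.supportedIn_F hz) hs' hy
  rw [← (finTwoArrowEquiv ℤ).symm.hasSum_iff] at this
  convert! this using 1
  ext n
  rw [Function.comp_apply, coef_F]
  congr 1
  · congr 1
    simp
    ring
  · rw [BoxFourier.char]
    congr 3
    have := Real.pi_ne_zero
    simp [Fin.sum_univ_two]

lemma normFactor_sq (h : d.Regular m) :
    d.normFactor * d.normFactor = (8 * (Real.pi : ℂ) ^ 2 * d.ct)⁻¹ := by
  have hct := h.ct_pos
  have hpi := Real.pi_pos
  rw [normFactor, ← Complex.ofReal_mul, div_mul_div_comm, Real.mul_self_sqrt (by positivity)]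
  push_cast
  ring

lemma summable_regular (h : d.Regular m) (x : E3) :
    Summable fun j => d.normFactor * d.regCoef j * d.phi j x := by
  refine Summable.of_norm ?_
  refine (h.summable_norm_regCoef.mul_left (‖d.normFactor‖ * ‖d.normFactor‖)).congr fun j => ?_
  rw [phi, norm_mul, norm_mul, norm_mul, norm_wave]
  ring

/-- The splitting of the Green's function off the plane `x₃ = 0`. -/
theorem green_mul_χ_of_ne (h : d.Regular m) {x : E3} (h0 : |x 0| ≤ Real.pi) (h1 : |x 1| ≤ Real.pi)
    (h2 : x 2 ≠ 0) (h2' : |x 2| ≤ d.ct) :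
    d.green x * (d.χ |x 2| : ℂ) = d.phase x * (d.regular x + d.F x) := by
  set z := x 2 with hz
  set y : Fin 2 → ℝ := ![x 0, x 1] with hy
  have hglue : glue z y = x := by ext i; fin_cases i <;> rfl
  have hpi : (Real.pi : ℂ) ≠ 0 := by exact_mod_cast Real.pi_ne_zero
  have hct : (d.ct : ℂ) ≠ 0 := by exact_mod_cast h.ct_pos.ne'
  set e : ℤ × ℤ → ℂ := fun n => Complex.exp (Complex.I * ((n.1 * y 0 + n.2 * y 1 : ℝ) : ℂ)) with he
  have hF := h.hasSum_F h2 h2' (y := y) (fun i => by fin_cases i <;> simpa [hy])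
  rw [hglue] at hF
  -- The absolutely convergent triple series is summed over j₃ first, which recovers the vertical
  -- profiles.
  have hreg : HasSum (fun n => (4 * (Real.pi : ℂ) ^ 2)⁻¹ *
      (d.mode n z - d.planeTransform n z) * e n) (d.regular x) := by
    have hs := (h.summable_regular x).hasSum
    rw [← tripleEquiv.symm.hasSum_iff] at hs
    refine hs.prod_fiberwise fun n => ?_
    have := ((h.hasSum_mode_sub n h2').mul_left ((4 * (Real.pi : ℂ) ^ 2)⁻¹)).mul_right (e n)
    convert! this using 1
    ext j₃
    simp only [Function.comp_apply, phi]
    have hw : d.wave (tripleEquiv.symm (n, j₃)) x =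
        Complex.exp (Complex.I * ((j₃ * Real.pi / d.ct * z : ℝ) : ℂ)) * e n := by
      rw [wave, he, ← Complex.exp_add, ← mul_add, ← Complex.ofReal_add]
      congr 3
      have t0 : tripleEquiv.symm (n, j₃) 0 = n.1 := rfl
      have t1 : tripleEquiv.symm (n, j₃) 1 = n.2 := rfl
      have t2 : tripleEquiv.symm (n, j₃) 2 = j₃ := rfl
      have y0 : y 0 = x 0 := rfl
      have y1 : y 1 = x 1 := rfl
      rw [t0, t1, t2, y0, y1, hz]
      ring
    have hnf := h.normFactor_sq
    rw [hw]
    calc d.normFactor * d.regCoef (tripleEquiv.symm (n, j₃)) * (d.normFactor *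
          (Complex.exp (Complex.I * ((j₃ * Real.pi / d.ct * z : ℝ) : ℂ)) * e n))
        = (d.normFactor * d.normFactor) * d.regCoef (tripleEquiv.symm (n, j₃)) *
          (Complex.exp (Complex.I * ((j₃ * Real.pi / d.ct * z : ℝ) : ℂ)) * e n) := by ring
      _ = _ := by
        rw [hnf]
        push_cast
        field_simp
        ring
  -- On addition the transforms of `F` cancel and the eigenfunction expansion times the cut-off
  -- remains.
  have hsum := (hreg.add hF).mul_left (d.phase x)
  rw [← hsum.tsum_eq, green, if_pos h2, eigenSeries, ← tsum_mul_left, ← tsum_mul_right]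
  refine tsum_congr fun n => ?_
  have hexp : Complex.exp (Complex.I * ((d.α₁ + n.1 : ℝ) : ℂ) * x 0 +
      Complex.I * ((d.α₂ + n.2 : ℝ) : ℂ) * x 1 + Complex.I * d.beta n * ((|x 2| : ℝ) : ℂ)) =
      d.phase x * e n * Complex.exp (Complex.I * d.beta n * ((|z| : ℝ) : ℂ)) := by
    rw [phase, he, ← Complex.exp_add, ← Complex.exp_add]
    congr 1
    simp [hy]
    ring
  have hβ := h.beta_ne n
  rw [hexp]
  simp only [mode]
  field_simp
  ring

end Regular

end Data

/-! ### Partial derivatives -/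

lemma pderiv_eq_fderiv {f : E3 → ℂ} {x : E3} (hf : DifferentiableAt ℝ f x) (p : Fin 3) :
    pderiv p f x = fderiv ℝ f x (EuclideanSpace.single p 1) :=
  hf.lineDeriv_eq_fderiv

lemma pderiv_congr {f g : E3 → ℂ} {x : E3} (hfg : f =ᶠ[𝓝 x] g) (p : Fin 3) :
    pderiv p f x = pderiv p g x :=
  hfg.lineDeriv_eq

lemma pderiv_eventuallyEq {f g : E3 → ℂ} {x : E3} (hfg : f =ᶠ[𝓝 x] g) (p : Fin 3) :
    pderiv p f =ᶠ[𝓝 x] pderiv p g :=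
  hfg.eventuallyEq_nhds.mono fun _ hy => pderiv_congr hy p

lemma pderiv_pderiv_congr {f g : E3 → ℂ} {x : E3} (hfg : f =ᶠ[𝓝 x] g) (p q : Fin 3) :
    pderiv p (pderiv q f) x = pderiv p (pderiv q g) x :=
  pderiv_congr (pderiv_eventuallyEq hfg q) p

lemma eventually_differentiableAt {f : E3 → ℂ} {x : E3} {n : ℕ}
    (hf : ContDiffAt ℝ ((n + 1 : ℕ) : WithTop ℕ∞) f x) :
    ∀ᶠ y in 𝓝 x, DifferentiableAt ℝ f y := by
  have := hf.eventually (by simp)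
  filter_upwards [this] with y hy
  exact hy.differentiableAt (by simp)

lemma contDiffAt_pderiv {f : E3 → ℂ} {x : E3} {n : ℕ}
    (hf : ContDiffAt ℝ ((n + 1 : ℕ) : WithTop ℕ∞) f x) (p : Fin 3) :
    ContDiffAt ℝ (n : WithTop ℕ∞) (pderiv p f) x := by
  have h1 : ContDiffAt ℝ (n : WithTop ℕ∞) (fderiv ℝ f) x := hf.fderiv_right (by norm_cast)
  have h2 : ContDiffAt ℝ (n : WithTop ℕ∞)
      (fun y => fderiv ℝ f y (EuclideanSpace.single p 1)) x := h1.clm_apply contDiffAt_const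
  exact h2.congr_of_eventuallyEq
    ((eventually_differentiableAt hf).mono fun y hy => pderiv_eq_fderiv hy p)

lemma continuousAt_pderiv_pderiv {f : E3 → ℂ} {x : E3} (hf : ContDiffAt ℝ 2 f x) (p q : Fin 3) :
    ContinuousAt (pderiv p (pderiv q f)) x :=
  (contDiffAt_pderiv (n := 0) (contDiffAt_pderiv (n := 1) hf q) p).continuousAt

lemma pderiv_pderiv_add {f g : E3 → ℂ} {x : E3} (hf : ContDiffAt ℝ 2 f x)
    (hg : ContDiffAt ℝ 2 g x) (p q : Fin 3) :
    pderiv p (pderiv q fun y => f y + g y) x =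
      pderiv p (pderiv q f) x + pderiv p (pderiv q g) x := by
  have hadd : ∀ {u v : E3 → ℂ} {y : E3} (r : Fin 3), DifferentiableAt ℝ u y →
      DifferentiableAt ℝ v y → pderiv r (fun y => u y + v y) y = pderiv r u y + pderiv r v y := by
    intro u v y r hu hv
    rw [pderiv_eq_fderiv hu, pderiv_eq_fderiv hv, 
      pderiv_eq_fderiv (show DifferentiableAt ℝ (fun y => u y + v y) y from hu.add hv),
      fderiv_fun_add hu hv]
    rfl
  have h1 : pderiv q (fun y => f y + g y) =ᶠ[𝓝 x] fun y => pderiv q f y + pderiv q g y := by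
    filter_upwards [eventually_differentiableAt (n := 1) hf,
      eventually_differentiableAt (n := 1) hg]
      with y hy hy' using hadd q hy hy'
  rw [pderiv_congr h1]
  exact hadd p ((contDiffAt_pderiv (n := 1) hf q).differentiableAt (by simp))
    ((contDiffAt_pderiv (n := 1) hg q).differentiableAt (by simp))

/-- Second derivatives of two functions agree at points that are limits of points near which the
functions agree. -/
lemma pderiv_pderiv_eq_of_frequently {f g : E3 → ℂ} {x : E3} (hf : ContDiffAt ℝ 2 f x)
    (hg : ContDiffAt ℝ 2 g x) (hfg : ∃ᶠ y in 𝓝 x, f =ᶠ[𝓝 y] g) (p q : Fin 3) :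
    pderiv p (pderiv q f) x = pderiv p (pderiv q g) x := by
  by_contra hne
  have h1 := ((continuousAt_pderiv_pderiv hf p q).sub
    (continuousAt_pderiv_pderiv hg p q)).eventually_ne (sub_ne_zero.2 hne)
  obtain ⟨y, hy, hne'⟩ := (hfg.and_eventually h1).exists
  exact hne' (sub_eq_zero.2 (pderiv_pderiv_congr hy p q))

/-! ### Trigonometric series -/

namespace Data

variable {d : Data} {m : ℕ}

/-- `exp(i c_j · x)`. -/
def planeWave (d : Data) (j : Fin 3 → ℤ) (x : E3) : ℂ :=
  Complex.exp (Complex.I * ((inner ℝ (d.freqVec j) x : ℝ) : ℂ))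

/-- The series `∑ a_j exp(i c_j · x)`. -/
def waveSeries (d : Data) (a : (Fin 3 → ℤ) → ℂ) (x : E3) : ℂ := ∑' j, a j * d.planeWave j x

lemma norm_planeWave (d : Data) (j : Fin 3 → ℤ) (x : E3) : ‖d.planeWave j x‖ = 1 := by
  rw [planeWave, mul_comm, Complex.norm_exp_ofReal_mul_I]

lemma iteratedDeriv_exp_I_mul (k : ℕ) :
    iteratedDeriv k (fun t : ℝ => Complex.exp (Complex.I * t)) =
      fun t : ℝ => Complex.I ^ k * Complex.exp (Complex.I * t) := by
  induction k with
  | zero => simp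
  | succ k ih =>
    rw [iteratedDeriv_succ, ih]
    ext t
    have h1 : HasDerivAt (fun t : ℝ => Complex.exp (Complex.I * t))
        (Complex.exp (Complex.I * t) * Complex.I) t := by
      simpa using ((Complex.ofRealCLM.hasDerivAt (x := t)).const_mul Complex.I).cexp
    rw [(h1.const_mul (Complex.I ^ k)).deriv]
    ring

lemma contDiff_exp_I_mul (n : WithTop ℕ∞) :
    ContDiff ℝ n fun t : ℝ => Complex.exp (Complex.I * t) :=
  (contDiff_const.mul Complex.ofRealCLM.contDiff).cexp

lemma contDiff_planeWave (d : Data) (j : Fin 3 → ℤ) (n : WithTop ℕ∞) :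
    ContDiff ℝ n (d.planeWave j) :=
  (contDiff_exp_I_mul n).comp (innerSL ℝ (d.freqVec j)).contDiff

lemma norm_iteratedFDeriv_planeWave_le (d : Data) (j : Fin 3 → ℤ) (k : ℕ) (x : E3) :
    ‖iteratedFDeriv ℝ k (d.planeWave j) x‖ ≤ ‖d.freqVec j‖ ^ k := by
  have h1 : d.planeWave j = (fun t : ℝ => Complex.exp (Complex.I * t)) ∘
      (innerSL ℝ (d.freqVec j)) := rfl
  rw [h1, ContinuousLinearMap.iteratedFDeriv_comp_right _ (contDiff_exp_I_mul k) x le_rfl]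
  refine (ContinuousMultilinearMap.norm_compContinuousLinearMap_le _ _).trans ?_
  rw [norm_iteratedFDeriv_eq_norm_iteratedDeriv, iteratedDeriv_exp_I_mul, norm_mul, norm_pow,
    Complex.norm_I, one_pow, mul_comm Complex.I, Complex.norm_exp_ofReal_mul_I, one_mul, one_mul,
    Finset.prod_const, innerSL_apply_norm]
  simp

lemma hasLineDerivAt_planeWave (d : Data) (j : Fin 3 → ℤ) (p : Fin 3) (x : E3) (t : ℝ) :
    HasDerivAt (fun t : ℝ => d.planeWave j (x + t • EuclideanSpace.single p (1 : ℝ)))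
      (Complex.I * d.freq j p * d.planeWave j (x + t • EuclideanSpace.single p (1 : ℝ))) t := by
  have h1 : ∀ t : ℝ, inner ℝ (d.freqVec j) (x + t • EuclideanSpace.single p (1 : ℝ)) =
      inner ℝ (d.freqVec j) x + t * d.freq j p := by
    intro t
    rw [inner_add_right, inner_smul_right, EuclideanSpace.inner_single_right]
    simp [freqVec]
  simp only [planeWave, h1]
  have h2 : HasDerivAt (fun t : ℝ => ((inner ℝ (d.freqVec j) x + t * d.freq j p : ℝ) : ℂ))
      (d.freq j p : ℂ) t := by
    have := (((hasDerivAt_id t).mul_const (d.freq j p)).const_add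
      (inner ℝ (d.freqVec j) x)).ofReal_comp
    simpa using this
  have := (h2.const_mul Complex.I).cexp
  convert! this using 1
  ring

lemma summable_mul_planeWave {a : (Fin 3 → ℤ) → ℂ} (ha : Summable fun j => ‖a j‖) (x : E3) :
    Summable fun j => a j * d.planeWave j x :=
  Summable.of_norm (ha.congr fun j => by rw [norm_mul, norm_planeWave, mul_one])

/-- Termwise differentiation along a line: the differentiated series has a summable majorant
independent of the point. -/
lemma pderiv_waveSeries {a : (Fin 3 → ℤ) → ℂ} (p : Fin 3) (ha : Summable fun j => ‖a j‖)
    (ha' : Summable fun j => ‖a j‖ * |d.freq j p|) :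
    pderiv p (d.waveSeries a) = d.waveSeries fun j => Complex.I * d.freq j p * a j := by
  ext x
  have h := hasDerivAt_tsum ha'
    (g := fun j t => a j * d.planeWave j (x + t • EuclideanSpace.single p (1 : ℝ)))
    (fun j t => (d.hasLineDerivAt_planeWave j p x t).const_mul (a j))
    (fun j t => by
      rw [norm_mul, norm_mul, norm_mul, norm_planeWave, Complex.norm_I, Complex.norm_real,
        Real.norm_eq_abs, one_mul, mul_one]) (y₀ := 0) (summable_mul_planeWave ha _) 0
  rw [pderiv, lineDeriv]
  refine h.deriv.trans ?_
  rw [waveSeries]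
  refine tsum_congr fun j => ?_
  simp only [zero_smul, add_zero]
  ring

lemma norm_freqVec_le (h : d.Regular m) :
    ∃ C : ℝ, 0 < C ∧ ∀ j, ‖d.freqVec j‖ ≤ C * size j := by
  obtain ⟨C, hC, hf⟩ := h.abs_freq_le
  refine ⟨3 * C, by positivity, fun j => ?_⟩
  have h1 : ‖d.freqVec j‖ ^ 2 ≤ (3 * C * size j) ^ 2 := by
    rw [EuclideanSpace.norm_sq_eq, Fin.sum_univ_three]
    simp only [Real.norm_eq_abs, freqVec]
    have hp := size_pos j
    have h0 := hf j 0
    have h1 := hf j 1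
    have h2 := hf j 2
    have : ∀ t : ℝ, |t| ≤ C * size j → |t| ^ 2 ≤ (C * size j) ^ 2 := fun t ht => by gcongr
    nlinarith [this _ h0, this _ h1, this _ h2]
  exact le_of_sq_le_sq h1 (by have := size_pos j; positivity)

lemma contDiff_waveSeries (h : d.Regular m) {a : (Fin 3 → ℤ) → ℂ}
    (ha : Summable fun j => ‖a j‖ * size j ^ 2) : ContDiff ℝ 2 (d.waveSeries a) := by
  obtain ⟨C, hC, hf⟩ := norm_freqVec_le h
  have key : ContDiff ℝ ((2 : ℕ∞) : WithTop ℕ∞) (d.waveSeries a) := by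
    refine contDiff_tsum (v := fun k j => ‖a j‖ * ‖d.freqVec j‖ ^ k)
      (fun j => contDiff_const.mul (d.contDiff_planeWave j _)) ?_ ?_
    · intro k hk
      have hk' : k ≤ 2 := by exact_mod_cast hk
      refine Summable.of_nonneg_of_le (fun j => by positivity) (fun j => ?_)
        (ha.mul_left ((C + 1) ^ 2))
      have hs := one_le_size j
      calc ‖a j‖ * ‖d.freqVec j‖ ^ k ≤ ‖a j‖ * ((C + 1) * size j) ^ k := by
            gcongr
            nlinarith [hf j]
        _ ≤ ‖a j‖ * ((C + 1) * size j) ^ 2 := by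
            gcongr
            nlinarith
        _ = _ := by ring
    · intro k j x _
      have : (fun x => a j * d.planeWave j x) = fun x => a j • d.planeWave j x := rfl
      rw [this, iteratedFDeriv_const_smul_apply' (d.contDiff_planeWave j _).contDiffAt, norm_smul]
      gcongr
      exact d.norm_iteratedFDeriv_planeWave_le j k x
  exact_mod_cast key

lemma pderiv_pderiv_waveSeries (h : d.Regular m) {a : (Fin 3 → ℤ) → ℂ}
    (ha : Summable fun j => ‖a j‖ * size j ^ 2) (p q : Fin 3) :
    pderiv p (pderiv q (d.waveSeries a)) =
      d.waveSeries fun j => -(d.freq j p : ℂ) * d.freq j q * a j := by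
  obtain ⟨C, hC, hf⟩ := h.abs_freq_le
  have h0 : Summable fun j => ‖a j‖ := Summable.of_nonneg_of_le (fun j => norm_nonneg _)
    (fun j => le_mul_of_one_le_right (norm_nonneg _) (one_le_pow₀ (one_le_size j))) ha
  have h1 : ∀ r, Summable fun j => ‖a j‖ * |d.freq j r| := fun r =>
    Summable.of_nonneg_of_le (fun j => by positivity) (fun j => by
      have hs := one_le_size j
      calc ‖a j‖ * |d.freq j r| ≤ ‖a j‖ * (C * size j ^ 2) := by
            gcongr
            exact (hf j r).trans (by gcongr; nlinarith)
        _ = C * (‖a j‖ * size j ^ 2) := by ring) (ha.mul_left C)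
  rw [pderiv_waveSeries q h0 (h1 q), pderiv_waveSeries p]
  · congr 1
    ext j
    linear_combination (d.freq j p : ℂ) * d.freq j q * a j * Complex.I_sq
  · refine (h1 q).congr fun j => ?_
    rw [norm_mul, norm_mul, Complex.norm_I, Complex.norm_real, Real.norm_eq_abs]
    ring
  · refine Summable.of_nonneg_of_le (fun j => by positivity) (fun j => ?_) (ha.mul_left (C ^ 2))
    rw [norm_mul, norm_mul, Complex.norm_I, Complex.norm_real, Real.norm_eq_abs, one_mul]
    have hs := size_pos j
    calc |d.freq j q| * ‖a j‖ * |d.freq j p| ≤ (C * size j) * ‖a j‖ * (C * size j) := by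
          gcongr
          · exact hf j q
          · exact hf j p
      _ = _ := by ring

/-! ### Reduction to the period cell -/

lemma reduce_zero_mem (x : E3) : reduce x 0 ∈ Set.Ico (-Real.pi) Real.pi := by
  have := toIcoMod_mem_Ico Real.two_pi_pos (-Real.pi) (x 0)
  rw [show -Real.pi + 2 * Real.pi = Real.pi by ring] at this
  exact this

lemma reduce_one_mem (x : E3) : reduce x 1 ∈ Set.Ico (-Real.pi) Real.pi := by
  have := toIcoMod_mem_Ico Real.two_pi_pos (-Real.pi) (x 1)
  rw [show -Real.pi + 2 * Real.pi = Real.pi by ring] at this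
  exact this

lemma reduce_two (x : E3) : reduce x 2 = x 2 := rfl

lemma exists_reduce_eq (x : E3) : ∃ k l : ℤ,
    x 0 = reduce x 0 + k * (2 * Real.pi) ∧ x 1 = reduce x 1 + l * (2 * Real.pi) := by
  refine ⟨toIcoDiv Real.two_pi_pos (-Real.pi) (x 0), toIcoDiv Real.two_pi_pos (-Real.pi) (x 1),
    ?_, ?_⟩
  · have := toIcoMod_add_toIcoDiv_zsmul Real.two_pi_pos (-Real.pi) (x 0)
    rw [zsmul_eq_mul] at this
    exact this.symm
  · have := toIcoMod_add_toIcoDiv_zsmul Real.two_pi_pos (-Real.pi) (x 1)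
    rw [zsmul_eq_mul] at this
    exact this.symm

lemma reduce_eq_self {x : E3} (h0 : |x 0| < Real.pi) (h1 : |x 1| < Real.pi) : reduce x = x := by
  rw [abs_lt] at h0 h1
  ext i
  fin_cases i
  · exact (toIcoMod_eq_self Real.two_pi_pos).2 ⟨h0.1.le, by linarith [h0.2]⟩
  · exact (toIcoMod_eq_self Real.two_pi_pos).2 ⟨h1.1.le, by linarith [h1.2]⟩
  · rfl

/-- The cosine is a continuous 2π-periodic test for being far from the period lattice. It controls
`reduce` near the faces |x_i| = π, where `reduce` itself jumps. -/
lemma one_le_abs_of_cos_neg {t : ℝ} (ht : Real.cos t < 0) : 1 ≤ |t| := by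
  by_contra! h
  have := Real.pi_gt_three
  rw [abs_lt] at h
  exact absurd (Real.cos_pos_of_mem_Ioo ⟨by linarith [h.1], by linarith [h.2]⟩) (not_lt.2 ht.le)

lemma cos_reduce (x : E3) : Real.cos (reduce x 0) = Real.cos (x 0) ∧
    Real.cos (reduce x 1) = Real.cos (x 1) := by
  obtain ⟨k, l, hk, hl⟩ := exists_reduce_eq x
  constructor
  · conv_rhs => rw [hk, Real.cos_add_int_mul_two_pi]
  · conv_rhs => rw [hl, Real.cos_add_int_mul_two_pi]

lemma one_le_norm_reduce {x : E3} (h : Real.cos (x 0) < 0 ∨ Real.cos (x 1) < 0) :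
    1 ≤ ‖reduce x‖ := by
  rcases h with h | h
  · rw [← (cos_reduce x).1] at h
    exact (one_le_abs_of_cos_neg h).trans (PiLp.norm_apply_le (reduce x) 0)
  · rw [← (cos_reduce x).2] at h
    exact (one_le_abs_of_cos_neg h).trans (PiLp.norm_apply_le (reduce x) 1)

/-- Near a point of the cell other than the origin, either the reduction is trivial or it stays
away from the support of the singular part. -/
lemma eventually_reduce {x : E3} (hx : x ∈ d.cell) (hx0 : x ≠ 0) :
    (∀ᶠ y in 𝓝 x, reduce y = y ∧ y ≠ 0) ∨ ∀ᶠ y in 𝓝 x, 1 ≤ ‖reduce y‖ := by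
  have hcont : ∀ i : Fin 3, ContinuousAt (fun y : E3 => y i) x := fun i => by fun_prop
  have key : ∀ i : Fin 3, |x i| = Real.pi → ∀ᶠ y in 𝓝 x, Real.cos (y i) < 0 := by
    intro i hi
    have h1 : Real.cos (x i) < 0 := by rw [← Real.cos_abs, hi, Real.cos_pi]; norm_num
    exact (Real.continuous_cos.continuousAt.comp (hcont i)).eventually_lt_const h1
  rcases hx.1.lt_or_eq with h0 | h0
  · rcases hx.2.1.lt_or_eq with h1 | h1
    · left
      filter_upwards [(hcont 0).abs.eventually_lt_const h0, (hcont 1).abs.eventually_lt_const h1,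
        eventually_ne_nhds hx0] with y hy0 hy1 hy using ⟨reduce_eq_self hy0 hy1, hy⟩
    · right
      filter_upwards [key 1 h1] with y hy using one_le_norm_reduce (Or.inr hy)
  · right
    filter_upwards [key 0 h0] with y hy using one_le_norm_reduce (Or.inl hy)

lemma exp_int_mul_two_pi (j k : ℤ) :
    Complex.exp (Complex.I * ((j * (k * (2 * Real.pi)) : ℝ) : ℂ)) = 1 := by
  rw [Complex.exp_eq_one_iff]
  refine ⟨j * k, ?_⟩
  push_cast
  ring

lemma wave_reduce (d : Data) (j : Fin 3 → ℤ) (x : E3) : d.wave j (reduce x) = d.wave j x := by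
  obtain ⟨k, l, hk, hl⟩ := exists_reduce_eq x
  have : d.wave j x = d.wave j (reduce x) *
      Complex.exp (Complex.I * ((j 0 * (k * (2 * Real.pi)) : ℝ) : ℂ)) *
      Complex.exp (Complex.I * ((j 1 * (l * (2 * Real.pi)) : ℝ) : ℂ)) := by
    rw [wave, wave, ← Complex.exp_add, ← Complex.exp_add]
    congr 1
    rw [hk, hl, reduce_two]
    push_cast
    ring
  rw [this, exp_int_mul_two_pi, exp_int_mul_two_pi, mul_one, mul_one]

lemma regular_reduce (d : Data) (x : E3) : d.regular (reduce x) = d.regular x := by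
  simp only [regular, phi, wave_reduce]

/-- Quasi-periodicity, read off from the expansion term by term and stated without division by the
phase. -/
lemma green_reduce {x : E3} (h2 : x 2 ≠ 0) :
    d.green x * d.phase (reduce x) = d.green (reduce x) * d.phase x := by
  obtain ⟨k, l, hk, hl⟩ := exists_reduce_eq x
  rw [green, green, if_pos h2, reduce_two, if_pos h2, eigenSeries, eigenSeries, ← tsum_mul_left,
    ← tsum_mul_left, ← tsum_mul_right, ← tsum_mul_right]
  refine tsum_congr fun n => ?_
  have : Complex.exp (Complex.I * ((d.α₁ + n.1 : ℝ) : ℂ) * x 0 +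
      Complex.I * ((d.α₂ + n.2 : ℝ) : ℂ) * x 1 + Complex.I * d.beta n * ((|x 2| : ℝ) : ℂ)) *
      d.phase (reduce x) =
      Complex.exp (Complex.I * ((d.α₁ + n.1 : ℝ) : ℂ) * reduce x 0 +
      Complex.I * ((d.α₂ + n.2 : ℝ) : ℂ) * reduce x 1 +
      Complex.I * d.beta n * ((|x 2| : ℝ) : ℂ)) * d.phase x *
      Complex.exp (Complex.I * ((n.1 * (k * (2 * Real.pi)) : ℝ) : ℂ)) *
      Complex.exp (Complex.I * ((n.2 * (l * (2 * Real.pi)) : ℝ) : ℂ)) := by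
    rw [phase, phase, ← Complex.exp_add, ← Complex.exp_add, ← Complex.exp_add, ← Complex.exp_add]
    congr 1
    rw [hk, hl]
    push_cast
    ring
  rw [exp_int_mul_two_pi, exp_int_mul_two_pi, mul_one, mul_one] at this
  linear_combination Complex.I / (8 * (Real.pi : ℂ) ^ 2) * (1 / d.beta n) * this

/-- The coefficients of the regular part, as a series of plane waves. -/
def waveCoef (d : Data) (j : Fin 3 → ℤ) : ℂ := d.normFactor * d.normFactor * d.regCoef j

lemma phase_mul_regular (d : Data) (x : E3) :
    d.phase x * d.regular x = d.waveSeries d.waveCoef x := by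
  rw [regular, waveSeries, ← tsum_mul_left]
  refine tsum_congr fun j => ?_
  rw [planeWave, ← phase_mul_wave, phi, waveCoef]
  ring

lemma contDiff_phase (d : Data) : ContDiff ℝ 2 d.phase := by
  have : ∀ i : Fin 3, ContDiff ℝ 2 fun y : E3 => y i := fun i => by fun_prop
  have h2 : ContDiff ℝ 2 fun y : E3 => ((d.α₁ * y 0 + d.α₂ * y 1 : ℝ) : ℂ) :=
    Complex.ofRealCLM.contDiff.comp
      ((contDiff_const.mul (this 0)).add (contDiff_const.mul (this 1)))
  exact (contDiff_const.mul h2).cexp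

/-! ### Regularity of the Green's function away from the origin. -/

namespace Regular

lemma summable_waveCoef (h : d.Regular m) : Summable fun j => ‖d.waveCoef j‖ * size j ^ 2 := by
  refine Summable.of_nonneg_of_le (fun j => by have := size_pos j; positivity) (fun j => ?_)
    (h.summable_regCoef.mul_left ‖d.normFactor * d.normFactor‖)
  rw [waveCoef, norm_mul, mul_assoc]
  have hs := one_le_size j
  gcongr
  exact h.two_lt.le

lemma contDiff_phase_mul_regular (h : d.Regular m) :
    ContDiff ℝ 2 fun x => d.phase x * d.regular x := by
  simp_rw [phase_mul_regular]
  exact contDiff_waveSeries h h.summable_waveCoef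

lemma continuous_regular (h : d.Regular m) : Continuous d.regular := by
  have h1 : d.regular = fun x => (d.phase x)⁻¹ * (d.phase x * d.regular x) := by
    ext x
    rw [inv_mul_cancel_left₀ (d.phase_ne_zero x)]
  rw [h1]
  exact (d.continuous_phase.inv₀ d.phase_ne_zero).mul h.contDiff_phase_mul_regular.continuous

/-- Off the plane this is the splitting in the reduced cell combined with quasi-periodicity. On the
plane both sides are compared along a vertical line, where the right side is continuous because the
reduced point is not the origin. -/
lemma green_mul_χ (h : d.Regular m) {x : E3} (h2 : |x 2| ≤ d.ct) (hx : reduce x ≠ 0) :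
    d.green x * (d.χ |x 2| : ℂ) = d.phase x * (d.regular x + d.F (reduce x)) := by
  have hne : ∀ y : E3, |y 2| ≤ d.ct → y 2 ≠ 0 →
      d.green y * (d.χ |y 2| : ℂ) = d.phase y * (d.regular y + d.F (reduce y)) := by
    intro y hy2 hy0
    have h1 := h.green_mul_χ_of_ne (x := reduce y)
      (by have := reduce_zero_mem y; exact abs_le.2 ⟨this.1, this.2.le⟩)
      (by have := reduce_one_mem y; exact abs_le.2 ⟨this.1, this.2.le⟩) hy0 hy2
    rw [reduce_two, regular_reduce] at h1
    have h3 := green_reduce (d := d) hy0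
    apply mul_right_cancel₀ (d.phase_ne_zero (reduce y))
    linear_combination (d.χ |y 2| : ℂ) * h3 + d.phase y * h1
  by_cases h0 : x 2 = 0
  · set l : ℝ → E3 := fun t => glue t ![x 0, x 1] with hl
    have hlc : Continuous l := (by fun_prop : Continuous fun t : ℝ => glue t ![x 0, x 1])
    have hl0 : l 0 = x := by
      ext i; fin_cases i
      · rfl
      · rfl
      · exact h0.symm
    have hred : ∀ t, reduce (l t) = glue t ![reduce x 0, reduce x 1] := fun t => by
      ext i; fin_cases i <;> rfl
    have hF : ContinuousAt (fun t => d.F (reduce (l t))) 0 := by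
      simp_rw [hred]
      have h0' : glue 0 ![reduce x 0, reduce x 1] = reduce x := by rw [← hred, hl0]
      refine ContinuousAt.comp (g := d.F) (f := fun t : ℝ => glue t ![reduce x 0, reduce x 1])
        (h.continuousAt_F ?_) (by fun_prop : Continuous fun t : ℝ =>
          glue t ![reduce x 0, reduce x 1]).continuousAt
      rw [h0']
      exact hx
    have hR : ContinuousAt (fun t => d.phase (l t) * (d.regular (l t) + d.F (reduce (l t)))) 0 :=
      (d.continuous_phase.comp hlc).continuousAt.mul
        ((h.continuous_regular.comp hlc).continuousAt.add hF)
    -- This both shows that the limit defining `green` on the plane exists and identifies it.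
    have hlim : Filter.Tendsto (fun t => d.eigenSeries (x 0) (x 1) t) (𝓝[≠] 0)
        (𝓝 (d.phase x * (d.regular x + d.F (reduce x)))) := by
      have h1 := hR.tendsto.mono_left (nhdsWithin_le_nhds (s := {(0 : ℝ)}ᶜ))
      simp only [hl0] at h1
      refine h1.congr' ?_
      have hc : ∀ᶠ t : ℝ in 𝓝[≠] 0, |t| < d.c :=
        (continuous_abs.continuousAt.eventually_lt_const
          (by simpa using h.c_pos : |(0 : ℝ)| < d.c)).filter_mono nhdsWithin_le_nhds
      filter_upwards [hc, self_mem_nhdsWithin] with t ht ht0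
      have h2 : l t 2 = t := rfl
      have h3 := hne (l t) (by rw [h2]; exact ht.le.trans h.c_lt.le) (by rw [h2]; exact ht0)
      rw [← h3, h2, h.χ_one _ ht.le, green, h2, if_pos (show t ≠ 0 from ht0)]
      simp [hl, glue]
    have hg : d.green x = d.phase x * (d.regular x + d.F (reduce x)) := by
      rw [green, if_neg (not_not.2 h0)]
      exact hlim.limUnder_eq
    rw [hg, h0, abs_zero, h.χ_one 0 h.c_pos.le]
    simp
  · exact hne x h2 h0

lemma contDiffAt_F (h : d.Regular m) {x : E3} (hx : x ≠ 0) : ContDiffAt ℝ 2 d.F x := by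
  have h1 : d.F = fun x => (d.outgoing ‖x‖ * (1 / (4 * Real.pi) : ℂ)) * ((‖x‖ : ℂ))⁻¹ *
      (d.phase x)⁻¹ := funext fun x => by rw [F_eq, div_eq_mul_inv]
  have hn : ContDiffAt ℝ 2 (fun x : E3 => ‖x‖) x := contDiffAt_norm ℝ hx
  have hn' : ContDiffAt ℝ 2 (fun x : E3 => (‖x‖ : ℂ)) x :=
    Complex.ofRealCLM.contDiff.contDiffAt.comp x hn
  have hY : ContDiff ℝ 2 d.Y := h.contDiff_Y.of_le (by
    have : ((2 : ℕ) : WithTop ℕ∞) ≤ ((m + 3 : ℕ) : WithTop ℕ∞) := by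
      exact_mod_cast (by omega : 2 ≤ m + 3)
    exact_mod_cast this)
  have hY' : ContDiffAt ℝ 2 (fun x : E3 => (d.Y ‖x‖ : ℂ)) x :=
    Complex.ofRealCLM.contDiff.contDiffAt.comp x (hY.contDiffAt.comp x hn)
  rw [h1]
  refine ContDiffAt.mul (ContDiffAt.mul (ContDiffAt.mul ?_ contDiffAt_const) ?_) ?_
  · exact ((contDiffAt_const.mul hn').cexp).mul hY'
  · exact hn'.inv (by exact_mod_cast norm_ne_zero_iff.2 hx)
  · exact (contDiff_phase d).contDiffAt.inv (d.phase_ne_zero x)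

/-- The absolute value is not smooth at zero, but the cut-off is constant there. -/
lemma contDiffAt_χ_abs (h : d.Regular m) (x : E3) :
    ContDiffAt ℝ 2 (fun y : E3 => (d.χ |y 2| : ℂ)) x := by
  have hχ : ContDiff ℝ 2 d.χ := h.contDiff_χ.of_le (by
    have : ((2 : ℕ) : WithTop ℕ∞) ≤ ((m + 3 : ℕ) : WithTop ℕ∞) := by
      exact_mod_cast (by omega : 2 ≤ m + 3)
    exact_mod_cast this)
  have hc : ContDiff ℝ 2 fun y : E3 => y 2 := by fun_prop
  by_cases h0 : x 2 = 0
  · have hev : ∀ᶠ y : E3 in 𝓝 x, |y 2| < d.c := by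
      refine (by fun_prop : ContinuousAt (fun y : E3 => |y 2|) x).eventually_lt_const ?_
      simpa [h0] using h.c_pos
    refine (contDiffAt_const (c := (1 : ℂ))).congr_of_eventuallyEq ?_
    filter_upwards [hev] with y hy
    rw [h.χ_one _ hy.le, Complex.ofReal_one]
  · exact Complex.ofRealCLM.contDiff.contDiffAt.comp x
      (hχ.contDiffAt.comp x (hc.contDiffAt.abs h0))

/-- The regularity of the Green's function and the formulas for its values and its second
derivatives. -/
theorem green_spec (h : d.Regular m) {x : E3} (hx : x ∈ d.cell) (hx0 : x ≠ 0) :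
    ContDiffAt ℝ 2 d.green x ∧
    d.green x = d.waveSeries d.waveCoef x + d.phase x * d.F (reduce x) ∧
    ∀ p q, pderiv p (pderiv q d.green) x =
      d.waveSeries (fun j => -(d.freq j p : ℂ) * d.freq j q * d.waveCoef j) x +
        d.phase x * d.Fpq p q (reduce x) := by
  -- `P` is a C² local representative of the reduced singular part: the unreduced one inside the
  -- period cell, and zero near a face |x_i| = π, where the support of `F` is far away.
  obtain ⟨P, hP, hPev, hP0, hPd⟩ : ∃ P : E3 → ℂ, ContDiffAt ℝ 2 P x ∧
      (∀ᶠ y in 𝓝 x, reduce y ≠ 0 ∧ d.phase y * d.F (reduce y) = P y) ∧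
      P x = d.phase x * d.F (reduce x) ∧
      ∀ p q, pderiv p (pderiv q P) x = d.phase x * d.Fpq p q (reduce x) := by
    rcases eventually_reduce hx hx0 with hA | hB
    · refine ⟨fun y => d.phase y * d.F y,
        (contDiff_phase d).contDiffAt.mul (h.contDiffAt_F hx0), ?_, ?_, ?_⟩
      · filter_upwards [hA] with y hy
        rw [hy.1]
        exact ⟨hy.2, rfl⟩
      · rw [hA.self_of_nhds.1]
      · intro p q
        rw [hA.self_of_nhds.1, Fpq, mul_inv_cancel_left₀ (d.phase_ne_zero x)]
    · refine ⟨fun _ => 0, contDiffAt_const, ?_, ?_, ?_⟩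
      · filter_upwards [hB] with y hy
        refine ⟨fun h0 => ?_, ?_⟩
        · rw [h0, norm_zero] at hy; linarith
        · rw [h.F_zero (h.ε_lt_one.le.trans hy), mul_zero]
      · rw [h.F_zero (h.ε_lt_one.le.trans hB.self_of_nhds), mul_zero]
      · intro p q
        have hz : (fun y => d.phase y * d.F y) =ᶠ[𝓝 (reduce x)] fun _ => 0 := by
          have : ∀ᶠ y in 𝓝 (reduce x), 2 * d.ε < ‖y‖ :=
            continuous_norm.continuousAt.eventually_const_lt
              (h.ε_lt_one.trans_le hB.self_of_nhds)
          filter_upwards [this] with y hy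
          rw [h.F_zero hy.le, mul_zero]
        rw [Fpq, pderiv_pderiv_congr hz p q]
        have hz' : ∀ (r : Fin 3) (y : E3), pderiv r (fun _ => (0 : ℂ)) y = 0 := fun r y => by
          rw [pderiv_eq_fderiv (differentiableAt_const _)]; simp
        have hz'' : ∀ y : E3, pderiv p (pderiv q fun _ => (0 : ℂ)) y = 0 := fun y => by
          rw [show pderiv q (fun _ : E3 => (0 : ℂ)) = fun _ => 0 from funext (hz' q)]
          exact hz' p y
        rw [hz'', hz'', mul_zero, mul_zero]
  have hx2 : |x 2| ≤ d.c := hx.2.2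
  have hct : ∀ᶠ y : E3 in 𝓝 x, |y 2| < d.ct :=
    (by fun_prop : ContinuousAt (fun y : E3 => |y 2|) x).eventually_lt_const
      (hx2.trans_lt h.c_lt)
  have hid : ∀ᶠ y in 𝓝 x, d.green y * (d.χ |y 2| : ℂ) = d.waveSeries d.waveCoef y + P y := by
    filter_upwards [hct, hPev] with y hy hPy
    rw [h.green_mul_χ hy.le hPy.1, mul_add, phase_mul_regular, hPy.2]
  have hχx : (d.χ |x 2| : ℂ) = 1 := by rw [h.χ_one _ hx2, Complex.ofReal_one]
  have hS : ContDiffAt ℝ 2 (d.waveSeries d.waveCoef) x :=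
    (contDiff_waveSeries h h.summable_waveCoef).contDiffAt
  have hχne : ∀ᶠ y : E3 in 𝓝 x, (d.χ |y 2| : ℂ) ≠ 0 :=
    (h.contDiffAt_χ_abs x).continuousAt.eventually_ne (by rw [hχx]; exact one_ne_zero)
  -- Dividing by the cut-off, which is nonzero near x, also covers the faces |x₃| = c, beyond which
  -- it need not equal 1.
  have hgreen : ContDiffAt ℝ 2 d.green x := by
    have h1 : ContDiffAt ℝ 2
        (fun y => (d.waveSeries d.waveCoef y + P y) * ((d.χ |y 2| : ℂ))⁻¹) x :=
      (hS.add hP).mul ((h.contDiffAt_χ_abs x).inv (by rw [hχx]; exact one_ne_zero))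
    refine h1.congr_of_eventuallyEq ?_
    filter_upwards [hid, hχne] with y hy hy0
    rw [← hy, mul_inv_cancel_right₀ hy0]
  refine ⟨hgreen, ?_, fun p q => ?_⟩
  · have := hid.self_of_nhds
    rw [hχx, mul_one] at this
    rw [this, hP0]
  -- On the faces |x₃| = c the formula for the derivatives comes from the interior: the points (1 -
  -- t)x satisfy |x₃| < c, where the cut-off is identically 1, and second derivatives are
  -- continuous.
  · have hfreq : ∃ᶠ y in 𝓝 x, d.green =ᶠ[𝓝 y] fun z => d.waveSeries d.waveCoef z + P z := by
      have hlt : ∃ᶠ y : E3 in 𝓝 x, |y 2| < d.c := by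
        have hl : Filter.Tendsto (fun t : ℝ => (1 - t) • x) (𝓝[>] 0) (𝓝 x) := by
          have : ContinuousAt (fun t : ℝ => (1 - t) • x) 0 := by fun_prop
          have h1 := this.tendsto
          simp only [sub_zero, one_smul] at h1
          exact h1.mono_left nhdsWithin_le_nhds
        refine hl.frequently (Filter.Eventually.frequently ?_)
        have h1 : ∀ᶠ t : ℝ in 𝓝[>] 0, t < 1 :=
          (eventually_lt_nhds one_pos).filter_mono nhdsWithin_le_nhds
        filter_upwards [h1, self_mem_nhdsWithin] with t ht ht0
        have ht0' : 0 < t := ht0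
        have : ((1 - t) • x) 2 = (1 - t) * x 2 := rfl
        rw [this, abs_mul, abs_of_pos (by linarith)]
        nlinarith [h.c_pos, abs_nonneg (x 2)]
      refine (hlt.and_eventually hid.eventually_nhds).mono fun y hy => ?_
      have hyc : ∀ᶠ z : E3 in 𝓝 y, |z 2| < d.c :=
        (by fun_prop : ContinuousAt (fun z : E3 => |z 2|) y).eventually_lt_const hy.1
      filter_upwards [hyc, hy.2] with z hz hz'
      rw [← hz', h.χ_one _ hz.le, Complex.ofReal_one, mul_one]
    rw [pderiv_pderiv_eq_of_frequently hgreen (hS.add hP) hfreq p q, pderiv_pderiv_add hS hP,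
      pderiv_pderiv_waveSeries h h.summable_waveCoef, hPd]

end Regular

end Data

end MaxwellGreen

namespace BoxFourier

lemma lineCoef_comp_neg (T : ℝ) (D : ℝ → ℂ) (j : ℤ) :
    lineCoef T (fun z => D (-z)) j = lineCoef T D (-j) := by
  rw [lineCoef, lineCoef, ← integral_neg_eq_self]
  congr 1
  ext z
  simp only [neg_neg]
  congr 3
  push_cast
  ring

end BoxFourier

namespace MaxwellGreen

namespace Data

variable {d : Data} {m : ℕ}

/-! ### The computed coefficients as discrete Fourier transforms -/

/-- The integrand of the transform that is approximated by `dftThree`. -/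
def boxSource (d : Data) (y : Fin 3 → ℝ) : ℂ :=
  d.source ‖(WithLp.toLp 2 y : E3)‖ * (1 / (4 * Real.pi) : ℂ) / (‖(WithLp.toLp 2 y : E3)‖ : ℂ) *
    (d.phase (WithLp.toLp 2 y))⁻¹

lemma char_halfPeriod_neg (d : Data) (j : Fin 3 → ℤ) (y : Fin 3 → ℝ) :
    BoxFourier.char d.halfPeriod (-j) y = (d.wave j (WithLp.toLp 2 y))⁻¹ := by
  have hpi : Real.pi ≠ 0 := Real.pi_ne_zero
  rw [BoxFourier.char, wave, ← Complex.exp_neg, ← mul_neg, ← Complex.ofReal_neg]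
  congr 3
  simp only [Fin.sum_univ_three, halfPeriod, Pi.neg_apply, Matrix.cons_val_zero,
    Matrix.cons_val_one, Matrix.cons_val, Int.cast_neg]
  field_simp
  ring

lemma indexBox_eq (N : ℕ) : indexBox N = BoxFourier.box (Fin 3) N := by
  unfold indexBox BoxFourier.box
  congr

lemma dftThree_eq (d : Data) (M : ℕ) (j : Fin 3 → ℤ) :
    d.dftThree M j = BoxFourier.dft d.halfPeriod M d.boxSource j := by
  rw [dftThree, BoxFourier.dft]
  congr 1
  · congr 1
    simp [Fin.prod_univ_three, halfPeriod]
    ring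
  · refine Finset.sum_congr (indexBox_eq M) fun l _ => ?_
    rw [char_halfPeriod_neg, show (WithLp.toLp 2 (BoxFourier.node d.halfPeriod M l) : E3) =
      d.gridPoint M l from rfl, boxSource, show (WithLp.toLp 2
      (BoxFourier.node d.halfPeriod M l) : E3) = d.gridPoint M l from rfl, fundSol, source]
    rw [show Complex.I * ((d.k * ‖d.gridPoint M l‖ : ℝ) : ℂ) =
      Complex.I * d.k * (‖d.gridPoint M l‖ : ℂ) by push_cast; ring]
    push_cast
    rw [div_eq_mul_inv, div_eq_mul_inv, div_eq_mul_inv, mul_inv]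
    ring

lemma coef_boxSource (h : d.Regular m) (j : Fin 3 → ℤ) :
    BoxFourier.coef d.halfPeriod d.boxSource j = d.sourceTransform j := by
  have hP : Profile fun r => d.source r * (1 / (4 * Real.pi) : ℂ) :=
    h.profile_source.mul continuous_const
  have hpi : (Real.pi : ℂ) ≠ 0 := by exact_mod_cast Real.pi_ne_zero
  have h1 := hP.integral_radial (d.freqVec j)
  have h2 : BoxFourier.coef d.halfPeriod d.boxSource j =
      ∫ x : E3, d.source ‖x‖ * (1 / (4 * Real.pi) : ℂ) / (‖x‖ : ℂ) *
        Complex.exp (Complex.I * ((-(inner ℝ (d.freqVec j) x) : ℝ) : ℂ)) := by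
    rw [← (EuclideanSpace.volume_preserving_symm_measurableEquiv_toLp (Fin 3)).symm.integral_comp'
      (g := fun x : E3 => d.source ‖x‖ * (1 / (4 * Real.pi) : ℂ) / (‖x‖ : ℂ) *
        Complex.exp (Complex.I * ((-(inner ℝ (d.freqVec j) x) : ℝ) : ℂ)))]
    rw [BoxFourier.coef]
    congr 1
    ext y
    rw [char_halfPeriod_neg, boxSource, mul_assoc, phase_inv_mul_wave_inv]
    rfl
  rw [h2, h1, sourceTransform, ← integral_const_mul]
  congr 1
  ext r
  rw [sineKernel]
  field_simp

lemma supportedIn_boxSource (h : d.Regular m) :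
    BoxFourier.SupportedIn d.halfPeriod d.boxSource := by
  have hε := h.ε_pos
  have hpi : (Real.pi : ℂ) ≠ 0 := by exact_mod_cast Real.pi_ne_zero
  refine ⟨?_, fun _ => 2 * d.ε, fun i => ?_, fun y i hi => ?_⟩
  -- Since the source vanishes for r < ε, the denominator |y| may be replaced by max(|y|, ε), which
  -- is continuous and nowhere zero.
  · have h1 : d.boxSource = fun y => d.source ‖(WithLp.toLp 2 y : E3)‖ * (1 / (4 * Real.pi) : ℂ) /
        ((max ‖(WithLp.toLp 2 y : E3)‖ d.ε : ℝ) : ℂ) * (d.phase (WithLp.toLp 2 y))⁻¹ := by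
      ext y
      rw [boxSource]
      rcases lt_or_ge ‖(WithLp.toLp 2 y : E3)‖ d.ε with hy | hy
      · rw [h.source_zero (Or.inl hy)]; simp
      · rw [max_eq_left hy]
    have hs := h.contDiff_source.continuous
    have hl : Continuous fun y : Fin 3 → ℝ => (WithLp.toLp 2 y : E3) := PiLp.continuous_toLp 2 _
    rw [h1]
    refine Continuous.mul (Continuous.div₀ ?_ ?_ fun y => ?_) ?_
    · exact (hs.comp hl.norm).mul continuous_const
    · exact Complex.continuous_ofReal.comp (hl.norm.max continuous_const)
    · exact_mod_cast (hε.trans_le (le_max_right _ _)).ne'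
    · exact (d.continuous_phase.comp hl).inv₀ fun y => d.phase_ne_zero _
  · have := h.ε_lt_one
    have := h.ε_lt_ct
    have := Real.pi_gt_three
    fin_cases i
    · change 2 * d.ε < Real.pi; linarith
    · change 2 * d.ε < Real.pi; linarith
    · change 2 * d.ε < d.ct; linarith
  · have h1 : |y i| ≤ ‖(WithLp.toLp 2 y : E3)‖ := PiLp.norm_apply_le (WithLp.toLp 2 y : E3) i
    rw [boxSource, h.source_zero (Or.inr (hi.trans_le h1))]
    simp

/-- `exp(i β_n t) χ'(t)`. -/
def vertSource (d : Data) (n : ℤ × ℤ) (t : ℝ) : ℂ :=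
  Complex.exp (Complex.I * d.beta n * (t : ℂ)) * ((deriv d.χ t : ℝ) : ℂ)

lemma lineCoef_vertSource (d : Data) (n : ℤ × ℤ) (j₃ : ℤ) :
    BoxFourier.lineCoef d.ct (d.vertSource n) j₃ = d.vertTransform n j₃ := by
  rw [BoxFourier.lineCoef, vertTransform]
  congr 1
  ext t
  rw [vertSource, mul_right_comm, ← Complex.exp_add]
  congr 2
  push_cast
  ring

namespace Regular

lemma halfPeriod_pos (h : d.Regular m) (i : Fin 3) : 0 < d.halfPeriod i := by
  have := Real.pi_pos
  have := h.ct_pos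
  fin_cases i <;> assumption

lemma continuous_vertSource (h : d.Regular m) (n : ℤ × ℤ) : Continuous (d.vertSource n) := by
  have := h.contDiff_deriv_χ.continuous
  unfold vertSource
  fun_prop

lemma vertSource_zero (h : d.Regular m) (n : ℤ × ℤ) {t : ℝ}
    (ht : t < d.c ∨ (d.c + d.ct) / 2 < t) : d.vertSource n t = 0 := by
  simp [vertSource, h.deriv_χ_zero ht]

/-- The half sum is a full transform because χ' vanishes on the negative axis. -/
lemma dftOne_eq (h : d.Regular m) {M : ℕ} (hM : 0 < M) (n : ℤ × ℤ) (j₃ : ℤ) :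
    d.dftOne M n j₃ = BoxFourier.lineDft d.ct M (d.vertSource n) j₃ := by
  have hM' : (0 : ℝ) < M := by exact_mod_cast hM
  have hct := h.ct_pos
  have hc := h.c_pos
  rw [dftOne, BoxFourier.lineDft]
  congr 1
  refine Finset.sum_of_injOn (fun l : ℕ => (l : ℤ)) (fun a _ b _ hab => Int.ofNat_injective hab)
    (fun l hl => ?_) (fun i hi hi' => ?_) (fun l _ => ?_)
  · simp only [Finset.coe_range, Set.mem_Iio] at hl
    simp only [Finset.coe_Ico, Set.mem_Ico]
    omega
  · rw [h.vertSource_zero n (Or.inl ?_), zero_mul]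
    rw [Finset.mem_Ico] at hi
    have hneg : i < 0 := by
      by_contra! h0
      exact hi' ⟨i.toNat, by simp only [Finset.coe_range, Set.mem_Iio]; omega,
        Int.toNat_of_nonneg h0⟩
    have : (i : ℝ) < 0 := by exact_mod_cast hneg
    have : (i : ℝ) * d.ct / M < 0 := div_neg_of_neg_of_pos (mul_neg_of_neg_of_pos this hct) hM'
    linarith
  · simp only [vertSource, Int.cast_natCast]

/-- Reversing the sign of j₃ amounts to reflecting the integrand, so both vertical sums fall under
the same aliasing estimate. -/
lemma dftOne_neg_eq (h : d.Regular m) {M : ℕ} (hM : 0 < M) (n : ℤ × ℤ) (j₃ : ℤ) :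
    d.dftOne M n (-j₃) = BoxFourier.lineDft d.ct M (fun t => d.vertSource n (-t)) j₃ := by
  have hM' : (0 : ℝ) < M := by exact_mod_cast hM
  have hct := h.ct_pos
  have hc := h.c_pos
  have hcct := h.c_lt
  rw [dftOne, BoxFourier.lineDft]
  congr 1
  refine Finset.sum_of_injOn (fun l : ℕ => -(l : ℤ)) (fun a _ b _ hab =>
      Int.ofNat_injective (neg_injective hab)) (fun l hl => ?_) (fun i hi hi' => ?_) (fun l _ => ?_)
  · simp only [Finset.coe_range, Set.mem_Iio] at hl
    simp only [Finset.coe_Ico, Set.mem_Ico]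
    omega
  · rw [h.vertSource_zero n ?_, zero_mul]
    rw [Finset.mem_Ico] at hi
    by_cases h0 : i ≤ 0
    · right
      -- The reflected indices run over -(M - 1), ..., 0. The one nonpositive grid index missed is
      -- -M, which corresponds to t = ct, where χ' vanishes.
      have : i = -(M : ℤ) := by
        by_contra hne
        exact hi' ⟨(-i).toNat, by simp only [Finset.coe_range, Set.mem_Iio]; omega,
          by simp only; omega⟩
      rw [this]
      push_cast
      have : -(-(M : ℝ) * d.ct / M) = d.ct := by field_simp
      rw [this]
      linarith
    · left
      have : (0 : ℝ) < i := by exact_mod_cast not_le.1 h0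
      have : 0 < (i : ℝ) * d.ct / M := by positivity
      linarith
  · simp only [vertSource, Int.cast_neg, Int.cast_natCast]
    have : -(-(l : ℝ) * d.ct / M) = l * d.ct / M := by ring
    rw [this]
    congr 4
    push_cast
    ring

/-! ### The aliasing errors -/

lemma le_size_of_notMem {M : ℕ} {n : Fin 3 → ℤ} (hn : ¬ ∀ i, -(M : ℤ) ≤ n i ∧ n i < M) :
    (M : ℝ) ≤ size n := by
  push Not at hn
  obtain ⟨i, hi⟩ := hn
  have h1 := one_add_abs_le_size n i
  have h2 : (M : ℤ) ≤ |n i| := by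
    by_contra! h0
    rw [abs_lt] at h0
    exact absurd (hi h0.1.le) (not_le.2 h0.2)
  have h3 : (M : ℝ) ≤ |(n i : ℝ)| := by exact_mod_cast h2
  linarith

lemma sum_indexBox (N : ℕ) (f : (Fin 3 → ℤ) → ℝ) :
    ∑ j ∈ indexBox N, f j =
      ∑ n ∈ Finset.Ico (-(N : ℤ)) N ×ˢ Finset.Ico (-(N : ℤ)) N,
        ∑ j₃ ∈ Finset.Ico (-(N : ℤ)) N, f (tripleEquiv.symm (n, j₃)) := by
  rw [← Finset.sum_product']
  refine Finset.sum_equiv tripleEquiv (fun j => ?_) fun j _ => by rw [Equiv.symm_apply_apply]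
  simp only [indexBox, Fintype.mem_piFinset, Finset.mem_product]
  exact ⟨fun h => ⟨⟨h 0, h 1⟩, h 2⟩, fun h i => by
    fin_cases i
    · exact h.1.1
    · exact h.1.2
    · exact h.2⟩

lemma size_le_of_mem {N : ℕ} (hN : 1 ≤ N) {j : Fin 3 → ℤ} (hj : j ∈ indexBox N) :
    size j ≤ 4 * N := by
  have hb : ∀ i, |(j i : ℝ)| ≤ N := fun i => by
    have := Finset.mem_Ico.1 (Fintype.mem_piFinset.1 hj i)
    have : |j i| ≤ (N : ℤ) := abs_le.2 ⟨this.1, this.2.le⟩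
    exact_mod_cast this
  have hN' : (1 : ℝ) ≤ N := by exact_mod_cast hN
  rw [size]
  linarith [hb 0, hb 1, hb 2]

/-- On the computed box `size j` ≤ 4N, so the weighted error is at most 4N^(s+1) times the tail over
|i| of order at least M ≥ N. There N ≤ size and s + 1 ≤ m - 1, so the decay of order m + 2 still
leaves size^(-3), summable with the horizontal weight. -/
lemma sum_size_mul_le {s : ℕ} (hs : s + 2 ≤ m) {C : ℝ} (hC : 0 ≤ C) {V : ℤ × ℤ → ℤ → ℝ}
    (hV0 : ∀ n i, 0 ≤ V n i)
    (hV : ∀ j : Fin 3 → ℤ, V (j 0, j 1) (j 2) ≤ C * (horizWeight (j 0, j 1) / size j ^ (m + 2)))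
    {N M : ℕ} (hN : 1 ≤ N) (hNM : N ≤ M) {e : ℤ × ℤ → ℤ → ℝ} (he0 : ∀ n i, 0 ≤ e n i)
    (he : ∀ n, ∑ i ∈ Finset.Ico (-(N : ℤ)) N, e n i ≤
      ∑' i : ℤ, if i ∈ Finset.Ico (-(M : ℤ)) M then 0 else V n i) :
    (N : ℝ) ^ s * ∑ j ∈ indexBox N, size j * e (j 0, j 1) (j 2) ≤
      4 * C * ∑' j : Fin 3 → ℤ, horizWeight (j 0, j 1) / size j ^ 3 := by
  set W : (ℤ × ℤ) × ℤ → ℝ := fun q => 4 * C *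
    (horizWeight q.1 / size (tripleEquiv.symm q) ^ 3) with hW
  have hW0 : ∀ q, 0 ≤ W q := fun q => by
    have := horizWeight_nonneg q.1
    have := size_pos (tripleEquiv.symm q)
    positivity
  have hWs : Summable W :=
    ((tripleEquiv.symm.summable_iff.2 summable_size_horizWeight).congr fun q => rfl).mul_left _
  have hWt : ∑' q, W q = 4 * C * ∑' j : Fin 3 → ℤ, horizWeight (j 0, j 1) / size j ^ 3 := by
    rw [← tsum_mul_left, ← tripleEquiv.symm.tsum_eq]
    rfl
  have hN' : (1 : ℝ) ≤ N := by exact_mod_cast hN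
  have hterm : ∀ n : ℤ × ℤ, (N : ℝ) ^ s * (4 * N) *
      (∑' i : ℤ, if i ∈ Finset.Ico (-(M : ℤ)) M then 0 else V n i) ≤ ∑' i, W (n, i) := by
    intro n
    rw [← tsum_mul_left]
    have hle : ∀ i : ℤ, (N : ℝ) ^ s * (4 * N) *
        (if i ∈ Finset.Ico (-(M : ℤ)) M then 0 else V n i) ≤ W (n, i) := by
      intro i
      split_ifs with hi
      · rw [mul_zero]; exact hW0 _
      · set j := tripleEquiv.symm (n, i) with hj
        have hsz : (N : ℝ) ≤ size j := by
          refine le_trans (by exact_mod_cast hNM) (le_size_of_notMem (M := M) fun h => hi ?_)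
          exact Finset.mem_Ico.2 (h 2)
        have h1 : V n i ≤ C * (horizWeight n / size j ^ (m + 2)) := hV j
        have hp := size_pos j
        have hw := horizWeight_nonneg n
        calc (N : ℝ) ^ s * (4 * N) * V n i
            = 4 * N ^ (s + 1) * V n i := by ring
          _ ≤ 4 * size j ^ (m - 1) * (C * (horizWeight n / size j ^ (m + 2))) := by
              refine mul_le_mul (mul_le_mul_of_nonneg_left ?_ (by norm_num)) h1 (hV0 _ _)
                (by positivity)
              calc (N : ℝ) ^ (s + 1) ≤ size j ^ (s + 1) := by gcongr
                _ ≤ size j ^ (m - 1) := pow_le_pow_right₀ (one_le_size j) (by omega)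
          _ = W (n, i) := by
              change _ = 4 * C * (horizWeight n / size j ^ 3)
              have : size j ^ (m + 2) = size j ^ (m - 1) * size j ^ 3 := by
                rw [← pow_add]; congr 1; omega
              rw [this]
              field_simp
    have hsW := hWs.prod_factor n
    have h0 : ∀ i : ℤ, 0 ≤ (N : ℝ) ^ s * (4 * N) *
        (if i ∈ Finset.Ico (-(M : ℤ)) M then 0 else V n i) := fun i => by
      have := hV0 n i
      split_ifs <;> positivity
    exact (hsW.of_nonneg_of_le h0 hle).tsum_le_tsum hle hsW
  calc (N : ℝ) ^ s * ∑ j ∈ indexBox N, size j * e (j 0, j 1) (j 2)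
      ≤ (N : ℝ) ^ s * ∑ j ∈ indexBox N, 4 * N * e (j 0, j 1) (j 2) := by
        gcongr with j hj
        · exact he0 _ _
        · exact size_le_of_mem hN hj
    _ = ∑ n ∈ Finset.Ico (-(N : ℤ)) N ×ˢ Finset.Ico (-(N : ℤ)) N,
        (N : ℝ) ^ s * (4 * N) * ∑ i ∈ Finset.Ico (-(N : ℤ)) N, e n i := by
        rw [sum_indexBox, Finset.mul_sum]
        refine Finset.sum_congr rfl fun n _ => ?_
        rw [← Finset.mul_sum, ← mul_assoc]
        rfl
    _ ≤ ∑ n ∈ Finset.Ico (-(N : ℤ)) N ×ˢ Finset.Ico (-(N : ℤ)) N, ∑' i, W (n, i) := by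
        refine Finset.sum_le_sum fun n _ => le_trans ?_ (hterm n)
        gcongr
        exact he n
    _ ≤ ∑' n, ∑' i, W (n, i) := hWs.prod.sum_le_tsum _ fun n _ => tsum_nonneg fun i => hW0 _
    _ = ∑' q, W q := hWs.tsum_prod.symm
    _ = _ := hWt

lemma summable_vertTransform (h : d.Regular m) (n : ℤ × ℤ) :
    Summable (d.vertTransform n) := by
  obtain ⟨C, hC, hv⟩ := h.norm_vertTransform_le
  have h1 : Summable fun i => C * (horizWeight n / size (tripleEquiv.symm (n, i)) ^ 3) :=
    (((tripleEquiv.symm.summable_iff.2 summable_size_horizWeight).congr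
      fun q => rfl).prod_factor n).mul_left C
  refine Summable.of_norm (h1.of_nonneg_of_le (fun i => norm_nonneg _) fun i => ?_)
  refine (hv (tripleEquiv.symm (n, i))).1.trans ?_
  have := horizWeight_nonneg n
  have h2 := size_pos (tripleEquiv.symm (n, i))
  change C * (horizWeight n / _) ≤ _
  gcongr
  · exact one_le_size _
  · have := h.two_lt; omega

lemma exists_sum_dftOne_sub_le (h : d.Regular m) {s : ℕ} (hs : s + 2 ≤ m) :
    ∃ B : ℝ, 0 ≤ B ∧ ∀ N M : ℕ, 1 ≤ N → N ≤ M →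
      (N : ℝ) ^ s * ∑ j ∈ indexBox N, size j *
        ‖d.dftOne M (j 0, j 1) (j 2) - d.vertTransform (j 0, j 1) (j 2)‖ ≤ B ∧
      (N : ℝ) ^ s * ∑ j ∈ indexBox N, size j *
        ‖d.dftOne M (j 0, j 1) (-(j 2)) - d.vertTransform (j 0, j 1) (-(j 2))‖ ≤ B := by
  obtain ⟨C, hC, hv⟩ := h.norm_vertTransform_le
  have hb : (d.c + d.ct) / 2 < d.ct := by linarith [h.c_lt]
  have hc := h.c_pos
  refine ⟨4 * C * ∑' j : Fin 3 → ℤ, horizWeight (j 0, j 1) / size j ^ 3,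
    mul_nonneg (by positivity) (tsum_nonneg fun j => div_nonneg (horizWeight_nonneg _)
      (pow_nonneg (size_pos j).le 3)), fun N M hN hNM => ?_⟩
  have hM : 0 < M := by omega
  constructor
  · refine sum_size_mul_le hs hC.le (V := fun n i => ‖d.vertTransform n i‖)
      (fun n i => norm_nonneg _) (fun j => (hv j).1) hN hNM
      (e := fun n i => ‖d.dftOne M n i - d.vertTransform n i‖) (fun n i => norm_nonneg _)
      fun n => ?_
    have hsum : Summable (BoxFourier.lineCoef d.ct (d.vertSource n)) :=
      (h.summable_vertTransform n).congr fun i => (d.lineCoef_vertSource n i).symm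
    have key := BoxFourier.sum_norm_lineDft_sub_le h.ct_pos hb (h.continuous_vertSource n)
      (fun z hz => h.vertSource_zero n (by
        rcases le_total 0 z with h0 | h0
        · rw [abs_of_nonneg h0] at hz; exact Or.inr hz
        · exact Or.inl (by linarith))) hsum hM hNM
    simp only [lineCoef_vertSource] at key
    simp only [h.dftOne_eq hM]
    exact key
  · refine sum_size_mul_le hs hC.le (V := fun n i => ‖d.vertTransform n (-i)‖)
      (fun n i => norm_nonneg _) (fun j => (hv j).2) hN hNM
      (e := fun n i => ‖d.dftOne M n (-i) - d.vertTransform n (-i)‖)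
      (fun n i => norm_nonneg _) fun n => ?_
    have hco : ∀ i, BoxFourier.lineCoef d.ct (fun t => d.vertSource n (-t)) i =
        d.vertTransform n (-i) := fun i => by
      rw [BoxFourier.lineCoef_comp_neg, lineCoef_vertSource]
    have hsum : Summable (BoxFourier.lineCoef d.ct fun t => d.vertSource n (-t)) :=
      ((Equiv.neg ℤ).summable_iff.2 (h.summable_vertTransform n)).congr fun i => (hco i).symm
    have key := BoxFourier.sum_norm_lineDft_sub_le h.ct_pos hb
      ((h.continuous_vertSource n).comp continuous_neg)
      (fun z hz => h.vertSource_zero n (by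
        rcases le_total 0 z with h0 | h0
        · exact Or.inl (by linarith)
        · rw [abs_of_nonpos h0] at hz; exact Or.inr hz)) hsum hM hNM
    simp only [Function.comp_def, hco] at key
    simp only [h.dftOne_neg_eq hM]
    exact key

/-- Outside the box N ≤ size. Of the decay of order m + 2, four orders are spent on summability over
the three-dimensional lattice, which leaves the rate m - 2. -/
lemma exists_sum_dftThree_sub_le (h : d.Regular m) {s : ℕ} (hs : s + 2 ≤ m) :
    ∃ B : ℝ, 0 ≤ B ∧ ∀ N M : ℕ, 1 ≤ N → N ≤ M →
      (N : ℝ) ^ s * ∑ j ∈ indexBox N, ‖d.dftThree M j - d.sourceTransform j‖ ≤ B := by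
  obtain ⟨C, hC, hv⟩ := h.norm_sourceTransform_le_size
  have hco : BoxFourier.coef d.halfPeriod d.boxSource = d.sourceTransform :=
    funext (coef_boxSource h)
  have hle4 : ∀ t ≤ s, ∀ j : Fin 3 → ℤ,
      size j ^ t * ‖d.sourceTransform j‖ ≤ C * (1 / size j ^ 4) := fun t ht j => by
    have hp := size_pos j
    calc size j ^ t * ‖d.sourceTransform j‖ ≤ size j ^ (m - 2) * (C * (1 / size j ^ (m + 2))) := by
          refine mul_le_mul (pow_le_pow_right₀ (one_le_size j) (by omega)) (hv j) (norm_nonneg _)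
            (by positivity)
      _ = C * (1 / size j ^ 4) := by
          have : size j ^ (m + 2) = size j ^ (m - 2) * size j ^ 4 := by
            rw [← pow_add]; congr 1; have := h.two_lt; omega
          rw [this]
          field_simp
  have hS : Summable fun j : Fin 3 → ℤ => C * (1 / size j ^ 4) := summable_size.mul_left C
  have hsum : Summable (BoxFourier.coef d.halfPeriod d.boxSource) := by
    rw [hco]
    refine Summable.of_norm (hS.of_nonneg_of_le (fun j => norm_nonneg _) fun j => ?_)
    have := hle4 0 (Nat.zero_le _) j
    rwa [pow_zero, one_mul] at this
  have hnn : ∀ j : Fin 3 → ℤ, 0 ≤ C * (1 / size j ^ 4) := fun j => by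
    have := size_pos j; positivity
  refine ⟨∑' j : Fin 3 → ℤ, C * (1 / size j ^ 4), tsum_nonneg hnn, fun N M hN hNM => ?_⟩
  have key := BoxFourier.sum_norm_dft_sub_le h.halfPeriod_pos (supportedIn_boxSource h) hsum
    (by omega : 0 < M) hNM
  rw [hco] at key
  have hle : ∀ n : Fin 3 → ℤ, (N : ℝ) ^ s *
      (if n ∈ BoxFourier.box (Fin 3) M then 0 else ‖d.sourceTransform n‖) ≤
      C * (1 / size n ^ 4) := fun n => by
    split_ifs with hn
    · rw [mul_zero]; exact hnn n
    · refine le_trans ?_ (hle4 s le_rfl n)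
      rw [BoxFourier.mem_box] at hn
      have : (N : ℝ) ≤ size n := le_trans (by exact_mod_cast hNM) (le_size_of_notMem hn)
      gcongr
  have h0 : ∀ n : Fin 3 → ℤ, 0 ≤ (N : ℝ) ^ s *
      (if n ∈ BoxFourier.box (Fin 3) M then 0 else ‖d.sourceTransform n‖) := fun n => by
    split_ifs <;> positivity
  calc (N : ℝ) ^ s * ∑ j ∈ indexBox N, ‖d.dftThree M j - d.sourceTransform j‖
      ≤ (N : ℝ) ^ s *
        ∑' n, if n ∈ BoxFourier.box (Fin 3) M then 0 else ‖d.sourceTransform n‖ := by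
        gcongr
        simp only [dftThree_eq, indexBox_eq]
        exact key
    _ ≤ _ := by
        rw [← tsum_mul_left]
        exact (hS.of_nonneg_of_le h0 hle).tsum_le_tsum hle hS

/-- The reciprocal symbols in `coefK` and `coefF` cancel exactly, so the only errors are those of
the three discrete transforms. -/
lemma coefL_sub (d : Data) (M : ℕ) (j : Fin 3 → ℤ) :
    d.coefL M j - d.normFactor * d.regCoef j = d.normFactor *
      (1 / (2 * d.beta (j 0, j 1) * ((d.vert (j 2) : ℂ) - d.beta (j 0, j 1))) *
          (d.dftOne M (j 0, j 1) (j 2) - d.vertTransform (j 0, j 1) (j 2))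
        - 1 / (2 * d.beta (j 0, j 1) * ((d.vert (j 2) : ℂ) + d.beta (j 0, j 1))) *
          (d.dftOne M (j 0, j 1) (-(j 2)) - d.vertTransform (j 0, j 1) (-(j 2)))
        + 1 / (d.symbol j : ℂ) * (d.dftThree M j - d.sourceTransform j)) := by
  rw [coefL, coefK, coefF, regCoef]
  ring

/-- The aliasing error of the computed coefficients. -/
theorem exists_sum_coefL_sub_le (h : d.Regular m) {s : ℕ} (hs : s + 2 ≤ m) :
    ∃ B : ℝ, 0 ≤ B ∧ ∀ N M : ℕ, 1 ≤ N → N ≤ M →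
      (N : ℝ) ^ s * ∑ j ∈ indexBox N,
        size j ^ 2 * ‖d.coefL M j - d.normFactor * d.regCoef j‖ ≤ B := by
  obtain ⟨A, hA, hmul⟩ := h.multiplier_le
  obtain ⟨B₁, hB₁, h1⟩ := h.exists_sum_dftOne_sub_le hs
  obtain ⟨B₂, hB₂, h2⟩ := h.exists_sum_dftThree_sub_le hs
  refine ⟨‖d.normFactor‖ * A * (B₁ + B₁ + B₂), by positivity, fun N M hN hNM => ?_⟩
  obtain ⟨ha, hb⟩ := h1 N M hN hNM
  have hc := h2 N M hN hNM
  have hterm : ∀ j : Fin 3 → ℤ,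
      size j ^ 2 * ‖d.coefL M j - d.normFactor * d.regCoef j‖ ≤ ‖d.normFactor‖ * A *
        (size j * ‖d.dftOne M (j 0, j 1) (j 2) - d.vertTransform (j 0, j 1) (j 2)‖ +
          size j * ‖d.dftOne M (j 0, j 1) (-(j 2)) - d.vertTransform (j 0, j 1) (-(j 2))‖ +
          ‖d.dftThree M j - d.sourceTransform j‖) := fun j => by
    obtain ⟨m1, m2, m3⟩ := hmul j
    have hp := size_pos j
    set e1 := d.dftOne M (j 0, j 1) (j 2) - d.vertTransform (j 0, j 1) (j 2)
    set e2 := d.dftOne M (j 0, j 1) (-(j 2)) - d.vertTransform (j 0, j 1) (-(j 2))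
    set e3 := d.dftThree M j - d.sourceTransform j
    rw [coefL_sub, norm_mul]
    calc size j ^ 2 * (‖d.normFactor‖ * _)
        ≤ size j ^ 2 * (‖d.normFactor‖ * (A / size j * ‖e1‖ + A / size j * ‖e2‖ +
          A / size j ^ 2 * ‖e3‖)) := by
          gcongr
          refine (norm_add_le _ _).trans
            (add_le_add ((norm_sub_le _ _).trans (add_le_add ?_ ?_)) ?_)
          all_goals rw [norm_mul]; gcongr
      _ = _ := by field_simp
  calc (N : ℝ) ^ s * ∑ j ∈ indexBox N,
        size j ^ 2 * ‖d.coefL M j - d.normFactor * d.regCoef j‖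
      ≤ (N : ℝ) ^ s * ∑ j ∈ indexBox N, ‖d.normFactor‖ * A *
        (size j * ‖d.dftOne M (j 0, j 1) (j 2) - d.vertTransform (j 0, j 1) (j 2)‖ +
          size j * ‖d.dftOne M (j 0, j 1) (-(j 2)) - d.vertTransform (j 0, j 1) (-(j 2))‖ +
          ‖d.dftThree M j - d.sourceTransform j‖) :=
        mul_le_mul_of_nonneg_left (Finset.sum_le_sum fun j _ => hterm j) (by positivity)
    _ = ‖d.normFactor‖ * A * ((N : ℝ) ^ s * ∑ j ∈ indexBox N, size j *
        ‖d.dftOne M (j 0, j 1) (j 2) - d.vertTransform (j 0, j 1) (j 2)‖ +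
      (N : ℝ) ^ s * ∑ j ∈ indexBox N, size j *
        ‖d.dftOne M (j 0, j 1) (-(j 2)) - d.vertTransform (j 0, j 1) (-(j 2))‖ +
      (N : ℝ) ^ s * ∑ j ∈ indexBox N, ‖d.dftThree M j - d.sourceTransform j‖) := by
        rw [← Finset.mul_sum, Finset.sum_add_distrib, Finset.sum_add_distrib]
        ring
    _ ≤ _ := by gcongr

end Regular

end Data

/-! ### Cubic interpolation of exponentials -/

lemma norm_exp_I_mul_sub_le (t : ℝ) :
    ‖Complex.exp (Complex.I * t) - 1 - Complex.I * t‖ ≤ 3 * t ^ 2 := by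
  have hn : ‖Complex.I * (t : ℂ)‖ = |t| := by simp
  rcases le_total |t| 1 with ht | ht
  · have h1 := Complex.norm_exp_sub_one_sub_id_le (x := Complex.I * t) (by rwa [hn])
    rw [hn, sq_abs] at h1
    nlinarith [sq_nonneg t]
  · have h1 : ‖Complex.exp (Complex.I * t)‖ = 1 := by
      rw [mul_comm, Complex.norm_exp_ofReal_mul_I]
    have h2 : |t| ≤ t ^ 2 := by rw [← sq_abs]; nlinarith
    calc ‖Complex.exp (Complex.I * t) - 1 - Complex.I * t‖
        ≤ ‖Complex.exp (Complex.I * t)‖ + ‖(1 : ℂ)‖ + ‖Complex.I * (t : ℂ)‖ :=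
          (norm_sub_le _ _).trans (add_le_add_left (norm_sub_le _ _) _)
      _ = 1 + 1 + |t| := by rw [h1, hn, norm_one]
      _ ≤ 3 * t ^ 2 := by linarith

namespace CubicScheme

/-- Exactness on affine functions, expressed by this and the next identity, together with
boundedness of the weights, is all that is used of the schemes. It treats both at once and gives
second order, enough for a rate of at most 2. -/
lemma sum_weight (sch : CubicScheme) (s : ℝ) : ∑ a, sch.weight a s = 1 := by
  cases sch <;> simp [weight, Fin.sum_univ_four] <;> ring

lemma sum_weight_mul (sch : CubicScheme) (s : ℝ) :
    ∑ a, sch.weight a s * (((a : ℕ) : ℝ) - 1) = s := by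
  cases sch <;> simp [weight, Fin.sum_univ_four] <;> ring

lemma abs_weight_le (sch : CubicScheme) (a : Fin 4) {s : ℝ} (h0 : 0 ≤ s) (h1 : s ≤ 1) :
    |sch.weight a s| ≤ 5 := by
  have h2 : 0 ≤ s ^ 2 := by positivity
  have h3 : 0 ≤ s ^ 3 := by positivity
  have h2' : s ^ 2 ≤ 1 := pow_le_one₀ h0 h1
  have h3' : s ^ 3 ≤ 1 := pow_le_one₀ h0 h1
  rw [abs_le]
  cases sch <;> fin_cases a <;> simp [weight] <;> constructor <;> nlinarith

/-- The interpolant at `s` of the values `exp(i θ (a - 1))` at the nodes `a - 1`. -/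
def interpExp (sch : CubicScheme) (θ s : ℝ) : ℂ :=
  ∑ a : Fin 4, (sch.weight a s : ℂ) * Complex.exp (Complex.I * ((θ * (((a : ℕ) : ℝ) - 1) : ℝ) : ℂ))

lemma norm_interpExp_le (sch : CubicScheme) (θ : ℝ) {s : ℝ} (h0 : 0 ≤ s) (h1 : s ≤ 1) :
    ‖sch.interpExp θ s‖ ≤ 20 := by
  refine (norm_sum_le _ _).trans ?_
  have : ∀ a : Fin 4, ‖(sch.weight a s : ℂ) *
      Complex.exp (Complex.I * ((θ * (((a : ℕ) : ℝ) - 1) : ℝ) : ℂ))‖ ≤ 5 := fun a => by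
    rw [norm_mul, mul_comm Complex.I, Complex.norm_exp_ofReal_mul_I, mul_one, Complex.norm_real]
    exact sch.abs_weight_le a h0 h1
  refine (Finset.sum_le_sum fun a _ => this a).trans ?_
  simp
  norm_num

lemma norm_interpExp_sub_le_sq (sch : CubicScheme) (θ : ℝ) {s : ℝ} (h0 : 0 ≤ s) (h1 : s ≤ 1) :
    ‖sch.interpExp θ s - Complex.exp (Complex.I * ((θ * s : ℝ) : ℂ))‖ ≤ 93 * θ ^ 2 := by
  set r : ℝ → ℂ := fun t => Complex.exp (Complex.I * t) - 1 - Complex.I * t with hr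
  have hsplit : ∀ t : ℝ, Complex.exp (Complex.I * t) = 1 + Complex.I * t + r t := fun t => by
    rw [hr]; ring
  have e1 : sch.interpExp θ s = 1 + Complex.I * ((θ * s : ℝ) : ℂ) +
      ∑ a : Fin 4, (sch.weight a s : ℂ) * r (θ * (((a : ℕ) : ℝ) - 1)) := by
    have hw : ∑ a, (sch.weight a s : ℂ) = 1 := by exact_mod_cast sch.sum_weight s
    have hw' : ∑ a, (sch.weight a s : ℂ) * (((a : ℕ) : ℂ) - 1) = s := by
      exact_mod_cast sch.sum_weight_mul s
    calc sch.interpExp θ s = ∑ a : Fin 4, ((sch.weight a s : ℂ) +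
          Complex.I * θ * ((sch.weight a s : ℂ) * (((a : ℕ) : ℂ) - 1)) +
          (sch.weight a s : ℂ) * r (θ * (((a : ℕ) : ℝ) - 1))) := by
          refine Finset.sum_congr rfl fun a _ => ?_
          rw [hsplit]
          push_cast
          ring
      _ = _ := by
          rw [Finset.sum_add_distrib, Finset.sum_add_distrib, ← Finset.mul_sum, hw, hw']
          push_cast
          ring
  rw [e1, hsplit, add_sub_add_left_eq_sub]
  have hrs : ‖r (θ * s)‖ ≤ 3 * θ ^ 2 := by
    refine (norm_exp_I_mul_sub_le _).trans ?_
    have : s ^ 2 ≤ 1 := pow_le_one₀ h0 h1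
    rw [mul_pow]
    nlinarith [sq_nonneg θ]
  have hra : ∀ a : Fin 4, ‖(sch.weight a s : ℂ) * r (θ * (((a : ℕ) : ℝ) - 1))‖ ≤
      5 * (3 * (θ * (((a : ℕ) : ℝ) - 1)) ^ 2) := fun a => by
    rw [norm_mul, Complex.norm_real]
    exact mul_le_mul (sch.abs_weight_le a h0 h1) (norm_exp_I_mul_sub_le _) (norm_nonneg _)
      (by norm_num)
  -- The squared nodes add up to 1 + 0 + 1 + 4 = 6, so 93 = 5 · 3 · 6 + 3.
  calc _ ≤ (∑ a : Fin 4, 5 * (3 * (θ * (((a : ℕ) : ℝ) - 1)) ^ 2)) + 3 * θ ^ 2 :=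
        (norm_sub_le _ _).trans (add_le_add (norm_sum_le_of_le _ fun a _ => hra a) hrs)
    _ = 93 * θ ^ 2 := by
        simp [Fin.sum_univ_four]
        ring

/-- For |θ| ≤ 1 the quadratic bound implies the weaker powers; for |θ| ≥ 1 the trivial bound 20 + 1
is enough. -/
lemma norm_interpExp_sub_le (sch : CubicScheme) {r : ℕ} (hr : r ≤ 2) (θ : ℝ) {s : ℝ} (h0 : 0 ≤ s)
    (h1 : s ≤ 1) :
    ‖sch.interpExp θ s - Complex.exp (Complex.I * ((θ * s : ℝ) : ℂ))‖ ≤ 93 * |θ| ^ r := by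
  rcases le_total |θ| 1 with ht | ht
  · refine (sch.norm_interpExp_sub_le_sq θ h0 h1).trans ?_
    rw [← sq_abs]
    exact mul_le_mul_of_nonneg_left (pow_le_pow_of_le_one (abs_nonneg _) ht hr) (by norm_num)
  · have h2 : ‖Complex.exp (Complex.I * ((θ * s : ℝ) : ℂ))‖ = 1 := by
      rw [mul_comm, Complex.norm_exp_ofReal_mul_I]
    have h3 : 1 ≤ |θ| ^ r := one_le_pow₀ ht
    have := (norm_sub_le (sch.interpExp θ s) (Complex.exp (Complex.I * ((θ * s : ℝ) : ℂ))))
    linarith [sch.norm_interpExp_le θ h0 h1]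

end CubicScheme

lemma norm_prod_three_sub_le {P e : Fin 3 → ℂ} {K δ : ℝ} (hK : 1 ≤ K) (hP : ∀ i, ‖P i‖ ≤ K)
    (he : ∀ i, ‖e i‖ = 1) (hδ : ∀ i, ‖P i - e i‖ ≤ δ) :
    ‖∏ i, P i - ∏ i, e i‖ ≤ 3 * K ^ 2 * δ := by
  have hδ0 : 0 ≤ δ := (norm_nonneg _).trans (hδ 0)
  have h1 : ∏ i, P i - ∏ i, e i = (P 0 - e 0) * (P 1 * P 2) + e 0 * (P 1 - e 1) * P 2 +
      e 0 * e 1 * (P 2 - e 2) := by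
    simp only [Fin.prod_univ_three]
    ring
  have hK2 : K ≤ K ^ 2 := by nlinarith
  rw [h1]
  calc _ ≤ ‖(P 0 - e 0) * (P 1 * P 2)‖ + ‖e 0 * (P 1 - e 1) * P 2‖ +
        ‖e 0 * e 1 * (P 2 - e 2)‖ := norm_add₃_le
    _ = ‖P 0 - e 0‖ * (‖P 1‖ * ‖P 2‖) + ‖P 1 - e 1‖ * ‖P 2‖ + ‖P 2 - e 2‖ := by
        simp only [norm_mul, he, one_mul]
    _ ≤ δ * (K * K) + δ * K + δ := by
        gcongr
        exacts [hδ 0, hP 1, hP 2, hδ 1, hP 2, hδ 2]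
    _ ≤ 3 * K ^ 2 * δ := by nlinarith

/-! ### Truncation and tricubic interpolation of the Fourier series. -/

namespace Data

variable {d : Data} {m : ℕ}

/-- The interpolant of the grid values of `wave j`. -/
def interpWave (d : Data) (sch : CubicScheme) (N : ℕ) (j : Fin 3 → ℤ) (x : E3) : ℂ :=
  d.tricubic sch N (fun l => d.wave j (d.gridPoint N l)) x

lemma tricubic_gridValue (d : Data) (sch : CubicScheme) (N : ℕ) (a : (Fin 3 → ℤ) → ℂ) (x : E3) :
    d.tricubic sch N (d.gridValue N a) x =
      ∑ j ∈ indexBox N, a j * (d.normFactor * d.interpWave sch N j x) := by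
  simp only [tricubic, gridValue, interpWave, phi, Finset.mul_sum]
  rw [Finset.sum_comm]
  refine Finset.sum_congr rfl fun j _ => Finset.sum_congr rfl fun o _ => ?_
  ring

namespace Regular

lemma wave_eq_prod (h : d.Regular m) {N : ℕ} (hN : 0 < N) (j : Fin 3 → ℤ) (x : E3) :
    d.wave j x = ∏ i, Complex.exp (Complex.I *
      ((j i * Real.pi / N * (x i * N / d.halfPeriod i) : ℝ) : ℂ)) := by
  have hN' : (N : ℝ) ≠ 0 := by exact_mod_cast hN.ne'
  have hct := h.ct_pos.ne'
  have hpi := Real.pi_ne_zero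
  rw [wave, ← Complex.exp_sum, ← Finset.mul_sum, ← Complex.ofReal_sum]
  congr 3
  simp only [Fin.sum_univ_three, halfPeriod, Matrix.cons_val_zero, Matrix.cons_val_one,
    Matrix.cons_val]
  field_simp

/-- Plane waves and tensor-product weights both factor over the coordinates, so the interpolant is a
product of one-dimensional interpolants of exponentials. -/
lemma interpWave_eq (h : d.Regular m) (sch : CubicScheme) {N : ℕ} (hN : 0 < N) (j : Fin 3 → ℤ)
    (x : E3) :
    d.interpWave sch N j x = ∏ i, Complex.exp (Complex.I *
        ((j i * Real.pi / N * ⌊x i * N / d.halfPeriod i⌋ : ℝ) : ℂ)) *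
      sch.interpExp (j i * Real.pi / N) (Int.fract (x i * N / d.halfPeriod i)) := by
  have hN' : (N : ℝ) ≠ 0 := by exact_mod_cast hN.ne'
  simp only [CubicScheme.interpExp, Finset.mul_sum]
  rw [Finset.prod_univ_sum, interpWave, tricubic, Fintype.piFinset_univ]
  refine Finset.sum_congr rfl fun o _ => ?_
  rw [h.wave_eq_prod hN, Complex.ofReal_prod, ← Finset.prod_mul_distrib]
  refine Finset.prod_congr rfl fun i _ => ?_
  rw [mul_left_comm, ← Complex.exp_add]
  congr 2
  rw [← mul_add, ← Complex.ofReal_add]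
  congr 2
  have hp := (h.halfPeriod_pos i).ne'
  simp only [gridPoint]
  push_cast
  field_simp
  ring

lemma norm_interpWave_le (h : d.Regular m) (sch : CubicScheme) {N : ℕ} (hN : 0 < N)
    (j : Fin 3 → ℤ) (x : E3) : ‖d.interpWave sch N j x‖ ≤ 20 ^ 3 := by
  rw [h.interpWave_eq sch hN, norm_prod]
  calc _ ≤ ∏ _i : Fin 3, (20 : ℝ) := by
        refine Finset.prod_le_prod (fun i _ => norm_nonneg _) fun i _ => ?_
        rw [norm_mul, mul_comm Complex.I, Complex.norm_exp_ofReal_mul_I, one_mul]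
        exact sch.norm_interpExp_le _ (Int.fract_nonneg _) (Int.fract_lt_one _).le
    _ = _ := by simp

lemma norm_interpWave_sub_le (h : d.Regular m) (sch : CubicScheme) {N : ℕ} (hN : 0 < N) {r : ℕ}
    (hr : r ≤ 2) (j : Fin 3 → ℤ) (x : E3) :
    ‖d.interpWave sch N j x - d.wave j x‖ ≤
      3 * 20 ^ 2 * (93 * (Real.pi * (size j / N)) ^ r) := by
  have hN' : (0 : ℝ) < N := by exact_mod_cast hN
  rw [h.interpWave_eq sch hN, h.wave_eq_prod hN]
  refine norm_prod_three_sub_le (by norm_num) (fun i => ?_) (fun i => ?_) fun i => ?_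
  · rw [norm_mul, mul_comm Complex.I, Complex.norm_exp_ofReal_mul_I, one_mul]
    exact sch.norm_interpExp_le _ (Int.fract_nonneg _) (Int.fract_lt_one _).le
  · rw [mul_comm, Complex.norm_exp_ofReal_mul_I]
  · set u := x i * N / d.halfPeriod i with hu
    set θ : ℝ := j i * Real.pi / N with hθ
    have h1 : Complex.exp (Complex.I * ((θ * u : ℝ) : ℂ)) =
        Complex.exp (Complex.I * ((θ * ⌊u⌋ : ℝ) : ℂ)) *
          Complex.exp (Complex.I * ((θ * Int.fract u : ℝ) : ℂ)) := by
      rw [← Complex.exp_add, ← mul_add, ← Complex.ofReal_add, ← mul_add, Int.floor_add_fract]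
    rw [h1, ← mul_sub, norm_mul, mul_comm Complex.I, Complex.norm_exp_ofReal_mul_I, one_mul]
    refine (sch.norm_interpExp_sub_le hr θ (Int.fract_nonneg u) (Int.fract_lt_one u).le).trans ?_
    have h2 : |θ| ≤ Real.pi * (size j / N) := by
      rw [hθ, abs_div, abs_mul, abs_of_pos Real.pi_pos, abs_of_pos hN', mul_div_assoc,
        mul_comm |(j i : ℝ)|, div_mul_eq_mul_div, mul_div_assoc]
      have := one_add_abs_le_size j i
      have := Real.pi_pos
      gcongr
      linarith
    gcongr

/-- The error of the truncation and of the interpolation of a Fourier series with perturbed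
coefficients. -/
theorem norm_series_sub_tricubic_le (h : d.Regular m) (sch : CubicScheme) {N : ℕ} (hN : 0 < N)
    {r : ℕ} (hr : r ≤ 2) {A : (Fin 3 → ℤ) → ℂ} (hA : Summable fun j => ‖A j‖ * size j ^ r)
    (a : (Fin 3 → ℤ) → ℂ) (x : E3) :
    (N : ℝ) ^ r * ‖∑' j, A j * d.phi j x - d.tricubic sch N (d.gridValue N a) x‖ ≤
      ‖d.normFactor‖ * (3 * 20 ^ 2 * 93 * Real.pi ^ r * ∑' j, ‖A j‖ * size j ^ r +
        20 ^ 3 * ((N : ℝ) ^ r * ∑ j ∈ indexBox N, ‖a j - A j‖)) := by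
  classical
  have hN' : (0 : ℝ) < N := by exact_mod_cast hN
  set K : ℝ := 3 * 20 ^ 2 * 93 * Real.pi ^ r with hK
  have hpi : 1 ≤ Real.pi ^ r := one_le_pow₀ (by linarith [Real.pi_gt_three])
  have hK1 : 1 ≤ K := by rw [hK]; nlinarith
  set f : (Fin 3 → ℤ) → ℂ := fun j =>
    A j * (d.wave j x - if j ∈ indexBox N then d.interpWave sch N j x else 0) with hf
  have hfle : ∀ j, (N : ℝ) ^ r * ‖f j‖ ≤ K * (‖A j‖ * size j ^ r) := by
    intro j
    have hp := size_pos j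
    have key : ‖d.wave j x - if j ∈ indexBox N then d.interpWave sch N j x else 0‖ ≤
        K * (size j / N) ^ r := by
      split_ifs with hj
      · rw [norm_sub_rev]
        refine (h.norm_interpWave_sub_le sch hN hr j x).trans_eq ?_
        rw [mul_pow, hK]
        ring
      -- A truncated mode has size j ≥ N, so its full amplitude already fits the interpolation
      -- bound.
      · rw [sub_zero, norm_wave]
        rw [indexBox_eq, BoxFourier.mem_box] at hj
        have h1 : 1 ≤ size j / N := (one_le_div hN').2 (le_size_of_notMem hj)
        have h2 : 1 ≤ (size j / N) ^ r := one_le_pow₀ h1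
        nlinarith
    calc (N : ℝ) ^ r * ‖f j‖ ≤ (N : ℝ) ^ r * (‖A j‖ * (K * (size j / N) ^ r)) := by
          rw [hf]
          simp only [norm_mul]
          gcongr
      _ = K * (‖A j‖ * size j ^ r) := by
          rw [div_pow]
          field_simp
  have hfs : Summable fun j => (N : ℝ) ^ r * ‖f j‖ :=
    (hA.mul_left K).of_nonneg_of_le (fun j => by positivity) hfle
  have hfs' : Summable fun j => ‖f j‖ :=
    (summable_mul_left_iff (pow_pos hN' r).ne').1 hfs
  have hAs : Summable fun j => A j * d.wave j x := by
    refine Summable.of_norm (hA.of_nonneg_of_le (fun j => norm_nonneg _) fun j => ?_)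
    rw [norm_mul, norm_wave]
    have := one_le_pow₀ (n := r) (one_le_size j)
    gcongr
  have hsplit : ∑' j, A j * d.phi j x - d.tricubic sch N (d.gridValue N a) x =
      d.normFactor * (∑' j, f j - ∑ j ∈ indexBox N, (a j - A j) * d.interpWave sch N j x) := by
    have h1 : ∑ j ∈ indexBox N, A j * d.interpWave sch N j x =
        ∑' j, A j * if j ∈ indexBox N then d.interpWave sch N j x else 0 := by
      rw [tsum_eq_sum (s := indexBox N) fun j hj => by rw [if_neg hj, mul_zero]]
      exact Finset.sum_congr rfl fun j hj => by rw [if_pos hj]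
    have h2 : Summable fun j => A j * if j ∈ indexBox N then d.interpWave sch N j x else 0 :=
      summable_of_ne_finset_zero (s := indexBox N) fun j hj => by rw [if_neg hj, mul_zero]
    have h3 : ∑' j, f j =
        ∑' j, A j * d.wave j x - ∑ j ∈ indexBox N, A j * d.interpWave sch N j x := by
      rw [h1, ← hAs.tsum_sub h2]
      exact tsum_congr fun j => mul_sub _ _ _
    rw [h3, tricubic_gridValue]
    simp only [sub_mul, Finset.sum_sub_distrib, phi]
    rw [mul_sub, mul_sub, mul_sub, ← tsum_mul_left]
    rw [sub_sub, add_comm, sub_add_cancel, Finset.mul_sum]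
    congr 1
    · exact tsum_congr fun j => by ring
    · exact Finset.sum_congr rfl fun j _ => by ring
  rw [hsplit, norm_mul, mul_left_comm]
  refine mul_le_mul_of_nonneg_left ?_ (norm_nonneg _)
  calc (N : ℝ) ^ r * ‖∑' j, f j - ∑ j ∈ indexBox N, (a j - A j) * d.interpWave sch N j x‖
      ≤ (N : ℝ) ^ r * (∑' j, ‖f j‖ + ∑ j ∈ indexBox N, ‖a j - A j‖ * 20 ^ 3) := by
        gcongr
        refine (norm_sub_le _ _).trans (add_le_add (norm_tsum_le_tsum_norm hfs')
          (norm_sum_le_of_le _ fun j _ => ?_))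
        rw [norm_mul]
        gcongr
        exact h.norm_interpWave_le sch hN j x
    _ = ∑' j, (N : ℝ) ^ r * ‖f j‖ + 20 ^ 3 * ((N : ℝ) ^ r * ∑ j ∈ indexBox N, ‖a j - A j‖) := by
        rw [mul_add, tsum_mul_left, ← Finset.sum_mul]
        ring
    _ ≤ _ := by
        gcongr
        rw [← tsum_mul_left]
        exact hfs.tsum_le_tsum hfle (hA.mul_left K)

/-- The multiplier μ treats values (μ = 1) and second derivatives (μ = -c_p c_q) together; its
growth of order two is the reason for s + 2 ≤ m. The bound is uniform in μ. -/
lemma exists_norm_regular_sub_le (h : d.Regular m) {s : ℕ} (hs : s + 2 ≤ m) (hs2 : s ≤ 2) {D : ℝ}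
    (hD : 0 ≤ D) : ∃ B : ℝ, ∀ μ : (Fin 3 → ℤ) → ℂ, (∀ j, ‖μ j‖ ≤ D * size j ^ 2) →
      ∀ N M : ℕ, 1 ≤ N → N ≤ M → ∀ (sch : CubicScheme) (x : E3),
        (N : ℝ) ^ s * ‖∑' j, μ j * (d.normFactor * d.regCoef j) * d.phi j x -
          d.tricubic sch N (d.gridValue N fun j => μ j * d.coefL M j) x‖ ≤ B := by
  obtain ⟨B, hB, hal⟩ := h.exists_sum_coefL_sub_le hs
  set S := ∑' j, ‖d.normFactor‖ * D * (‖d.regCoef j‖ * size j ^ m) with hS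
  have hSs := h.summable_regCoef.mul_left (‖d.normFactor‖ * D)
  refine ⟨‖d.normFactor‖ * (3 * 20 ^ 2 * 93 * Real.pi ^ s * S + 20 ^ 3 * (D * B)),
    fun μ hμ N M hN hNM sch x => ?_⟩
  have hle : ∀ j, ‖μ j * (d.normFactor * d.regCoef j)‖ * size j ^ s ≤
      ‖d.normFactor‖ * D * (‖d.regCoef j‖ * size j ^ m) := fun j => by
    have hp := size_pos j
    rw [norm_mul, norm_mul]
    calc ‖μ j‖ * (‖d.normFactor‖ * ‖d.regCoef j‖) * size j ^ s
        ≤ D * size j ^ 2 * (‖d.normFactor‖ * ‖d.regCoef j‖) * size j ^ s := by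
          gcongr
          exact hμ j
      _ = ‖d.normFactor‖ * D * (‖d.regCoef j‖ * size j ^ (s + 2)) := by ring
      _ ≤ _ := by
          gcongr
          exact one_le_size j
  have hA : Summable fun j => ‖μ j * (d.normFactor * d.regCoef j)‖ * size j ^ s :=
    hSs.of_nonneg_of_le (fun j => by have := size_pos j; positivity) hle
  refine (h.norm_series_sub_tricubic_le sch (by omega) hs2 hA _ x).trans ?_
  refine mul_le_mul_of_nonneg_left (add_le_add ?_ ?_) (norm_nonneg _)
  · have hpi := Real.pi_pos
    gcongr
    exact hA.tsum_le_tsum hle hSs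
  · refine mul_le_mul_of_nonneg_left ?_ (by norm_num)
    calc (N : ℝ) ^ s * ∑ j ∈ indexBox N,
          ‖μ j * d.coefL M j - μ j * (d.normFactor * d.regCoef j)‖
        ≤ (N : ℝ) ^ s * ∑ j ∈ indexBox N,
          D * (size j ^ 2 * ‖d.coefL M j - d.normFactor * d.regCoef j‖) := by
          gcongr with j hj
          rw [← mul_sub, norm_mul, ← mul_assoc]
          gcongr
          exact hμ j
      _ = D * ((N : ℝ) ^ s * ∑ j ∈ indexBox N,
          size j ^ 2 * ‖d.coefL M j - d.normFactor * d.regCoef j‖) := by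
          rw [← Finset.mul_sum]; ring
      _ ≤ D * B := by
          gcongr
          exact hal N M hN hNM

/-- The error estimate for cut-off functions that are smooth on the line and equal to one on the
negative half line. -/
theorem exists_norm_greenTensor_sub_le (h : d.Regular m) {s : ℕ} (hs : s + 2 ≤ m) (hs2 : s ≤ 2) :
    ∃ C : ℝ, ∀ N M : ℕ, 1 ≤ N → N ≤ M → ∀ sch : CubicScheme, ∀ x ∈ d.cell, x ≠ 0 →
      ∀ p q : Fin 3, ‖d.greenTensor x p q - d.numGreenTensor sch N M x p q‖ ≤ C / (N : ℝ) ^ s := by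
  obtain ⟨Cf, hCf, hf⟩ := h.abs_freq_le
  obtain ⟨B, hB⟩ := h.exists_norm_regular_sub_le hs hs2 (D := 1 + Cf ^ 2) (by positivity)
  refine ⟨B + ‖1 / (d.k : ℂ) ^ 2‖ * B, fun N M hN hNM sch x hx hx0 p q => ?_⟩
  obtain ⟨-, hg, hgd⟩ := h.green_spec hx hx0
  have hN' : (0 : ℝ) < (N : ℝ) ^ s := by positivity
  have hwave : ∀ μ : (Fin 3 → ℤ) → ℂ, d.waveSeries (fun j => μ j * d.waveCoef j) x =
      d.phase x * ∑' j, μ j * (d.normFactor * d.regCoef j) * d.phi j (reduce x) := fun μ => by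
    rw [waveSeries, ← tsum_mul_left]
    refine tsum_congr fun j => ?_
    rw [planeWave, ← phase_mul_wave, phi, wave_reduce, waveCoef]
    ring
  have e1 : N ^ s * ‖d.green x - d.numGreen sch N M x‖ ≤ B := by
    have h1 := hB (fun _ => 1) (fun j => by
      have := one_le_pow₀ (n := 2) (one_le_size j)
      rw [norm_one]
      nlinarith [sq_nonneg Cf]) N M hN hNM sch (reduce x)
    have h2 := hwave fun _ => 1
    simp only [one_mul] at h1 h2
    -- The singular part is the same in the exact and the computed value and drops out.
    rw [hg, h2, numGreen, mul_add, add_sub_add_right_eq_sub, ← mul_sub, norm_mul, norm_phase,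
      one_mul]
    exact h1
  have e2 : N ^ s * ‖pderiv p (pderiv q d.green) x - d.numGreenDeriv sch N M p q x‖ ≤ B := by
    have h1 := hB (fun j => -(d.freq j p : ℂ) * d.freq j q) (fun j => by
      have hp := size_pos j
      rw [norm_mul, norm_neg, Complex.norm_real, Complex.norm_real, Real.norm_eq_abs,
        Real.norm_eq_abs]
      calc |d.freq j p| * |d.freq j q| ≤ Cf * size j * (Cf * size j) :=
            mul_le_mul (hf j p) (hf j q) (abs_nonneg _) (by positivity)
        _ ≤ (1 + Cf ^ 2) * size j ^ 2 := by nlinarith [sq_nonneg (size j)])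
      N M hN hNM sch (reduce x)
    rw [hgd, hwave, numGreenDeriv, mul_add, add_sub_add_right_eq_sub, ← mul_sub, norm_mul,
      norm_phase, one_mul]
    exact h1
  have e3 : ‖d.greenTensor x p q - d.numGreenTensor sch N M x p q‖ ≤
      ‖d.green x - d.numGreen sch N M x‖ +
        ‖1 / (d.k : ℂ) ^ 2‖ * ‖pderiv p (pderiv q d.green) x - d.numGreenDeriv sch N M p q x‖ := by
    have : d.greenTensor x p q - d.numGreenTensor sch N M x p q =
        (d.green x - d.numGreen sch N M x) * (1 : Matrix (Fin 3) (Fin 3) ℂ) p q +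
        1 / (d.k : ℂ) ^ 2 *
          (pderiv p (pderiv q d.green) x - d.numGreenDeriv sch N M p q x) := by
      simp only [greenTensor, numGreenTensor, Matrix.add_apply, Matrix.smul_apply, Matrix.of_apply,
        smul_eq_mul]
      ring
    rw [this]
    refine (norm_add_le _ _).trans (add_le_add ?_ (norm_mul _ _).le)
    rw [norm_mul]
    refine mul_le_of_le_one_right (norm_nonneg _) ?_
    rw [Matrix.one_apply]
    split_ifs <;> simp
  rw [le_div_iff₀ hN']
  calc _ ≤ (‖d.green x - d.numGreen sch N M x‖ + ‖1 / (d.k : ℂ) ^ 2‖ *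
        ‖pderiv p (pderiv q d.green) x - d.numGreenDeriv sch N M p q x‖) * (N : ℝ) ^ s := by
        gcongr
    _ = N ^ s * ‖d.green x - d.numGreen sch N M x‖ + ‖1 / (d.k : ℂ) ^ 2‖ *
        (N ^ s * ‖pderiv p (pderiv q d.green) x - d.numGreenDeriv sch N M p q x‖) := by ring
    _ ≤ _ := by gcongr

end Regular

end Data

/-! ### Extension of the cut-off functions to the negative half line -/

/-- The function `f` with its values on the negative half line replaced by one. -/
def patch (f : ℝ → ℝ) (t : ℝ) : ℝ := if t ≤ 0 then 1 else f t

lemma patch_eventuallyEq (f : ℝ → ℝ) {t : ℝ} (ht : 0 < t) : patch f =ᶠ[𝓝 t] f := by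
  filter_upwards [Ioi_mem_nhds ht] with y hy
  exact if_neg (not_le.2 hy)

lemma patch_eq_one {f : ℝ → ℝ} {a : ℝ} (hf : ∀ t ∈ Set.Icc 0 a, f t = 1) {t : ℝ} (ht : t ≤ a) :
    patch f t = 1 := by
  rw [patch]
  split_ifs with h0
  · rfl
  · exact hf t ⟨(not_le.1 h0).le, ht⟩

lemma patch_eq {f : ℝ → ℝ} (hf : f 0 = 1) {t : ℝ} (ht : 0 ≤ t) : patch f t = f t := by
  rw [patch]
  split_ifs with h0
  · rw [le_antisymm h0 ht, hf]
  · rfl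

/-- Below a the patched function is constant, and at positive points it agrees locally with `f`; the
two regions cover the line. -/
lemma contDiff_patch {f : ℝ → ℝ} {n : WithTop ℕ∞} (hf : ContDiffOn ℝ n f (Set.Ici 0)) {a : ℝ}
    (ha : 0 < a) (h1 : ∀ t ∈ Set.Icc 0 a, f t = 1) : ContDiff ℝ n (patch f) := by
  rw [contDiff_iff_contDiffAt]
  intro t
  rcases lt_or_ge t a with hta | hta
  · refine (contDiffAt_const (c := (1 : ℝ))).congr_of_eventuallyEq ?_
    filter_upwards [Iio_mem_nhds hta] with y hy
    exact patch_eq_one h1 (le_of_lt hy)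
  · have ht : 0 < t := ha.trans_le hta
    exact (hf.contDiffAt (Ici_mem_nhds ht)).congr_of_eventuallyEq (patch_eventuallyEq f ht)

namespace Data

variable {d : Data}

/-- The data with patched cut-off functions. -/
def patched (d : Data) : Data := { d with χ := patch d.χ, Y := patch d.Y }

lemma F_patched (hY : d.Y 0 = 1) : d.patched.F = d.F := by
  ext x
  change (d.phase x)⁻¹ * d.fundSol x * (patch d.Y ‖x‖ : ℂ) = _
  rw [patch_eq hY (norm_nonneg x)]
  rfl

lemma Fpq_patched (hY : d.Y 0 = 1) (p q : Fin 3) : d.patched.Fpq p q = d.Fpq p q := by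
  ext x
  rw [Fpq, F_patched hY]
  rfl

lemma dftOne_patched (hct : 0 < d.ct) {a : ℝ} (ha : 0 < a) (hχ : ∀ t, |t| ≤ a → d.χ t = 1)
    (M : ℕ) (n : ℤ × ℤ) (j₃ : ℤ) : d.patched.dftOne M n j₃ = d.dftOne M n j₃ := by
  have hderiv : ∀ t : ℝ, 0 ≤ t → deriv (patch d.χ) t = deriv d.χ t := fun t ht => by
    rcases ht.eq_or_lt with rfl | ht
    -- The grid contains t = 0. There the two-sided hypothesis on χ makes both functions equal to 1
    -- nearby.
    · have hev : patch d.χ =ᶠ[𝓝 0] d.χ := by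
        filter_upwards [Ioo_mem_nhds (neg_neg_of_pos ha) ha] with y hy
        rw [hχ y (abs_le.2 ⟨hy.1.le, hy.2.le⟩)]
        exact patch_eq_one (a := a) (fun t ht => hχ t (by rw [abs_of_nonneg ht.1]; exact ht.2))
          hy.2.le
      exact hev.deriv_eq
    · exact (patch_eventuallyEq d.χ ht).deriv_eq
  rw [dftOne, dftOne]
  congr 1
  refine Finset.sum_congr rfl fun l _ => ?_
  change _ * ((deriv (patch d.χ) (l * d.ct / M) : ℝ) : ℂ) * _ = _
  rw [hderiv _ (by positivity)]
  rfl

/-- At the grid point 0 the derivatives of Y may depend on its values on the negative axis, but they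
are multiplied by `fundSol`, which is 0 there by the convention for division by zero. -/
lemma dftThree_patched (d : Data) (M : ℕ) (j : Fin 3 → ℤ) :
    d.patched.dftThree M j = d.dftThree M j := by
  rw [dftThree, dftThree]
  congr 1
  refine Finset.sum_congr rfl fun l _ => ?_
  change d.fundSol (d.gridPoint M l) *
    (2 * Complex.I * (d.k : ℂ) * ((deriv (patch d.Y) ‖d.gridPoint M l‖ : ℝ) : ℂ) +
      ((deriv (deriv (patch d.Y)) ‖d.gridPoint M l‖ : ℝ) : ℂ)) *
    (d.phase (d.gridPoint M l))⁻¹ * (d.wave j (d.gridPoint M l))⁻¹ = _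
  rcases (norm_nonneg (d.gridPoint M l)).eq_or_lt with h0 | h0
  · have : d.fundSol (d.gridPoint M l) = 0 := by rw [fundSol, ← h0]; simp
    rw [this]
    simp
  · have h1 := patch_eventuallyEq d.Y h0
    rw [h1.deriv_eq, h1.deriv.deriv_eq]

lemma coefL_patched (hct : 0 < d.ct) {a : ℝ} (ha : 0 < a) (hχ : ∀ t, |t| ≤ a → d.χ t = 1)
    (M : ℕ) : d.patched.coefL M = d.coefL M := by
  ext j
  rw [coefL, coefK, coefF, dftThree_patched, dftOne_patched hct ha hχ, dftOne_patched hct ha hχ]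
  rfl

lemma numGreenTensor_patched (hct : 0 < d.ct) {a : ℝ} (ha : 0 < a)
    (hχ : ∀ t, |t| ≤ a → d.χ t = 1) (hY : d.Y 0 = 1) (sch : CubicScheme) (N M : ℕ) (x : E3) :
    d.patched.numGreenTensor sch N M x = d.numGreenTensor sch N M x := by
  have h1 : d.patched.numGreen sch N M x = d.numGreen sch N M x := by
    rw [numGreen, coefL_patched hct ha hχ, F_patched hY]
    rfl
  have h2 : ∀ p q, d.patched.numGreenDeriv sch N M p q x = d.numGreenDeriv sch N M p q x :=
    fun p q => by
      have : d.patched.coefLpq M p q = d.coefLpq M p q := by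
        ext j
        rw [coefLpq, coefL_patched hct ha hχ]
        rfl
      rw [numGreenDeriv, this, Fpq_patched hY]
      rfl
  rw [numGreenTensor, numGreenTensor, h1]
  simp only [h2]
  rfl

end Data

end MaxwellGreen

end

theorem theorem4p6 (d : MaxwellGreen.Data) (m : ℕ) (hm : 2 < m)
    (hk : 0 < d.k) (hc : 0 < d.c) (hct : d.c < d.ct)
    (hε : 0 < d.ε) (hε' : d.ε < min 1 d.ct / 2)
    (hχ : ContDiff ℝ ((m + 3 : ℕ) : WithTop ℕ∞) d.χ)
    (hχ1 : ∀ t : ℝ, |t| ≤ d.c → d.χ t = 1)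
    (hχ0 : ∀ t : ℝ, (d.c + d.ct) / 2 ≤ |t| → d.χ t = 0)
    (hY : ContDiffOn ℝ ((m + 3 : ℕ) : WithTop ℕ∞) d.Y (Set.Ici 0))
    (hY1 : ∀ t ∈ Set.Icc 0 d.ε, d.Y t = 1)
    (hY0 : ∀ t : ℝ, 2 * d.ε ≤ t → d.Y t = 0)
    (hWood : ∀ n : ℤ × ℤ, d.beta n ≠ 0)
    (hres : ∀ (n : ℤ × ℤ) (j₃ : ℤ), d.beta n ≠ ((j₃ * Real.pi / d.ct : ℝ) : ℂ)) :
    (∀ x ∈ d.cell, x ≠ 0 → ContDiffAt ℝ 2 d.green x) ∧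
    ∃ C : ℝ, ∀ N M : ℕ, 1 ≤ N → N ≤ M → ∀ sch : MaxwellGreen.CubicScheme,
      ∀ x ∈ d.cell, x ≠ 0 → ∀ p q : Fin 3,
        ‖d.greenTensor x p q - d.numGreenTensor sch N M x p q‖
          ≤ C / (N : ℝ) ^ (min 2 (m - 2)) := by
  have hmin : 2 * d.ε < min 1 d.ct := by linarith
  have hct0 : 0 < d.ct := hc.trans hct
  have hY00 : d.Y 0 = 1 := hY1 0 ⟨le_rfl, hε.le⟩
  have hχ1' : ∀ t ∈ Set.Icc 0 d.c, d.χ t = 1 := fun t ht =>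
    hχ1 t (by rw [abs_of_nonneg ht.1]; exact ht.2)
  -- Y is controlled only on the half line, and χ is even-type near zero but vanishes far to the
  -- left. Patching makes both globally smooth with derivatives supported on the positive axis, and
  -- changes neither the Green's function nor the computed tensor.
  have h : d.patched.Regular m :=
    { two_lt := hm
      k_pos := hk
      c_pos := hc
      c_lt := hct
      ε_pos := hε
      ε_lt_one := hmin.trans_le (min_le_left _ _)
      ε_lt_ct := hmin.trans_le (min_le_right _ _)
      contDiff_χ := MaxwellGreen.contDiff_patch hχ.contDiffOn hc hχ1'
      χ_one := fun t ht => MaxwellGreen.patch_eq_one hχ1' ht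
      χ_zero := fun t (ht : (d.c + d.ct) / 2 ≤ t) => by
        have h0 : 0 < t := by linarith
        exact (if_neg (not_le.2 h0)).trans (hχ0 t (by rwa [abs_of_pos h0]))
      contDiff_Y := MaxwellGreen.contDiff_patch hY hε hY1
      Y_one := fun t ht => MaxwellGreen.patch_eq_one hY1 ht
      Y_zero := fun t (ht : 2 * d.ε ≤ t) => by
        have h0 : 0 < t := by linarith
        exact (if_neg (not_le.2 h0)).trans (hY0 t ht)
      beta_ne := hWood
      beta_ne' := hres }
  refine ⟨fun x hx hx0 => (h.green_spec (x := x) hx hx0).1, ?_⟩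
  -- Since m > 2, the truncated subtraction m - 2 is the true one, so s + 2 ≤ m and s ≤ 2 hold.
  obtain ⟨C, hC⟩ := h.exists_norm_greenTensor_sub_le (s := min 2 (m - 2)) (by omega) (by omega)
  refine ⟨C, fun N M hN hNM sch x hx hx0 p q => ?_⟩
  have key := hC N M hN hNM sch x hx hx0 p q
  rw [MaxwellGreen.Data.numGreenTensor_patched hct0 hc hχ1 hY00] at key
  exact key
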